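/- **Proposition (decomposition of the minorant).** Notation: $p,q,q_j$ denote primes; $m\sim M$ means $M<m\le 2M$; $d$ is the divisor function; $P(z)=\prod_{p<z}p$ and $\rho(n,z)=1_{(n,P(z))=1}$. For $X\ge 3$ and $\varepsilon, A>0$ put $z=X^{2/11}$, $z_0=\exp\big((\log X)/(\log\log X)^3\big)$, $\delta_A=(\log X)^{-10A}$ and $$\rho^-(n)=\rho(n,z)-\sum_{\substack{n=qm\\ z\le q<2X^{1/2}}}\rho(m,z)+\sum_{\substack{n=q_1q_2m\\ z\le q_2<q_1<X^{1/4-2\varepsilon}\\ q_1q_2^4<X^{1-2\varepsilon}}}\rho(m,z)-\sum_{\substack{n=q_1q_2q_3m\\ z\le q_3<q_2<q_1<X^{1/4-2\varepsilon}\\ q_1q_2^4<X^{1-2\varepsilon}}}\rho(m,z).$$ There is $\varepsilon_0>0$ such that the following holds for every fixed $\varepsilon\in(0,\varepsilon_0]$. There are constants $C,K$ and $B\in\mathbb{N}$, depending only on $\varepsilon$, and for every real $A\ge5$ a constant $C_A$, depending only on $\varepsilon$ and $A$, such that for all real $X\ge 3$ and $Y\in(X^{1-\varepsilon/100},X/2]$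 there are a finite set $\mathcal F$ of at most $C\exp((\log\log X)^5)$ functions $f:\mathbb{N}\to\mathbb{C}$ and a sequence $c_n$ of complex numbers with $$\rho^-(n)1_{n\in(Y/2,4Y]}=\sum_{f\in\mathcal F}f(n)+c_n\quad\text{for all } n,$$ where $c_n$ is supported on $(Y/4,8Y]$ and $$\sum_n|c_n|^2\le C_A\frac{Y}{(\log X)^A}.$$ Furthermore, for each $f\in\mathcal F$ one of the following holds for some complex coefficients $\alpha_m,\beta_m$ bounded in absolute value by $K\,d(m)^B$ for all $m\geq 1$, and some positive real $M_1,M_2,M_3$: (i) (Type I) $\displaystyle f(n)=\sum_{\substack{n=m_1m_2\\ m_1\sim M_1\\ M_2<m_2\le(1+\delta_A)M_2}}\alpha_{m_1}$ with $M_1\le X^{1/2+\varepsilon}$ and $M_1M_2\in(Y/2,4Y]$. (ii) (Type I/II) $\displaystyle f(n)=\sum_{\substack{n=m_1m_2m_3\\ m_1\sim M_1,\ m_2\sim M_2\\ M_3<m_3\le(1+\delta_A)M_3}}\alpha_{m_1}\beta_{m_2}$ with $M_1^2M_2\le X^{1-\varepsilon}$, $M_2\le X^{1/4-\varepsilon}$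 and $M_1M_2M_3\in(Y/2,4Y]$. (iii) (Type II) For some $R\in\{1,\dots,\lfloor\frac{\log z}{\log z_0}\rfloor\}$, $\displaystyle f(n)=\sum_{\substack{n=m_1m_2\\ M_1<m_1\le(1+\delta_A)^RM_1\\ m_2\sim M_2}}\alpha_{m_1}\beta_{m_2}$ with $X^{\varepsilon/2}\le M_1\le z$, $M_1M_2\in(Y/2,4Y]$ and $$\alpha_m=\sum_{\substack{m=q_1\cdots q_R\\ Q_j<q_j\le Q_j(1+\delta_A)}}1,$$ where $Q_1,\dots,Q_R\in[z_0,z)$ are real numbers with $Q_1\cdots Q_R=M_1$. -/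

import Mathlib

namespace HarmanMinorant

/-- `P(z)`, the product of all primes `p < z`. -/
noncomputable def primorialBelow (z : ℝ) : ℕ :=
  ∏ p ∈ (Finset.range ⌈z⌉₊).filter Nat.Prime, p

/-- `ρ(n, z)`, the indicator function of `(n, P(z)) = 1`. -/
noncomputable def rho (n : ℕ) (z : ℝ) : ℝ :=
  if Nat.Coprime n (primorialBelow z) then 1 else 0

/-- The sieve level `z = X ^ (2 / 11)`. -/
noncomputable def zLevel (X : ℝ) : ℝ := X ^ (2 / 11 : ℝ)

/-- `z₀ = exp (log X / (log log X) ^ 3)`. -/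
noncomputable def z₀Level (X : ℝ) : ℝ :=
  Real.exp (Real.log X / Real.log (Real.log X) ^ 3)

/-- `δ_A = (log X) ^ (- 10 A)`. -/
noncomputable def delta (A X : ℝ) : ℝ := Real.log X ^ (-(10 * A))

/-- The sum of `ρ(m, z)` over `n = q m` with `q` prime and `z ≤ q < 2 X ^ (1 / 2)`. -/
noncomputable def rhoSum₁ (X : ℝ) (n : ℕ) : ℝ :=
  ∑ t ∈ n.divisorsAntidiagonal.filter (fun t : ℕ × ℕ =>
      t.1.Prime ∧ zLevel X ≤ (t.1 : ℝ) ∧ (t.1 : ℝ) < 2 * X ^ (1 / 2 : ℝ)),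
    rho t.2 (zLevel X)

/-- The sum of `ρ(m, z)` over `n = q₁ q₂ m` with `q₁, q₂` prime,
`z ≤ q₂ < q₁ < X ^ (1 / 4 - 2 ε)` and `q₁ q₂ ^ 4 < X ^ (1 - 2 ε)`.
Here `Nat.finMulAntidiag 3 n` is the set of all triples of natural numbers with product `n ≠ 0`. -/
noncomputable def rhoSum₂ (ε X : ℝ) (n : ℕ) : ℝ :=
  ∑ t ∈ (Nat.finMulAntidiag 3 n).filter (fun t : Fin 3 → ℕ =>
      (t 0).Prime ∧ (t 1).Prime ∧
      zLevel X ≤ (t 1 : ℝ) ∧ t 1 < t 0 ∧ (t 0 : ℝ) < X ^ (1 / 4 - 2 * ε) ∧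
      (t 0 : ℝ) * (t 1 : ℝ) ^ 4 < X ^ (1 - 2 * ε)),
    rho (t 2) (zLevel X)

/-- The sum of `ρ(m, z)` over `n = q₁ q₂ q₃ m` with `q₁, q₂, q₃` prime,
`z ≤ q₃ < q₂ < q₁ < X ^ (1 / 4 - 2 ε)` and `q₁ q₂ ^ 4 < X ^ (1 - 2 ε)`. -/
noncomputable def rhoSum₃ (ε X : ℝ) (n : ℕ) : ℝ :=
  ∑ t ∈ (Nat.finMulAntidiag 4 n).filter (fun t : Fin 4 → ℕ =>
      (t 0).Prime ∧ (t 1).Prime ∧ (t 2).Prime ∧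
      zLevel X ≤ (t 2 : ℝ) ∧ t 2 < t 1 ∧ t 1 < t 0 ∧ (t 0 : ℝ) < X ^ (1 / 4 - 2 * ε) ∧
      (t 0 : ℝ) * (t 1 : ℝ) ^ 4 < X ^ (1 - 2 * ε)),
    rho (t 3) (zLevel X)

/-- The minorant `ρ⁻(n)` (depending on `ε` and `X`). -/
noncomputable def rhoMinus (ε X : ℝ) (n : ℕ) : ℝ :=
  rho n (zLevel X) - rhoSum₁ X n + rhoSum₂ ε X n - rhoSum₃ ε X n

/-- `|α(m)| ≤ K d(m) ^ B` for all `m ≥ 1`. -/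
def DivisorBounded (K : ℝ) (B : ℕ) (α : ℕ → ℂ) : Prop :=
  ∀ m : ℕ, 1 ≤ m → ‖α m‖ ≤ K * (m.divisors.card : ℝ) ^ B

/-- `m ∼ M`, that is `M < m ≤ 2 M`. -/
def Dyadic (M : ℝ) (m : ℕ) : Prop := M < (m : ℝ) ∧ (m : ℝ) ≤ 2 * M

open Classical in
/-- The sum of `α(m₁)` over `n = m₁ m₂`, `m₁ ∼ M₁`, `M₂ < m₂ ≤ (1 + δ) M₂`. -/
noncomputable def sumTypeI (δ M₁ M₂ : ℝ) (α : ℕ → ℂ) (n : ℕ) : ℂ :=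
  ∑ t ∈ n.divisorsAntidiagonal.filter (fun t : ℕ × ℕ =>
      Dyadic M₁ t.1 ∧ M₂ < (t.2 : ℝ) ∧ (t.2 : ℝ) ≤ (1 + δ) * M₂),
    α t.1

open Classical in
/-- The sum of `α(m₁) β(m₂)` over `n = m₁ m₂ m₃`, `m₁ ∼ M₁`, `m₂ ∼ M₂`,
`M₃ < m₃ ≤ (1 + δ) M₃`. -/
noncomputable def sumTypeI_II (δ M₁ M₂ M₃ : ℝ) (α β : ℕ → ℂ) (n : ℕ) : ℂ :=
  ∑ t ∈ (Nat.finMulAntidiag 3 n).filter (fun t : Fin 3 → ℕ =>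
      Dyadic M₁ (t 0) ∧ Dyadic M₂ (t 1) ∧ M₃ < (t 2 : ℝ) ∧ (t 2 : ℝ) ≤ (1 + δ) * M₃),
    α (t 0) * β (t 1)

open Classical in
/-- The sum of `α(m₁) β(m₂)` over `n = m₁ m₂`, `M₁ < m₁ ≤ (1 + δ) ^ R M₁`, `m₂ ∼ M₂`. -/
noncomputable def sumTypeII (δ : ℝ) (R : ℕ) (M₁ M₂ : ℝ) (α β : ℕ → ℂ) (n : ℕ) : ℂ :=
  ∑ t ∈ n.divisorsAntidiagonal.filter (fun t : ℕ × ℕ =>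
      M₁ < (t.1 : ℝ) ∧ (t.1 : ℝ) ≤ (1 + δ) ^ R * M₁ ∧ Dyadic M₂ t.2),
    α t.1 * β t.2

/-- The number of ways to write `m = q₁ ⋯ q_R` with primes `Q_j < q_j ≤ Q_j (1 + δ)`. -/
noncomputable def primeProductCoeff (δ : ℝ) (R : ℕ) (Q : Fin R → ℝ) (m : ℕ) : ℂ :=
  ∑ _q ∈ (Nat.finMulAntidiag R m).filter (fun q : Fin R → ℕ =>
      ∀ j, (q j).Prime ∧ Q j < (q j : ℝ) ∧ (q j : ℝ) ≤ Q j * (1 + δ)),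
    (1 : ℂ)

/-- `f` is a type I sum. -/
def IsTypeI (K : ℝ) (B : ℕ) (ε A X Y : ℝ) (f : ℕ → ℂ) : Prop :=
  ∃ (α : ℕ → ℂ) (M₁ M₂ : ℝ), DivisorBounded K B α ∧ 0 < M₁ ∧ 0 < M₂ ∧
    M₁ ≤ X ^ (1 / 2 + ε) ∧
    Y / 2 < M₁ * M₂ ∧ M₁ * M₂ ≤ 4 * Y ∧
    ∀ n, f n = sumTypeI (delta A X) M₁ M₂ α n

/-- `f` is a type I/II sum. -/
def IsTypeI_II (K : ℝ) (B : ℕ) (ε A X Y : ℝ) (f : ℕ → ℂ) : Prop :=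
  ∃ (α β : ℕ → ℂ) (M₁ M₂ M₃ : ℝ), DivisorBounded K B α ∧ DivisorBounded K B β ∧
    0 < M₁ ∧ 0 < M₂ ∧ 0 < M₃ ∧
    M₁ ^ 2 * M₂ ≤ X ^ (1 - ε) ∧ M₂ ≤ X ^ (1 / 4 - ε) ∧
    Y / 2 < M₁ * M₂ * M₃ ∧ M₁ * M₂ * M₃ ≤ 4 * Y ∧
    ∀ n, f n = sumTypeI_II (delta A X) M₁ M₂ M₃ α β n

/-- `f` is a type II sum whose first variable is a product of `R` primes. -/
def IsTypeII (K : ℝ) (B : ℕ) (ε A X Y : ℝ) (f : ℕ → ℂ) : Prop :=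
  ∃ (α β : ℕ → ℂ) (R : ℕ) (M₁ M₂ : ℝ) (Q : Fin R → ℝ),
    DivisorBounded K B α ∧ DivisorBounded K B β ∧ 0 < M₂ ∧
    1 ≤ R ∧ R ≤ ⌊Real.log (zLevel X) / Real.log (z₀Level X)⌋₊ ∧
    X ^ (ε / 2) ≤ M₁ ∧ M₁ ≤ zLevel X ∧
    Y / 2 < M₁ * M₂ ∧ M₁ * M₂ ≤ 4 * Y ∧
    (∀ j, z₀Level X ≤ Q j ∧ Q j < zLevel X) ∧ ∏ j, Q j = M₁ ∧
    (∀ m, α m = primeProductCoeff (delta A X) R Q m) ∧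
    ∀ n, f n = sumTypeII (delta A X) R M₁ M₂ α β n

end HarmanMinorant

/-! ### Dirichlet convolution ring, pointwise domination, and the ideal of functions vanishing on
the divisors of `n`. -/

namespace HarmanMinorant

open Finset

/-! By Legendre's formula, `ρ(·, z)` is the Dirichlet convolution of `∏_{p < z} (1 - pt p)` with
`constOne`, and the minorant is `(1 - w₁ + w₂ - w₃) * ρ(·, z)`, where `wⱼ` collects the `j` primes
pulled out (`rhoMinus_eq`). The product is then modified in ways that matter at few integers only. A
value at `n` depends only on the class modulo `vanishIdeal n`, so each modification is a congruence
that holds unless `n` has a divisor of a rare shape or lies outside the range considered.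

For the primes up to `z₀`, the product is expanded and divisors above `X ^ (ε / 4)` are dropped. The
primes between `z₀` and `z` are grouped into cells of ratio `1 + δ`. Unless two primes of one cell
divide `n`, that cell contributes `1 - ∑ pt p`, so the product becomes a signed sum over sets `S` of
cells, each with an approximate size `cellVal S`.

Sets of size below `X ^ (ε / 2)`, combined with `1 - w₁ + w₂`, give a coefficient supported up to `X
^ (1/2 + ε)`: type I. Combined with `w₃`, once the conditions linking `q₁` and `q₂` are replaced by
conditions on their cells, the grouping `m₁ = q₂ q₃`, `m₂ = q₁ ·` (Möbius divisor) works, because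
`m₁² m₂` is at most `q₁ q₂⁴` up to a small power of `X`: type I/II. If `S` is larger, a minimal
subset reaching `X ^ (ε / 2)` has size at most `z` (`exists_subset_cellVal`). Primes from different
cells satisfy no joint condition, so this subset splits off freely as the type II variable.

Finally the variables are confined to cells whose products stay in `(Y/2, 4Y]`. The resulting
identity `GoodAt.rhoMinus_eq_parts` is exact outside `O(δ Y log X)` integers of that interval
(`card_badSet_le`): Rankin's trick handles large smooth divisors, direct counting handles divisors
in short windows and integers near the endpoints. At the exceptional integers all parts are
`O(d(n))`, having one common majorant (`majorant_apply_le`). Cauchy-Schwarz with the fourth moment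
of `d` bounds the remainder, since `δ` is a high power of `1 / log X`.

With `t = log log X`, a set `S` has at most `2 t³` cells, chosen among `exp(O(t))`, so there are
`exp(O(t⁴))` pieces. For `X` below a bound depending on `ε` and `A`, the minorant itself serves as
the remainder. -/

/-- Real-valued arithmetic functions, a commutative ring under Dirichlet convolution. -/
abbrev AF := ArithmeticFunction ℝ

/-- The indicator function of the positive integer `q`. -/
def pt (q : ℕ) : AF := ⟨fun m => if m = q ∧ m ≠ 0 then 1 else 0, by simp⟩

/-- The function that is constantly `1` on positive integers. -/
def constOne : AF := ⟨fun m => if m = 0 then 0 else 1, by simp⟩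

open Classical in
/-- Restriction of an arithmetic function to a predicate. -/
noncomputable def res (p : ℕ → Prop) (f : AF) : AF := ⟨fun m => if p m then f m else 0, by simp⟩

lemma pt_apply (q m : ℕ) : pt q m = if m = q ∧ m ≠ 0 then 1 else 0 := rfl

lemma constOne_apply (m : ℕ) : constOne m = if m = 0 then 0 else 1 := rfl

open Classical in
lemma res_apply (p : ℕ → Prop) (f : AF) (m : ℕ) : res p f m = if p m then f m else 0 := rfl

lemma pt_mul_apply {q : ℕ} (hq : q ≠ 0) (h : AF) {n : ℕ} (hn : n ≠ 0) :
    (pt q * h) n = if q ∣ n then h (n / q) else 0 := by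
  rw [ArithmeticFunction.mul_apply]
  split_ifs with hd
  · rw [Finset.sum_eq_single (q, n / q)]
    · simp [pt_apply, hq]
    · rintro ⟨a, b⟩ hab hne
      simp only [Nat.mem_divisorsAntidiagonal] at hab
      rw [pt_apply, if_neg, zero_mul]
      rintro ⟨rfl, h0⟩
      apply hne
      have h0' : a ≠ 0 := h0
      have : n / a = b := by rw [← hab.1]; exact Nat.mul_div_cancel_left b (Nat.pos_of_ne_zero h0')
      simp [this]
    · intro h1
      exact absurd (Nat.mem_divisorsAntidiagonal.2 ⟨Nat.mul_div_cancel' hd, hn⟩) h1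
  · apply Finset.sum_eq_zero
    rintro ⟨a, b⟩ hab
    simp only [Nat.mem_divisorsAntidiagonal] at hab
    rw [pt_apply, if_neg, zero_mul]
    rintro ⟨rfl, -⟩
    exact hd ⟨b, hab.1.symm⟩

lemma pt_one : pt 1 = 1 := by
  ext m
  rw [pt_apply, ArithmeticFunction.one_apply]
  congr 1
  simp only [ne_eq, eq_iff_iff, and_iff_left_iff_imp]
  omega

lemma pt_mul_pt (a b : ℕ) (ha : a ≠ 0) (_hb : b ≠ 0) : pt a * pt b = pt (a * b) := by
  ext m
  rcases eq_or_ne m 0 with rfl | hm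
  · simp
  rw [pt_mul_apply ha _ hm, pt_apply, pt_apply]
  by_cases hd : a ∣ m
  · obtain ⟨c, rfl⟩ := hd
    have hc : c ≠ 0 := by rintro rfl; simp at hm
    rw [if_pos (Dvd.intro _ rfl), Nat.mul_div_cancel_left _ (Nat.pos_of_ne_zero ha)]
    simp [ha, hc]
  · rw [if_neg hd, if_neg]
    rintro ⟨rfl, -⟩
    exact hd (Dvd.intro _ rfl)

lemma prod_pt {ι : Type*} (s : Finset ι) (g : ι → ℕ) (h : ∀ i ∈ s, g i ≠ 0) :
    ∏ i ∈ s, pt (g i) = pt (∏ i ∈ s, g i) := by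
  classical
  induction s using Finset.induction_on with
  | empty => simp [pt_one]
  | insert a s ha ih =>
    rw [Finset.prod_insert ha, Finset.prod_insert ha, ih fun i hi => h i (by simp [hi]),
      pt_mul_pt _ _ (h a (by simp)) (Finset.prod_ne_zero_iff.2 fun i hi => h i (by simp [hi]))]

/-- `f` is dominated by `g` pointwise. -/
def Dom (f g : AF) : Prop := ∀ m, |f m| ≤ g m

namespace Dom

variable {f g f' g' h : AF}

lemma nonneg (H : Dom f g) (m : ℕ) : 0 ≤ g m := (abs_nonneg _).trans (H m)

/-- `Dom g g` just says that `g` is nonnegative; this is how nonnegativity is passed around. -/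
lemma self_right (H : Dom f g) : Dom g g := fun m => by rw [abs_of_nonneg (H.nonneg m)]

lemma trans (H : Dom f g) (H' : Dom g h) : Dom f h := fun m =>
  (H m).trans ((le_abs_self _).trans (H' m))

lemma of_nonneg_le (h0 : ∀ m, 0 ≤ f m) (h1 : ∀ m, f m ≤ g m) : Dom f g := fun m => by
  rw [abs_of_nonneg (h0 m)]; exact h1 m

lemma refl (h0 : ∀ m, 0 ≤ f m) : Dom f f := of_nonneg_le h0 fun _ => le_rfl

lemma mul (H : Dom f g) (H' : Dom f' g') : Dom (f * f') (g * g') := fun m => by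
  rw [ArithmeticFunction.mul_apply, ArithmeticFunction.mul_apply]
  refine (Finset.abs_sum_le_sum_abs _ _).trans (Finset.sum_le_sum fun x _ => ?_)
  rw [abs_mul]
  exact mul_le_mul (H _) (H' _) (abs_nonneg _) (H.nonneg _)

lemma add (H : Dom f g) (H' : Dom f' g') : Dom (f + f') (g + g') := fun m => by
  rw [ArithmeticFunction.add_apply, ArithmeticFunction.add_apply]
  exact (abs_add_le _ _).trans (add_le_add (H m) (H' m))

lemma neg (H : Dom f g) : Dom (-f) g := fun m => by
  rw [ArithmeticFunction.neg_apply, abs_neg]; exact H m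

lemma sub (H : Dom f g) (H' : Dom f' g') : Dom (f - f') (g + g') := by
  rw [sub_eq_add_neg]; exact H.add H'.neg

lemma zero : Dom 0 0 := fun m => by simp

lemma one : Dom 1 1 := refl fun m => by
  rw [ArithmeticFunction.one_apply]; split_ifs <;> norm_num

lemma sum {ι : Type*} {s : Finset ι} {F G : ι → AF} (H : ∀ i ∈ s, Dom (F i) (G i)) :
    Dom (∑ i ∈ s, F i) (∑ i ∈ s, G i) := by
  classical
  induction s using Finset.induction_on with
  | empty => simpa using zero
  | insert a s ha ih =>
    rw [Finset.sum_insert ha, Finset.sum_insert ha]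
    exact (H a (by simp)).add (ih fun i hi => H i (by simp [hi]))

lemma prod {ι : Type*} {s : Finset ι} {F G : ι → AF} (H : ∀ i ∈ s, Dom (F i) (G i)) :
    Dom (∏ i ∈ s, F i) (∏ i ∈ s, G i) := by
  classical
  induction s using Finset.induction_on with
  | empty => simpa using one
  | insert a s ha ih =>
    rw [Finset.prod_insert ha, Finset.prod_insert ha]
    exact (H a (by simp)).mul (ih fun i hi => H i (by simp [hi]))

lemma neg_one_pow_mul (k : ℕ) (H : Dom f g) : Dom ((-1) ^ k * f) g := by
  rcases neg_one_pow_eq_or AF k with h | h <;> rw [h]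
  · simpa using H
  · simpa using H.neg

lemma res (p : ℕ → Prop) (H : Dom f g) : Dom (res p f) g := fun m => by
  rw [res_apply]; split_ifs
  · exact H m
  · simpa using H.nonneg m

lemma add_right (H : Dom f g) (H' : Dom f' g') : Dom f (g + g') := fun m => by
  rw [ArithmeticFunction.add_apply]
  linarith [H m, H'.nonneg m]

end Dom

lemma sum_apply {ι : Type*} (s : Finset ι) (F : ι → AF) (m : ℕ) :
    (∑ i ∈ s, F i) m = ∑ i ∈ s, F i m := by
  classical
  induction s using Finset.induction_on with
  | empty => simp
  | insert a s ha ih => rw [Finset.sum_insert ha, Finset.sum_insert ha, ← ih]; rfl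

lemma sub_apply (f g : AF) (m : ℕ) : (f - g) m = f m - g m := by
  rw [sub_eq_add_neg, ArithmeticFunction.add_apply, ArithmeticFunction.neg_apply, sub_eq_add_neg]

lemma dom_sum_subset {ι : Type*} {s t : Finset ι} {F : ι → AF} (hst : s ⊆ t)
    (H : ∀ i ∈ t, Dom (F i) (F i)) : Dom (∑ i ∈ s, F i) (∑ i ∈ t, F i) := by
  refine Dom.of_nonneg_le (fun m => ?_) (fun m => ?_)
  · rw [sum_apply]; exact Finset.sum_nonneg fun i hi => (H i (hst hi)).nonneg m
  · rw [sum_apply, sum_apply]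
    exact Finset.sum_le_sum_of_subset_of_nonneg hst fun i hi _ => (H i hi).nonneg m

lemma dom_pt (q : ℕ) : Dom (pt q) (pt q) := Dom.refl fun m => by
  rw [pt_apply]; split_ifs <;> norm_num

lemma dom_constOne : Dom constOne constOne := Dom.refl fun m => by
  rw [constOne_apply]; split_ifs <;> norm_num

lemma dom_sum_pt {s : Finset ℕ} : Dom (∑ q ∈ s, pt q) (∑ q ∈ s, pt q) :=
  Dom.sum fun q _ => dom_pt q

lemma sum_pt_apply (s : Finset ℕ) (m : ℕ) :
    (∑ q ∈ s, pt q) m = if m ∈ s ∧ m ≠ 0 then 1 else 0 := by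
  rw [sum_apply]
  simp only [pt_apply]
  split_ifs with h
  · rw [Finset.sum_eq_single m]
    · simp [h.2]
    · intro b _ hb; rw [if_neg]; exact fun h => hb h.1.symm
    · exact fun h' => absurd h.1 h'
  · apply Finset.sum_eq_zero
    intro q hq
    rw [if_neg]
    rintro ⟨rfl, h0⟩
    exact h ⟨hq, h0⟩

lemma dom_sum_pt_constOne (s : Finset ℕ) : Dom (∑ q ∈ s, pt q) constOne := by
  refine Dom.of_nonneg_le (fun m => dom_sum_pt.nonneg m) (fun m => ?_)
  rw [sum_pt_apply, constOne_apply]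
  split_ifs with h1 h2 h2 <;> simp_all

/-- The ideal of functions that vanish at all divisors of `n`. -/
def vanishIdeal (n : ℕ) : Ideal AF where
  carrier := {f | ∀ d, d ∣ n → d ≠ 0 → f d = 0}
  add_mem' {f g} hf hg d hd h0 := by
    rw [ArithmeticFunction.add_apply, hf d hd h0, hg d hd h0, add_zero]
  zero_mem' d _ _ := by simp
  -- A convolution at `d` only involves values at divisors of `d`, which again divide `n`.
  smul_mem' c f hf d hd h0 := by
    rw [smul_eq_mul, ArithmeticFunction.mul_apply]
    refine Finset.sum_eq_zero fun x hx => ?_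
    have hx' := Nat.mem_divisorsAntidiagonal.1 hx
    have : x.2 ≠ 0 := by rintro h; apply h0; rw [← hx'.1, h, mul_zero]
    rw [hf x.2 ((Dvd.intro_left _ hx'.1).trans hd) this, mul_zero]

lemma mem_vanishIdeal {n : ℕ} {f : AF} :
    f ∈ vanishIdeal n ↔ ∀ d, d ∣ n → d ≠ 0 → f d = 0 := Iff.rfl

lemma pt_mem_vanishIdeal {n q : ℕ} (h : ¬ q ∣ n) : pt q ∈ vanishIdeal n := by
  intro d hd _
  rw [pt_apply, if_neg]
  rintro ⟨rfl, -⟩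
  exact h hd

/-- As `n` divides itself, identities valid only at `n` can be proved by ring manipulations in the
quotient. -/
lemma eq_of_mk_eq {n : ℕ} (hn : n ≠ 0) {f g : AF}
    (h : Ideal.Quotient.mk (vanishIdeal n) f = Ideal.Quotient.mk (vanishIdeal n) g) :
    f n = g n := by
  have := mem_vanishIdeal.1 (Ideal.Quotient.eq.1 h) n dvd_rfl hn
  rw [sub_apply] at this
  linarith

lemma prod_fin_apply : ∀ (k : ℕ) (f : Fin k → AF) (n : ℕ),
    (∏ i, f i) n = ∑ q ∈ Nat.finMulAntidiag k n, ∏ i, f i (q i)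
  | 0, f, n => by
    rcases eq_or_ne n 1 with rfl | h
    · rw [Nat.finMulAntidiag_one]; simp
    · rw [Nat.finMulAntidiag_zero_left h]; simp [ArithmeticFunction.one_apply_ne h]
  | k + 1, f, n => by
    rw [Fin.prod_univ_succ, ArithmeticFunction.mul_apply]
    simp only [prod_fin_apply k, Finset.mul_sum]
    rw [Finset.sum_sigma']
    refine Finset.sum_bij' (fun x _ => Fin.cons x.1.1 x.2)
      (fun q _ => ⟨(q 0, ∏ i : Fin k, q i.succ), fun i => q i.succ⟩) ?_ ?_ ?_ ?_ ?_
    · rintro ⟨⟨a, b⟩, q⟩ h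
      simp only [Finset.mem_sigma, Nat.mem_divisorsAntidiagonal, Nat.mem_finMulAntidiag] at h
      rw [Nat.mem_finMulAntidiag, Fin.prod_univ_succ]
      simp [h.2.1, h.1.1, h.1.2]
    · intro q h
      rw [Nat.mem_finMulAntidiag, Fin.prod_univ_succ] at h
      simp only [Finset.mem_sigma, Nat.mem_divisorsAntidiagonal, Nat.mem_finMulAntidiag]
      refine ⟨⟨h.1, h.2⟩, trivial, ?_⟩
      rintro h0
      rw [h0, mul_zero] at h
      exact h.2 h.1.symm
    · rintro ⟨⟨a, b⟩, q⟩ h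
      simp only [Finset.mem_sigma, Nat.mem_divisorsAntidiagonal, Nat.mem_finMulAntidiag] at h
      simp [h.2.1]
    · intro q h
      exact Fin.cons_self_tail q
    · rintro ⟨⟨a, b⟩, q⟩ h
      simp [Fin.prod_univ_succ]

lemma mul_three_apply (f g h : AF) (n : ℕ) :
    (f * g * h) n = ∑ q ∈ Nat.finMulAntidiag 3 n, f (q 0) * g (q 1) * h (q 2) := by
  have := prod_fin_apply 3 ![f, g, h] n
  simpa [Fin.prod_univ_three] using this

lemma mul_four_apply (f g h k : AF) (n : ℕ) :
    (f * g * h * k) n = ∑ q ∈ Nat.finMulAntidiag 4 n, f (q 0) * g (q 1) * h (q 2) * k (q 3) := by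
  have := prod_fin_apply 4 ![f, g, h, k] n
  simpa [Fin.prod_univ_four] using this

/-- The restrictions to the classes of a map with value in a finite set add up. -/
lemma sum_res_eq {κ : Type*} (idx : ℕ → κ) (s : Finset κ) (f : AF) :
    ∑ j ∈ s, res (fun x => idx x = j) f = res (fun x => idx x ∈ s) f := by
  classical
  ext m
  rw [sum_apply]
  simp only [res_apply]
  rw [Finset.sum_ite_eq]
  congr 1

lemma dom_sum_res {κ : Type*} (idx : ℕ → κ) (s : Finset κ) {f g : AF} (H : Dom f g) :
    Dom (∑ j ∈ s, res (fun x => idx x = j) f) g := by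
  rw [sum_res_eq]; exact H.res _

lemma exists_of_mul_ne_zero {f g : AF} {n : ℕ} (h : (f * g) n ≠ 0) :
    ∃ a b, a * b = n ∧ f a ≠ 0 ∧ g b ≠ 0 := by
  rw [ArithmeticFunction.mul_apply] at h
  obtain ⟨x, hx, h⟩ := Finset.exists_ne_zero_of_sum_ne_zero h
  exact ⟨x.1, x.2, (Nat.mem_divisorsAntidiagonal.1 hx).1, left_ne_zero_of_mul h,
    right_ne_zero_of_mul h⟩

lemma exists_of_sum_ne_zero {ι : Type*} {s : Finset ι} {F : ι → AF} {m : ℕ}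
    (h : (∑ i ∈ s, F i) m ≠ 0) : ∃ i ∈ s, F i m ≠ 0 := by
  rw [sum_apply] at h
  exact Finset.exists_ne_zero_of_sum_ne_zero h

lemma eq_of_pt_ne_zero {q m : ℕ} (h : pt q m ≠ 0) : m = q := by
  rw [pt_apply] at h
  by_contra h'
  exact h (if_neg fun h => h' h.1)

lemma ne_zero_of_apply_ne_zero {f : AF} {m : ℕ} (h : f m ≠ 0) : m ≠ 0 := by
  rintro rfl; simp at h

/-- If `f * g` is evaluated at `n`, `g` may be restricted to the cofactors of the support of `f`. -/
lemma mul_res_apply_eq {f g : AF} {p : ℕ → Prop} {n : ℕ}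
    (h : ∀ a b, a * b = n → n ≠ 0 → f a ≠ 0 → g b ≠ 0 → p b) : (f * res p g) n = (f * g) n := by
  rw [ArithmeticFunction.mul_apply, ArithmeticFunction.mul_apply]
  refine Finset.sum_congr rfl fun x hx => ?_
  obtain ⟨hx1, hx2⟩ := Nat.mem_divisorsAntidiagonal.1 hx
  rw [res_apply]
  split_ifs with hp
  · rfl
  · by_cases hf : f x.1 = 0
    · simp [hf]
    by_cases hg : g x.2 = 0
    · simp [hg]
    exact absurd (h _ _ hx1 hx2 hf hg) hp

lemma mul_constOne_apply (f : AF) (n : ℕ) : (f * constOne) n = ∑ d ∈ n.divisors, f d := by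
  rw [ArithmeticFunction.mul_apply, Nat.sum_divisorsAntidiagonal (fun a b => f a * constOne b)]
  refine Finset.sum_congr rfl fun d hd => ?_
  obtain ⟨h1, h2⟩ := Nat.mem_divisors.1 hd
  rw [constOne_apply, if_neg, mul_one]
  exact (Nat.div_pos (Nat.le_of_dvd (Nat.pos_of_ne_zero h2) h1)
    (Nat.pos_of_dvd_of_pos h1 (Nat.pos_of_ne_zero h2))).ne'

/-- Each further convolution with `constOne` sums over the divisors of `m`, and `d` is monotone
under divisibility. This turns domination by a power of `constOne` into a divisor bound. -/
lemma constOne_pow_apply_le (k : ℕ) (m : ℕ) :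
    (constOne ^ (k + 1)) m ≤ (m.divisors.card : ℝ) ^ k := by
  induction k generalizing m with
  | zero => rw [zero_add, pow_one, constOne_apply]; split_ifs <;> simp
  | succ k ih =>
    rw [pow_succ constOne (k + 1), mul_constOne_apply, pow_succ (m.divisors.card : ℝ)]
    calc ∑ d ∈ m.divisors, (constOne ^ (k + 1)) d
        ≤ ∑ d ∈ m.divisors, (m.divisors.card : ℝ) ^ k := by
          refine Finset.sum_le_sum fun d hd => (ih d).trans ?_
          have := Finset.card_le_card (Nat.divisors_subset_of_dvd (Nat.mem_divisors.1 hd).2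
            (Nat.mem_divisors.1 hd).1)
          gcongr
      _ = _ := by rw [Finset.sum_const, nsmul_eq_mul, mul_comm]

lemma dom_constOne_pow (k : ℕ) : Dom (constOne ^ k) (constOne ^ k) := by
  have := Dom.prod (s := range k) (F := fun _ => constOne) (G := fun _ => constOne)
    fun _ _ => dom_constOne
  simpa using this

lemma dom_one_constOne : Dom 1 constOne := Dom.one.trans fun m => by
  rw [ArithmeticFunction.one_apply, constOne_apply]
  split_ifs with h1 h2 h2 <;> simp_all

lemma dom_constOne_pow_le {k l : ℕ} (h : k ≤ l) : Dom (constOne ^ k) (constOne ^ l) := by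
  obtain ⟨j, rfl⟩ := Nat.exists_eq_add_of_le h
  induction j with
  | zero => exact dom_constOne_pow k
  | succ j ih =>
    have := (ih (by omega)).mul dom_one_constOne
    rw [mul_one] at this
    rw [← add_assoc, pow_succ]
    exact this

end HarmanMinorant

/-! ### The sieve and the minorant as convolutions. -/

namespace HarmanMinorant

open Finset

/-- When a prime `p` is added, the term at `m / p` cancels the term at `m` if `p ∣ m`, because
dividing by `p` does not affect divisibility by the other primes. -/
lemma prod_one_sub_pt_mul_constOne (P : Finset ℕ) (hP : ∀ p ∈ P, p.Prime) {m : ℕ} (hm : m ≠ 0) :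
    ((∏ p ∈ P, (1 - pt p)) * constOne) m = if ∀ p ∈ P, ¬ p ∣ m then 1 else 0 := by
  classical
  induction P using Finset.induction_on generalizing m with
  | empty => simp [constOne_apply, hm]
  | insert p P hp ih =>
    have hpp : p.Prime := hP p (by simp)
    have ih' := fun {m : ℕ} (hm : m ≠ 0) => ih (fun q hq => hP q (by simp [hq])) (m := m) hm
    rw [Finset.prod_insert hp, mul_assoc, sub_mul, one_mul, sub_apply, ih' hm,
      pt_mul_apply hpp.ne_zero _ hm]
    by_cases hd : p ∣ m
    · obtain ⟨c, rfl⟩ := hd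
      have hc : c ≠ 0 := by rintro rfl; simp at hm
      rw [if_pos (Dvd.intro _ rfl), Nat.mul_div_cancel_left _ hpp.pos, ih' hc]
      have h1 : (∀ q ∈ P, ¬ q ∣ p * c) ↔ ∀ q ∈ P, ¬ q ∣ c := by
        refine forall₂_congr fun q hq => not_congr ?_
        have hqp : q.Prime := hP q (by simp [hq])
        rw [hqp.dvd_mul, Nat.prime_dvd_prime_iff_eq hqp hpp]
        refine or_iff_right ?_
        rintro rfl; exact hp hq
      simp [h1]
    · rw [if_neg hd, sub_zero]
      simp [hd]

lemma prod_primes_injOn {P : Finset ℕ} (hP : ∀ p ∈ P, p.Prime) :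
    Set.InjOn (fun T : Finset ℕ => ∏ p ∈ T, p) (P.powerset : Set (Finset ℕ)) := by
  intro S hS T hT h
  have hS' := Finset.mem_powerset.1 (Finset.mem_coe.1 hS)
  have hT' := Finset.mem_powerset.1 (Finset.mem_coe.1 hT)
  rw [← Nat.primeFactors_prod fun p hp => hP p (hS' hp),
    ← Nat.primeFactors_prod fun p hp => hP p (hT' hp)]
  exact congrArg Nat.primeFactors h

lemma prod_one_sub_pt_eq (P : Finset ℕ) (hP : ∀ p ∈ P, p.Prime) :
    ∏ p ∈ P, (1 - pt p) = ∑ T ∈ P.powerset, (-1 : AF) ^ T.card * pt (∏ p ∈ T, p) := by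
  simp only [sub_eq_add_neg]
  rw [Finset.prod_one_add]
  refine Finset.sum_congr rfl fun T hT => ?_
  simp only [neg_eq_neg_one_mul (pt _)]
  rw [Finset.prod_mul_distrib, Finset.prod_const, prod_pt]
  exact fun p hp => (hP p (Finset.mem_powerset.1 hT hp)).ne_zero

lemma prod_one_add_pt_eq (P : Finset ℕ) (hP : ∀ p ∈ P, p.Prime) :
    ∏ p ∈ P, (1 + pt p) = ∑ T ∈ P.powerset, pt (∏ p ∈ T, p) := by
  rw [Finset.prod_one_add]
  refine Finset.sum_congr rfl fun T hT => ?_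
  rw [prod_pt]
  exact fun p hp => (hP p (Finset.mem_powerset.1 hT hp)).ne_zero

/-- By unique factorization the expanded product is the indicator of a set of squarefree integers.
Hence sifting factors are bounded by `1`, however many terms they have. -/
lemma dom_prod_one_add_pt (P : Finset ℕ) (hP : ∀ p ∈ P, p.Prime) :
    Dom (∏ p ∈ P, (1 + pt p)) constOne := by
  rw [prod_one_add_pt_eq P hP, ← Finset.sum_image (f := pt) (prod_primes_injOn hP)]
  exact dom_sum_pt_constOne _

/-- All terms beyond the linear ones involve `pt (p * q)` with `p ≠ q` in `C`, and these vanish at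
the divisors of `n`. -/
lemma mk_prod_one_sub_pt (n : ℕ) (C : Finset ℕ) (hC : ∀ p ∈ C, p.Prime)
    (h : ∀ p ∈ C, ∀ q ∈ C, p < q → ¬ p * q ∣ n) :
    Ideal.Quotient.mk (vanishIdeal n) (∏ p ∈ C, (1 - pt p)) =
      Ideal.Quotient.mk (vanishIdeal n) (1 - ∑ p ∈ C, pt p) := by
  classical
  induction C using Finset.induction_on with
  | empty => simp
  | insert p C hp ih =>
    rw [Finset.prod_insert hp, map_mul, ih (fun q hq => hC q (by simp [hq]))
      (fun q hq r hr => h q (by simp [hq]) r (by simp [hr])), ← map_mul, Ideal.Quotient.eq,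
      Finset.sum_insert hp]
    have : (1 - pt p) * (1 - ∑ q ∈ C, pt q) - (1 - (pt p + ∑ q ∈ C, pt q)) =
        ∑ q ∈ C, pt (p * q) := by
      rw [← Finset.sum_congr rfl fun q hq => pt_mul_pt p q (hC p (by simp)).ne_zero
        (hC q (by simp [hq])).ne_zero, ← Finset.mul_sum]
      ring
    rw [this]
    refine Ideal.sum_mem _ fun q hq => pt_mem_vanishIdeal ?_
    have hne : p ≠ q := by rintro rfl; exact hp hq
    rcases lt_or_gt_of_ne hne with hlt | hlt
    · exact h p (by simp) q (by simp [hq]) hlt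
    · rw [mul_comm]; exact h q (by simp [hq]) p (by simp) hlt

lemma mk_prod_one_sub_pt_eq_one (n : ℕ) (C : Finset ℕ) (h : ∀ p ∈ C, ¬ p ∣ n) :
    Ideal.Quotient.mk (vanishIdeal n) (∏ p ∈ C, (1 - pt p)) = 1 := by
  rw [map_prod]
  refine Finset.prod_eq_one fun p hp => ?_
  rw [map_sub, map_one, Ideal.Quotient.eq_zero_iff_mem.2 (pt_mem_vanishIdeal (h p hp)), sub_zero]

/-- The primes in the interval `(a, b]`. -/
noncomputable def primesIoc (a b : ℝ) : Finset ℕ :=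
  (range (⌊b⌋₊ + 1)).filter fun p => p.Prime ∧ a < (p : ℝ) ∧ (p : ℝ) ≤ b

lemma mem_primesIoc {a b : ℝ} {p : ℕ} :
    p ∈ primesIoc a b ↔ p.Prime ∧ a < (p : ℝ) ∧ (p : ℝ) ≤ b := by
  simp only [primesIoc, mem_filter, mem_range, and_iff_right_iff_imp, and_imp]
  exact fun _ _ h => Nat.lt_succ_of_le (Nat.le_floor h)

/-- The primes in the interval `[a, b)`. -/
noncomputable def primesIco (a b : ℝ) : Finset ℕ :=
  (range ⌈b⌉₊).filter fun p => p.Prime ∧ a ≤ (p : ℝ)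

lemma mem_primesIco {a b : ℝ} {p : ℕ} :
    p ∈ primesIco a b ↔ p.Prime ∧ a ≤ (p : ℝ) ∧ (p : ℝ) < b := by
  simp only [primesIco, mem_filter, mem_range, Nat.lt_ceil]
  tauto

/-- The function `ρ(·, z)` as a convolution. -/
lemma rho_eq (z : ℝ) {m : ℕ} (hm : m ≠ 0) :
    rho m z = ((∏ p ∈ primesIco 0 z, (1 - pt p)) * constOne) m := by
  rw [prod_one_sub_pt_mul_constOne _ (fun p hp => (mem_primesIco.1 hp).1) hm, rho, primorialBelow]
  refine if_congr ?_ rfl rfl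
  rw [Nat.coprime_prod_right_iff]
  simp only [mem_filter, mem_range, mem_primesIco, Nat.lt_ceil, and_imp]
  refine ⟨fun h p hp _ hz => ?_, fun h p hz hp => ?_⟩
  · exact (Nat.Prime.coprime_iff_not_dvd hp).1 (h p hz hp).symm
  · exact ((Nat.Prime.coprime_iff_not_dvd hp).2 (h p hp (Nat.cast_nonneg _) hz)).symm

lemma rho_nonneg (m : ℕ) (z : ℝ) : 0 ≤ rho m z := by rw [rho]; split_ifs <;> norm_num

lemma rho_le_one (m : ℕ) (z : ℝ) : rho m z ≤ 1 := by rw [rho]; split_ifs <;> norm_num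

/-- The pairs of primes in the third term of the minorant. -/
noncomputable def primePairs (ε X : ℝ) : Finset (ℕ × ℕ) :=
  (primesIco (zLevel X) (X ^ (1 / 4 - 2 * ε)) ×ˢ primesIco (zLevel X) (X ^ (1 / 4 - 2 * ε))).filter
    fun q => q.2 < q.1 ∧ (q.1 : ℝ) * (q.2 : ℝ) ^ 4 < X ^ (1 - 2 * ε)

/-- The triples of primes in the fourth term of the minorant. -/
noncomputable def primeTriples (ε X : ℝ) : Finset (ℕ × ℕ × ℕ) :=
  (primesIco (zLevel X) (X ^ (1 / 4 - 2 * ε)) ×ˢ primesIco (zLevel X) (X ^ (1 / 4 - 2 * ε)) ×ˢ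
    primesIco (zLevel X) (X ^ (1 / 4 - 2 * ε))).filter
    fun q => q.2.2 < q.2.1 ∧ q.2.1 < q.1 ∧ (q.1 : ℝ) * (q.2.1 : ℝ) ^ 4 < X ^ (1 - 2 * ε)

/-- The indicator of the primes in the second term of the minorant. -/
noncomputable def weight₁ (X : ℝ) : AF :=
  ∑ q ∈ primesIco (zLevel X) (2 * X ^ (1 / 2 : ℝ)), pt q

/-- The indicator of the products of the pairs in `primePairs`. -/
noncomputable def weight₂ (ε X : ℝ) : AF := ∑ q ∈ primePairs ε X, pt q.1 * pt q.2

/-- The products of the triples in `primeTriples`, with multiplicity. -/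
noncomputable def weight₃ (ε X : ℝ) : AF :=
  ∑ q ∈ primeTriples ε X, pt q.1 * pt q.2.1 * pt q.2.2

/-- `ρ(·, z)` as an arithmetic function. -/
noncomputable def rhoAF (z : ℝ) : AF := (∏ p ∈ primesIco 0 z, (1 - pt p)) * constOne

lemma rhoAF_apply (z : ℝ) {m : ℕ} (hm : m ≠ 0) : rhoAF z m = rho m z := (rho_eq z hm).symm

lemma dom_rhoAF (z : ℝ) : Dom (rhoAF z) constOne := by
  intro m
  rcases eq_or_ne m 0 with rfl | hm
  · simp
  rw [rhoAF_apply z hm, abs_of_nonneg (rho_nonneg m z), constOne_apply, if_neg hm]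
  exact rho_le_one m z

lemma pt_one_of {q m : ℕ} (hm : m ≠ 0) : pt q m = if m = q then 1 else 0 := by
  rw [pt_apply]; simp [hm]

lemma rhoSum₁_eq (X : ℝ) (n : ℕ) : rhoSum₁ X n = (weight₁ X * rhoAF (zLevel X)) n := by
  rw [rhoSum₁, ArithmeticFunction.mul_apply, Finset.sum_filter]
  refine Finset.sum_congr rfl fun x hx => ?_
  have hx' := Nat.mem_divisorsAntidiagonal.1 hx
  have h1 : x.1 ≠ 0 := by rintro h; rw [h, zero_mul] at hx'; exact hx'.2 hx'.1.symm
  have h2 : x.2 ≠ 0 := by rintro h; rw [h, mul_zero] at hx'; exact hx'.2 hx'.1.symm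
  rw [rhoAF_apply _ h2, weight₁, sum_pt_apply]
  simp only [mem_primesIco]
  split_ifs with h h' h' <;> first | (exfalso; tauto) | simp

lemma rhoSum₂_eq (ε X : ℝ) (n : ℕ) : rhoSum₂ ε X n = (weight₂ ε X * rhoAF (zLevel X)) n := by
  classical
  rw [rhoSum₂, weight₂, Finset.sum_mul, sum_apply]
  simp only [mul_three_apply]
  rw [Finset.sum_comm, Finset.sum_filter]
  refine Finset.sum_congr rfl fun t ht => ?_
  have h0 : ∀ i, t i ≠ 0 := fun i => Nat.ne_zero_of_mem_finMulAntidiag ht i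
  simp only [rhoAF_apply _ (h0 2), pt_one_of (h0 0), pt_one_of (h0 1)]
  rw [← Finset.sum_mul]
  have : ∀ q : ℕ × ℕ, ((if t 0 = q.1 then (1 : ℝ) else 0) * if t 1 = q.2 then 1 else 0) =
      if (t 0, t 1) = q then 1 else 0 := by
    rintro ⟨a, b⟩
    simp only [Prod.mk.injEq, ite_and]
    split_ifs <;> simp
  simp only [this]
  rw [Finset.sum_ite_eq]
  simp only [primePairs, mem_filter, mem_product, mem_primesIco]
  have hlt : t 1 < t 0 → (t 1 : ℝ) < t 0 := fun h => by exact_mod_cast h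
  split_ifs with h h' h'
  · simp
  · exfalso
    refine h' ⟨⟨⟨h.1, ?_, h.2.2.2.2.1⟩, h.2.1, h.2.2.1, ?_⟩, h.2.2.2.1, h.2.2.2.2.2⟩
    · linarith [hlt h.2.2.2.1, h.2.2.1]
    · linarith [hlt h.2.2.2.1, h.2.2.2.2.1]
  · exfalso; tauto
  · simp

lemma rhoSum₃_eq (ε X : ℝ) (n : ℕ) : rhoSum₃ ε X n = (weight₃ ε X * rhoAF (zLevel X)) n := by
  classical
  rw [rhoSum₃, weight₃, Finset.sum_mul, sum_apply]
  simp only [mul_four_apply]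
  rw [Finset.sum_comm, Finset.sum_filter]
  refine Finset.sum_congr rfl fun t ht => ?_
  have h0 : ∀ i, t i ≠ 0 := fun i => Nat.ne_zero_of_mem_finMulAntidiag ht i
  simp only [rhoAF_apply _ (h0 3), pt_one_of (h0 0), pt_one_of (h0 1), pt_one_of (h0 2)]
  rw [← Finset.sum_mul]
  have : ∀ q : ℕ × ℕ × ℕ, ((if t 0 = q.1 then (1 : ℝ) else 0) * (if t 1 = q.2.1 then 1 else 0) *
      if t 2 = q.2.2 then 1 else 0) = if (t 0, t 1, t 2) = q then 1 else 0 := by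
    rintro ⟨a, b, c⟩
    simp only [Prod.mk.injEq, ite_and]
    split_ifs <;> simp
  simp only [this]
  rw [Finset.sum_ite_eq]
  simp only [primeTriples, mem_filter, mem_product, mem_primesIco]
  have hlt : t 1 < t 0 → (t 1 : ℝ) < t 0 := fun h => by exact_mod_cast h
  have hlt2 : t 2 < t 1 → (t 2 : ℝ) < t 1 := fun h => by exact_mod_cast h
  split_ifs with h h' h'
  · simp
  · exfalso
    obtain ⟨p0, p1, p2, hz, h21, h10, hX, hc⟩ := h
    have a1 := hlt h10
    have a2 := hlt2 h21
    exact h' ⟨⟨⟨p0, by linarith, hX⟩, ⟨p1, by linarith, by linarith⟩, p2, hz, by linarith⟩,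
      h21, h10, hc⟩
  · exfalso; tauto
  · simp

lemma rhoMinus_eq (ε X : ℝ) {n : ℕ} (hn : n ≠ 0) :
    rhoMinus ε X n =
      ((1 - weight₁ X + weight₂ ε X - weight₃ ε X) * rhoAF (zLevel X)) n := by
  rw [rhoMinus, rhoSum₁_eq, rhoSum₂_eq, rhoSum₃_eq, ← rhoAF_apply _ hn, sub_mul, add_mul, sub_mul,
    one_mul, sub_apply, ArithmeticFunction.add_apply, sub_apply]

end HarmanMinorant

/-! ### Moments of the divisor function and counts of exceptional integers. -/

namespace HarmanMinorant

open Finset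

lemma sum_Icc_sum_divisorsAntidiagonal_le (N : ℕ) (F : ℕ × ℕ → ℝ) (hF : ∀ x, 0 ≤ F x) :
    ∑ n ∈ Icc 1 N, ∑ x ∈ n.divisorsAntidiagonal, F x ≤ ∑ x ∈ Icc 1 N ×ˢ Icc 1 N, F x := by
  classical
  rw [← Finset.sum_biUnion]
  · refine Finset.sum_le_sum_of_subset_of_nonneg ?_ fun x _ _ => hF x
    rintro ⟨a, b⟩ h
    obtain ⟨n, hn, hx⟩ := Finset.mem_biUnion.1 h
    obtain ⟨hx1, hx2⟩ := Nat.mem_divisorsAntidiagonal.1 hx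
    have hn' := (mem_Icc.1 hn).2
    simp only at hx1
    have ha : a ∣ n := Dvd.intro _ hx1
    have hb : b ∣ n := Dvd.intro_left _ hx1
    have hpos := Nat.pos_of_ne_zero hx2
    rw [mem_product, mem_Icc, mem_Icc]
    exact ⟨⟨Nat.pos_of_dvd_of_pos ha hpos, (Nat.le_of_dvd hpos ha).trans hn'⟩,
      Nat.pos_of_dvd_of_pos hb hpos, (Nat.le_of_dvd hpos hb).trans hn'⟩
  · intro m _ n _ hmn
    rw [Function.onFun, Finset.disjoint_left]
    intro x hx hy
    exact hmn ((Nat.mem_divisorsAntidiagonal.1 hx).1.symm.trans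
      (Nat.mem_divisorsAntidiagonal.1 hy).1)

/-- One factor `d(n)` counts the factorizations `n = a b`, and the other factors obey `d(ab) ≤ d(a)
d(b)`. So the sum for `k + 1` is at most the square of the sum for `k`. -/
lemma sum_divisors_card_pow_div_le (k N : ℕ) :
    ∑ n ∈ Icc 1 N, (n.divisors.card : ℝ) ^ k / n ≤ (1 + Real.log N) ^ 2 ^ k := by
  induction k with
  | zero =>
    have := harmonic_le_one_add_log N
    rw [harmonic_eq_sum_Icc] at this
    push_cast at this
    simpa using this
  | succ k ih =>
    have h0 : 0 ≤ ∑ n ∈ Icc 1 N, (n.divisors.card : ℝ) ^ k / n :=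
      Finset.sum_nonneg fun n _ => by positivity
    calc ∑ n ∈ Icc 1 N, (n.divisors.card : ℝ) ^ (k + 1) / n
        ≤ ∑ n ∈ Icc 1 N, ∑ x ∈ n.divisorsAntidiagonal,
            ((x.1.divisors.card : ℝ) ^ k / x.1) * ((x.2.divisors.card : ℝ) ^ k / x.2) := by
          refine Finset.sum_le_sum fun n hn => ?_
          have hn0 : 0 < n := (mem_Icc.1 hn).1
          calc (n.divisors.card : ℝ) ^ (k + 1) / n
              = ∑ x ∈ n.divisorsAntidiagonal, (n.divisors.card : ℝ) ^ k / n := by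
                rw [Finset.sum_const, ← Nat.map_div_right_divisors, Finset.card_map, nsmul_eq_mul]
                ring
            _ ≤ _ := by
                refine Finset.sum_le_sum fun x hx => ?_
                have hx' := (Nat.mem_divisorsAntidiagonal.1 hx).1
                have hd : n.divisors.card ≤ x.1.divisors.card * x.2.divisors.card := by
                  rw [← hx', Nat.divisors_mul]; exact Finset.card_mul_le
                rw [div_mul_div_comm, ← mul_pow, ← Nat.cast_mul x.1 x.2, hx']
                gcongr
                exact_mod_cast hd
      _ ≤ ∑ x ∈ Icc 1 N ×ˢ Icc 1 N,
            ((x.1.divisors.card : ℝ) ^ k / x.1) * ((x.2.divisors.card : ℝ) ^ k / x.2) :=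
          sum_Icc_sum_divisorsAntidiagonal_le N (fun x =>
            ((x.1.divisors.card : ℝ) ^ k / x.1) * ((x.2.divisors.card : ℝ) ^ k / x.2))
            fun x => by positivity
      _ = (∑ n ∈ Icc 1 N, (n.divisors.card : ℝ) ^ k / n) ^ 2 := by
          rw [Finset.sum_product, sq, Finset.sum_mul_sum]
      _ ≤ ((1 + Real.log N) ^ 2 ^ k) ^ 2 := by gcongr
      _ = _ := by rw [← pow_mul, pow_succ]

lemma sum_divisors_card_pow_le (k N : ℕ) :
    ∑ n ∈ Icc 1 N, (n.divisors.card : ℝ) ^ k ≤ N * (1 + Real.log N) ^ 2 ^ k := by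
  calc ∑ n ∈ Icc 1 N, (n.divisors.card : ℝ) ^ k
      ≤ ∑ n ∈ Icc 1 N, N * ((n.divisors.card : ℝ) ^ k / n) := by
        refine Finset.sum_le_sum fun n hn => ?_
        obtain ⟨h1, h2⟩ := mem_Icc.1 hn
        have h1' : (0 : ℝ) < n := by exact_mod_cast h1
        have h2' : (n : ℝ) ≤ N := by exact_mod_cast h2
        rw [mul_div_assoc', le_div_iff₀ h1', mul_comm]
        gcongr
    _ ≤ _ := by
        rw [← Finset.mul_sum]
        exact mul_le_mul_of_nonneg_left (sum_divisors_card_pow_div_le k N) (Nat.cast_nonneg _)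

lemma card_multiples_le (N d : ℕ) :
    (((Icc 1 N).filter fun n => d ∣ n).card : ℝ) ≤ N / d := by
  have : ((Icc 1 N).filter fun n => d ∣ n).card = N / d := by
    rw [← Nat.Ioc_filter_dvd_card_eq_div]
    congr 1
  rw [this]
  exact Nat.cast_div_le

/-- The multiples of the members of a finite set of positive integers are few. -/
lemma card_filter_exists_dvd_le {ι : Type*} (N : ℕ) (s : Finset ι) (g : ι → ℕ)
    (p : ℕ → Prop) [DecidablePred p]
    (hp : ∀ n, 1 ≤ n → n ≤ N → p n → ∃ i ∈ s, g i ∣ n) :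
    (((Icc 1 N).filter p).card : ℝ) ≤ N * ∑ i ∈ s, (1 / (g i : ℝ)) := by
  classical
  have h1 : (Icc 1 N).filter p ⊆ s.biUnion fun i => (Icc 1 N).filter fun n => g i ∣ n := by
    intro n hn
    obtain ⟨hn, hpn⟩ := mem_filter.1 hn
    obtain ⟨i, hi, hd⟩ := hp n (mem_Icc.1 hn).1 (mem_Icc.1 hn).2 hpn
    exact mem_biUnion.2 ⟨i, hi, mem_filter.2 ⟨hn, hd⟩⟩
  calc (((Icc 1 N).filter p).card : ℝ)
      ≤ ((∑ i ∈ s, ((Icc 1 N).filter fun n => g i ∣ n).card : ℕ) : ℝ) := by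
        exact_mod_cast (Finset.card_le_card h1).trans Finset.card_biUnion_le
    _ = ∑ i ∈ s, (((Icc 1 N).filter fun n => g i ∣ n).card : ℝ) := by push_cast; rfl
    _ ≤ ∑ i ∈ s, (N : ℝ) / g i := Finset.sum_le_sum fun i _ => card_multiples_le N _
    _ = _ := by rw [Finset.mul_sum]; exact Finset.sum_congr rfl fun i _ => by ring

/-- `n` has a divisor `m' m` with `m` in a short interval that depends on `m'`. -/
def HasWindowDivisor (y l : ℝ) (u : ℕ → ℝ) (n : ℕ) : Prop :=
  ∃ a m : ℕ, a * m ∣ n ∧ y ≤ m ∧ u a ≤ m ∧ (m : ℝ) ≤ l * u a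

/-- The window holds at most `(l - 1) u + 1` integers, each at least `max u y`; the lower bound `y`
serves to control the contribution of the extra integer. -/
lemma sum_window_le (N : ℕ) {y l u : ℝ} (hy : 0 < y) (hl : 1 ≤ l) :
    ∑ m ∈ (Icc 1 N).filter (fun m : ℕ => y ≤ m ∧ u ≤ m ∧ (m : ℝ) ≤ l * u), (1 / (m : ℝ)) ≤
      (l - 1) + 1 / y := by
  set s := (Icc 1 N).filter (fun m : ℕ => y ≤ m ∧ u ≤ m ∧ (m : ℝ) ≤ l * u) with hs
  rcases le_or_gt u 0 with hu | hu
  · have : s = ∅ := by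
      rw [hs, Finset.filter_eq_empty_iff]
      rintro m hm ⟨h1, h2, h3⟩
      nlinarith
    rw [this, Finset.sum_empty]
    have : 0 < 1 / y := by positivity
    linarith
  have hcard : (s.card : ℝ) ≤ (l - 1) * u + 1 := by
    rcases s.eq_empty_or_nonempty with h | ⟨m, hm⟩
    · rw [h]
      simp only [card_empty, CharP.cast_eq_zero]
      nlinarith
    have hlu : u ≤ l * u := by nlinarith
    have hsub : s ⊆ Icc ⌈u⌉₊ ⌊l * u⌋₊ := by
      intro m hm
      obtain ⟨_, _, h2, h3⟩ := mem_filter.1 hm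
      exact mem_Icc.2 ⟨Nat.ceil_le.2 h2, Nat.le_floor h3⟩
    have h1 := Finset.card_le_card hsub
    rw [Nat.card_Icc] at h1
    have h2 : (⌊l * u⌋₊ : ℝ) ≤ l * u := Nat.floor_le (by linarith)
    have h3 : u ≤ ⌈u⌉₊ := Nat.le_ceil u
    have hm' := mem_Icc.1 (hsub hm)
    have h4 : ((⌊l * u⌋₊ + 1 - ⌈u⌉₊ : ℕ) : ℝ) = (⌊l * u⌋₊ : ℝ) + 1 - ⌈u⌉₊ := by
      rw [Nat.cast_sub (by omega)]; push_cast; ring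
    have h5 : (s.card : ℝ) ≤ ((⌊l * u⌋₊ + 1 - ⌈u⌉₊ : ℕ) : ℝ) := by exact_mod_cast h1
    rw [h4] at h5
    linarith
  have hM : 0 < max u y := lt_max_of_lt_right hy
  calc ∑ m ∈ s, (1 / (m : ℝ)) ≤ ∑ m ∈ s, 1 / max u y := by
        refine Finset.sum_le_sum fun m hm => ?_
        obtain ⟨_, h1, h2, _⟩ := mem_filter.1 hm
        exact one_div_le_one_div_of_le hM (max_le h2 h1)
    _ = s.card * (1 / max u y) := by rw [Finset.sum_const, nsmul_eq_mul]
    _ ≤ ((l - 1) * u + 1) * (1 / max u y) := by gcongr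
    _ = (l - 1) * (u / max u y) + 1 / max u y := by ring
    _ ≤ (l - 1) * 1 + 1 / y := by
        refine add_le_add (mul_le_mul_of_nonneg_left ?_ (by linarith)) ?_
        · exact (div_le_one hM).2 (le_max_left _ _)
        · exact one_div_le_one_div_of_le hy (le_max_right _ _)
    _ = _ := by ring

open Classical in
-- The bound for the inner sum is uniform in the position of the window, so the window may depend on
-- the cofactor `a` at the price of one harmonic sum.
lemma card_hasWindowDivisor_le (N : ℕ) {y l : ℝ} (u : ℕ → ℝ) (hy : 0 < y) (hl : 1 ≤ l) :
    (((Icc 1 N).filter (HasWindowDivisor y l u)).card : ℝ) ≤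
      N * ((1 + Real.log N) * ((l - 1) + 1 / y)) := by
  set s : Finset (Σ _ : ℕ, ℕ) := (Icc 1 N).sigma fun a =>
    (Icc 1 N).filter (fun m : ℕ => y ≤ m ∧ u a ≤ m ∧ (m : ℝ) ≤ l * u a) with hs
  refine (card_filter_exists_dvd_le N s (fun x => x.1 * x.2) _ ?_).trans ?_
  · rintro n h1 hN ⟨a, m, hd, h⟩
    refine ⟨⟨a, m⟩, ?_, hd⟩
    have ha : a ∣ n := (Dvd.intro _ rfl).trans hd
    have hm : m ∣ n := (Dvd.intro_left _ rfl).trans hd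
    simp only [hs, mem_sigma, mem_filter, mem_Icc]
    exact ⟨⟨Nat.pos_of_dvd_of_pos ha h1, (Nat.le_of_dvd h1 ha).trans hN⟩,
      ⟨Nat.pos_of_dvd_of_pos hm h1, (Nat.le_of_dvd h1 hm).trans hN⟩, h⟩
  · refine mul_le_mul_of_nonneg_left ?_ (Nat.cast_nonneg _)
    rw [hs, Finset.sum_sigma]
    have hB : 0 ≤ (l - 1) + 1 / y := by
      have : 0 < 1 / y := by positivity
      linarith
    calc _ = ∑ a ∈ Icc 1 N, (1 / (a : ℝ)) *
            ∑ m ∈ (Icc 1 N).filter (fun m : ℕ => y ≤ m ∧ u a ≤ m ∧ (m : ℝ) ≤ l * u a),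
              (1 / (m : ℝ)) := by
          refine Finset.sum_congr rfl fun a _ => ?_
          rw [Finset.mul_sum]
          refine Finset.sum_congr rfl fun m _ => ?_
          push_cast
          rw [one_div_mul_one_div]
      _ ≤ ∑ a ∈ Icc 1 N, (1 / (a : ℝ)) * ((l - 1) + 1 / y) := by
          gcongr with a ha
          exact sum_window_le N hy hl
      _ ≤ _ := by
          rw [← Finset.sum_mul]
          refine mul_le_mul_of_nonneg_right ?_ hB
          simpa using sum_divisors_card_pow_div_le 0 N

/-- Induction works after subtracting the tail `M ^ (-κ) / κ`, so that the sum telescopes; the step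
is `(1 + 1 / M) ^ κ ≥ 1 + κ / (M + 1)`. -/
lemma sum_rpow_neg_le (κ : ℝ) (hκ : 0 < κ) (M : ℕ) :
    ∑ m ∈ Icc 1 M, (m : ℝ) ^ (-(1 + κ)) ≤ 1 + 1 / κ := by
  rcases Nat.eq_zero_or_pos M with rfl | hM
  · simp; positivity
  have key : ∀ M : ℕ, 1 ≤ M →
      ∑ m ∈ Icc 1 M, (m : ℝ) ^ (-(1 + κ)) ≤ 1 + 1 / κ - 1 / κ * (M : ℝ) ^ (-κ) := by
    intro M hM
    induction M, hM using Nat.le_induction with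
    | base => simp
    | succ M hM ih =>
      rw [Finset.sum_Icc_succ_top (by omega)]
      have hM0 : (0 : ℝ) < M := by exact_mod_cast hM
      have hx : (0 : ℝ) < (M : ℝ) + 1 := by positivity
      have h1 : ((M : ℝ) + 1) ^ (-κ) * (1 + κ / (M + 1)) ≤ (M : ℝ) ^ (-κ) := by
        have h2 : 1 + κ / (M + 1) ≤ ((M : ℝ) / (M + 1)) ^ (-κ) := by
          rw [Real.rpow_def_of_pos (by positivity)]
          have h3 : Real.log ((M : ℝ) / (M + 1)) ≤ -(1 / (M + 1)) := by
            have := Real.log_le_sub_one_of_pos (show (0 : ℝ) < (M : ℝ) / (M + 1) by positivity)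
            have e : (M : ℝ) / (M + 1) - 1 = -(1 / (M + 1)) := by field_simp; ring
            rwa [e] at this
          have h4 := Real.add_one_le_exp (Real.log ((M : ℝ) / (M + 1)) * -κ)
          have h5 : κ / (M + 1) ≤ Real.log ((M : ℝ) / (M + 1)) * -κ := by
            have : κ / (M + 1) = -(1 / ((M : ℝ) + 1)) * -κ := by ring
            rw [this]
            exact mul_le_mul_of_nonpos_right h3 (by linarith)
          linarith
        calc ((M : ℝ) + 1) ^ (-κ) * (1 + κ / (M + 1))
            ≤ ((M : ℝ) + 1) ^ (-κ) * ((M : ℝ) / (M + 1)) ^ (-κ) := by gcongr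
          _ = (M : ℝ) ^ (-κ) := by
            rw [← Real.mul_rpow hx.le (by positivity)]
            congr 1
            field_simp
      have h6 : ((M : ℝ) + 1) ^ (-(1 + κ)) = ((M : ℝ) + 1) ^ (-κ) / (M + 1) := by
        rw [show -(1 + κ) = -κ - 1 by ring, Real.rpow_sub_one hx.ne']
      push_cast
      rw [h6]
      have h7 : ((M : ℝ) + 1) ^ (-κ) * (1 + κ / (M + 1)) =
          ((M : ℝ) + 1) ^ (-κ) + κ * (((M : ℝ) + 1) ^ (-κ) / (M + 1)) := by ring
      rw [h7] at h1
      have h8 := mul_le_mul_of_nonneg_left h1 (show 0 ≤ 1 / κ by positivity)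
      rw [mul_add, ← mul_assoc, one_div_mul_cancel hκ.ne', one_mul] at h8
      linarith
  have := key M hM
  have h9 : 0 ≤ 1 / κ * (M : ℝ) ^ (-κ) := by positivity
  linarith

lemma prod_one_add_rpow_eq (P : Finset ℕ) (s : ℝ) :
    ∏ p ∈ P, (1 + (p : ℝ) ^ s) = ∑ T ∈ P.powerset, ((∏ p ∈ T, p : ℕ) : ℝ) ^ s := by
  rw [Finset.prod_one_add]
  refine Finset.sum_congr rfl fun T _ => ?_
  push_cast
  rw [Real.finsetProd_rpow]
  exact fun i _ => Nat.cast_nonneg i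

/-- The Euler product expands into a sum over distinct squarefree integers, which is at most the
full zeta sum. -/
lemma prod_one_add_rpow_neg_le (P : Finset ℕ) (hP : ∀ p ∈ P, p.Prime) {κ : ℝ} (hκ : 0 < κ) :
    ∏ p ∈ P, (1 + (p : ℝ) ^ (-(1 + κ))) ≤ 1 + 1 / κ := by
  classical
  rw [prod_one_add_rpow_eq, ← Finset.sum_image (f := fun m : ℕ => (m : ℝ) ^ (-(1 + κ)))
    (prod_primes_injOn hP)]
  set s := P.powerset.image fun T => ∏ p ∈ T, p with hs
  refine le_trans ?_ (sum_rpow_neg_le κ hκ (s.sup id))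
  refine Finset.sum_le_sum_of_subset_of_nonneg ?_ fun i _ _ => by positivity
  intro m hm
  refine mem_Icc.2 ⟨?_, Finset.le_sup (f := id) hm⟩
  obtain ⟨T, hT, rfl⟩ := mem_image.1 hm
  exact Finset.prod_pos fun p hp => (hP p (mem_powerset.1 hT hp)).pos

/-- For `p ≤ y` the exponents `1 / log y - 1` and `-(1 + 1 / log y)` differ by a factor at most `e²
≤ 8`, which Bernoulli turns into an eighth power. The zeta bound at `1 + 1 / log y` then replaces
Mertens' theorem. -/
lemma prod_one_add_rpow_le {y : ℝ} (hy : 1 < y) (P : Finset ℕ)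
    (hP : ∀ p ∈ P, p.Prime ∧ (p : ℝ) ≤ y) :
    ∏ p ∈ P, (1 + (p : ℝ) ^ (1 / Real.log y - 1)) ≤ (1 + Real.log y) ^ 8 := by
  have hl : 0 < Real.log y := Real.log_pos hy
  have hκ : 0 < 1 / Real.log y := by positivity
  have h1 := prod_one_add_rpow_neg_le P (fun p hp => (hP p hp).1) hκ
  rw [one_div_one_div] at h1
  calc ∏ p ∈ P, (1 + (p : ℝ) ^ (1 / Real.log y - 1))
      ≤ ∏ p ∈ P, (1 + (p : ℝ) ^ (-(1 + 1 / Real.log y))) ^ 8 := by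
        refine Finset.prod_le_prod (fun p _ => by positivity) fun p hp => ?_
        obtain ⟨hpp, hpy⟩ := hP p hp
        have hp0 : (0 : ℝ) < p := by exact_mod_cast hpp.pos
        have h2 : (p : ℝ) ^ (1 / Real.log y - 1) =
            (p : ℝ) ^ (2 / Real.log y) * (p : ℝ) ^ (-(1 + 1 / Real.log y)) := by
          rw [← Real.rpow_add hp0]; congr 1; ring
        have h3 : (p : ℝ) ^ (2 / Real.log y) ≤ 8 := by
          rw [Real.rpow_def_of_pos hp0]
          have h4 : Real.log p * (2 / Real.log y) ≤ 2 := by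
            rw [mul_div_assoc', div_le_iff₀ hl]
            have := Real.log_le_log hp0 hpy
            linarith
          have h5 : Real.exp 2 = Real.exp 1 * Real.exp 1 := by rw [← Real.exp_add]; norm_num
          have h6 := Real.exp_one_lt_d9
          have h7 := Real.exp_pos 1
          calc Real.exp _ ≤ Real.exp 2 := Real.exp_le_exp.2 h4
            _ ≤ 8 := by rw [h5]; nlinarith
        have h8 := one_add_mul_le_pow (a := (p : ℝ) ^ (-(1 + 1 / Real.log y)))
          (by have : (0 : ℝ) ≤ (p : ℝ) ^ (-(1 + 1 / Real.log y)) := by positivity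
              linarith) 8
        refine le_trans ?_ h8
        rw [h2]
        push_cast
        gcongr
    _ = (∏ p ∈ P, (1 + (p : ℝ) ^ (-(1 + 1 / Real.log y)))) ^ 8 := by rw [Finset.prod_pow]
    _ ≤ _ := by
        have : 0 ≤ ∏ p ∈ P, (1 + (p : ℝ) ^ (-(1 + 1 / Real.log y))) :=
          Finset.prod_nonneg fun p _ => by positivity
        gcongr

/-- `n` has a squarefree divisor larger than `D` all of whose prime factors lie in `P`. -/
def HasLargeDivisor (P : Finset ℕ) (D : ℝ) (n : ℕ) : Prop :=
  ∃ T ∈ P.powerset, D < ((∏ p ∈ T, p : ℕ) : ℝ) ∧ ∏ p ∈ T, p ∣ n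

open Classical in
-- Rankin's trick: for a divisor `m > D` insert the factor `(m / D) ^ (1 / log y) ≥ 1` and complete
-- the sum to an Euler product.
lemma card_hasLargeDivisor_le (N : ℕ) {y D : ℝ} (hy : 1 < y) (hD : 0 < D) (P : Finset ℕ)
    (hP : ∀ p ∈ P, p.Prime ∧ (p : ℝ) ≤ y) :
    (((Icc 1 N).filter (HasLargeDivisor P D)).card : ℝ) ≤
      N * (D ^ (-(1 / Real.log y)) * (1 + Real.log y) ^ 8) := by
  have hl : 0 < Real.log y := Real.log_pos hy
  set s := P.powerset.filter fun T => D < ((∏ p ∈ T, p : ℕ) : ℝ) with hs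
  have hpos : ∀ T ∈ P.powerset, 0 < ∏ p ∈ T, p := fun T hT =>
    Finset.prod_pos fun p hp => (hP p (mem_powerset.1 hT hp)).1.pos
  refine (card_filter_exists_dvd_le N s (fun T => ∏ p ∈ T, p) _ ?_).trans ?_
  · rintro n _ _ ⟨T, hT, h1, h2⟩
    exact ⟨T, mem_filter.2 ⟨hT, h1⟩, h2⟩
  · refine mul_le_mul_of_nonneg_left ?_ (Nat.cast_nonneg _)
    calc ∑ T ∈ s, 1 / ((∏ p ∈ T, p : ℕ) : ℝ)
        ≤ ∑ T ∈ s, D ^ (-(1 / Real.log y)) *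
            ((∏ p ∈ T, p : ℕ) : ℝ) ^ (1 / Real.log y - 1) := by
          refine Finset.sum_le_sum fun T hT => ?_
          obtain ⟨h1, h2⟩ := mem_filter.1 hT
          have h3 : (0 : ℝ) < ((∏ p ∈ T, p : ℕ) : ℝ) := by exact_mod_cast hpos T h1
          rw [Real.rpow_sub_one h3.ne', Real.rpow_neg hD.le, mul_div_assoc']
          refine div_le_div_of_nonneg_right ?_ h3.le
          rw [inv_mul_eq_div, le_div_iff₀ (by positivity), one_mul]
          exact Real.rpow_le_rpow hD.le h2.le (by positivity)
      _ ≤ ∑ T ∈ P.powerset, D ^ (-(1 / Real.log y)) *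
            ((∏ p ∈ T, p : ℕ) : ℝ) ^ (1 / Real.log y - 1) :=
          Finset.sum_le_sum_of_subset_of_nonneg (Finset.filter_subset _ _)
            fun T _ _ => by positivity
      _ = D ^ (-(1 / Real.log y)) * ∏ p ∈ P, (1 + (p : ℝ) ^ (1 / Real.log y - 1)) := by
          rw [← Finset.mul_sum, prod_one_add_rpow_eq]
      _ ≤ _ := by
          have := prod_one_add_rpow_le hy P hP
          gcongr

lemma card_filter_Ioc_le (N : ℕ) {a b : ℝ} (hab : a ≤ b) (ha : 0 ≤ a) :
    (((Icc 1 N).filter fun n : ℕ => a < n ∧ (n : ℝ) ≤ b).card : ℝ) ≤ b - a + 1 := by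
  have h : ((Icc 1 N).filter fun n : ℕ => a < n ∧ (n : ℝ) ≤ b) ⊆ Ioc ⌊a⌋₊ ⌊b⌋₊ := by
    intro n hn
    obtain ⟨_, h1, h2⟩ := mem_filter.1 hn
    exact mem_Ioc.2 ⟨(Nat.floor_lt ha).2 h1, Nat.le_floor h2⟩
  have h1 := Finset.card_le_card h
  rw [Nat.card_Ioc] at h1
  have h2 : ((⌊b⌋₊ - ⌊a⌋₊ : ℕ) : ℝ) = (⌊b⌋₊ : ℝ) - ⌊a⌋₊ := Nat.cast_sub (Nat.floor_mono hab)
  have h3 := Nat.floor_le (ha.trans hab)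
  have h4 := Nat.lt_floor_add_one a
  have h5 : (((Icc 1 N).filter fun n : ℕ => a < n ∧ (n : ℝ) ≤ b).card : ℝ) ≤
    ((⌊b⌋₊ - ⌊a⌋₊ : ℕ) : ℝ) := by exact_mod_cast h1
  rw [h2] at h5
  linarith

/-- Cauchy-Schwarz against the fourth moment of `d`, whose logarithmic exponent is `2 ^ 4`. A sparse
set thus carries little of the second moment. -/
lemma sum_divisors_card_sq_le (N : ℕ) (s : Finset ℕ) (hs : s ⊆ Icc 1 N) :
    (∑ n ∈ s, (n.divisors.card : ℝ) ^ 2) ^ 2 ≤ s.card * (N * (1 + Real.log N) ^ 16) := by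
  have h1 := Finset.sum_mul_sq_le_sq_mul_sq s (fun _ => (1 : ℝ))
    fun n => (n.divisors.card : ℝ) ^ 2
  have h2 := sum_divisors_card_pow_le 4 N
  norm_num at h1 h2
  refine h1.trans (mul_le_mul_of_nonneg_left (le_trans ?_ h2) (Nat.cast_nonneg _))
  refine (Finset.sum_le_sum_of_subset_of_nonneg hs fun n _ _ => by positivity).trans (le_of_eq ?_)
  exact Finset.sum_congr rfl fun n _ => by ring

end HarmanMinorant

/-! ### Inequalities between the parameters for large `X`. -/

namespace HarmanMinorant

open Finset Filter

/-- A bound for the number of primes above `z₀` that divide an integer up to `2 X`. -/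
noncomputable def maxFactors (X : ℝ) : ℕ := ⌊2 * Real.log (Real.log X) ^ 3⌋₊

/-- A bound for the number of cells of ratio `1 + δ` that meet `[1, 2 X]`. -/
noncomputable def cellBound (A X : ℝ) : ℝ := 10 * Real.log X / delta A X

/-- The inequalities between the parameters that hold for all large `X`. -/
structure Regime (ε A X : ℝ) : Prop where
  X_pos : 0 < X
  eps_pos : 0 < ε
  eps_le : ε ≤ 1 / 100
  A_ge : 5 ≤ A
  log_ge : 10 ≤ Real.log X
  delta_mul_log_le : delta A X * Real.log X ≤ 1 / 100
  two_le_z₀ : 2 ≤ z₀Level X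
  inv_z₀_le : 1 / z₀Level X ≤ delta A X
  z₀_lt : z₀Level X < zLevel X
  maxFactors_le : maxFactors X + 3 ≤ ⌊Real.log X⌋₊
  card_le : ∀ k : ℕ, z₀Level X ^ k ≤ 2 * X → k ≤ maxFactors X
  four_le : 4 ≤ X ^ (ε / 4)
  smooth_le : (X ^ (ε / 4)) ^ (-(1 / Real.log (z₀Level X))) * (1 + Real.log (z₀Level X)) ^ 8 ≤
    delta A X
  z_pow_gt : 2 * X < zLevel X ^ 6
  count_le : 2 * (cellBound A X ^ 2 + cellBound A X ^ 5 +
    (maxFactors X + 1) * cellBound A X ^ maxFactors X * cellBound A X) ≤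
      Real.exp (Real.log (Real.log X) ^ 5)

lemma tendsto_loglog : Tendsto (fun X : ℝ => Real.log (Real.log X)) atTop atTop :=
  Real.tendsto_log_atTop.comp Real.tendsto_log_atTop

lemma eventually_loglog_pow_le (c : ℝ) (hc : 0 < c) (n : ℕ) :
    ∀ᶠ X : ℝ in atTop, c * Real.log (Real.log X) ^ n ≤ Real.log X := by
  have h := (Real.isLittleO_pow_log_id_atTop (n := n)).def (show 0 < 1 / c by positivity)
  filter_upwards [Real.tendsto_log_atTop.eventually h, tendsto_loglog.eventually_ge_atTop 0,
    Real.tendsto_log_atTop.eventually_ge_atTop 0] with X h1 h2 h3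
  rw [id, Real.norm_of_nonneg (by positivity), Real.norm_of_nonneg h3] at h1
  calc _ ≤ c * (1 / c * Real.log X) := by gcongr
    _ = _ := by field_simp

lemma eventually_rpow_ge (a c : ℝ) (ha : 0 < a) : ∀ᶠ X : ℝ in atTop, c ≤ X ^ a :=
  (tendsto_rpow_atTop ha).eventually_ge_atTop c

/-- Here `L = log X` and `t = log L`. As `10 ≤ L`, the base `M` is at most `exp ((10 A + 2) t)`; its
power of order `2 t³` is `exp (O(A t⁴))`, which `exp (t⁵)` beats once `t ≥ 100 A`. -/
lemma count_bound {A L t : ℝ} (hA : 5 ≤ A) (hL : 10 ≤ L) (ht : 100 * A ≤ t)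
    (hLt : Real.exp t = L) (hK : ⌊2 * t ^ 3⌋₊ + 3 ≤ ⌊L⌋₊) :
    2 * ((10 * L / L ^ (-(10 * A))) ^ 2 + (10 * L / L ^ (-(10 * A))) ^ 5 +
      (⌊2 * t ^ 3⌋₊ + 1) * (10 * L / L ^ (-(10 * A))) ^ ⌊2 * t ^ 3⌋₊ *
        (10 * L / L ^ (-(10 * A)))) ≤ Real.exp (t ^ 5) := by
  set K := ⌊2 * t ^ 3⌋₊ with hKdef
  have ht0 : 0 < t := by linarith
  have hL0 : 0 < L := by linarith
  set M := 10 * L / L ^ (-(10 * A)) with hM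
  have hpow : L ^ (-(10 * A)) = Real.exp (-(10 * A) * t) := by
    rw [← hLt, ← Real.exp_mul, mul_comm]
  have hM1 : M ≤ Real.exp ((10 * A + 2) * t) := by
    rw [hM, hpow, div_le_iff₀ (Real.exp_pos _), ← Real.exp_add]
    have : (10 * A + 2) * t + -(10 * A) * t = t + t := by ring
    rw [this, Real.exp_add, hLt]
    gcongr
  have hM2 : 1 ≤ M := by
    rw [hM, hpow, le_div_iff₀ (Real.exp_pos _), one_mul]
    have : Real.exp (-(10 * A) * t) ≤ 1 := Real.exp_le_one_iff.2 (by nlinarith)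
    linarith
  have hKL : (K : ℝ) + 3 ≤ L := by
    have h1 : ((K + 3 : ℕ) : ℝ) ≤ (⌊L⌋₊ : ℝ) := by exact_mod_cast hK
    push_cast at h1
    exact h1.trans (Nat.floor_le hL0.le)
  have hK2 : (K : ℝ) ≤ 2 * t ^ 3 := Nat.floor_le (by positivity)
  have hK0 : (0 : ℝ) ≤ K := Nat.cast_nonneg _
  have e1 : M ^ 2 ≤ M ^ (K + 5) := pow_le_pow_right₀ hM2 (by omega)
  have e2 : M ^ 5 ≤ M ^ (K + 5) := pow_le_pow_right₀ hM2 (by omega)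
  have e3 : M ^ K * M ≤ M ^ (K + 5) := by rw [← pow_succ]; exact pow_le_pow_right₀ hM2 (by omega)
  have e4 : M ^ (K + 5) ≤ Real.exp ((10 * A + 2) * t * (2 * t ^ 3 + 5)) := by
    calc M ^ (K + 5) ≤ (Real.exp ((10 * A + 2) * t)) ^ (K + 5) := by gcongr
      _ = Real.exp ((10 * A + 2) * t * (K + 5)) := by
        rw [← Real.exp_nat_mul]; congr 1; push_cast; ring
      _ ≤ _ := by
        apply Real.exp_le_exp.2
        have : 0 ≤ (10 * A + 2) * t := by positivity
        gcongr
  have e5 : 2 * ((K : ℝ) + 3) ≤ Real.exp (2 * t) := by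
    have : Real.exp (2 * t) = L * L := by rw [two_mul, Real.exp_add, hLt]
    rw [this]; nlinarith
  have hMp : 0 ≤ M ^ (K + 5) := by positivity
  calc 2 * (M ^ 2 + M ^ 5 + (K + 1) * M ^ K * M)
      ≤ 2 * (M ^ (K + 5) + M ^ (K + 5) + (K + 1) * M ^ (K + 5)) := by
        have : ((K : ℝ) + 1) * M ^ K * M ≤ (K + 1) * M ^ (K + 5) := by
          rw [mul_assoc]; gcongr
        linarith
    _ = 2 * ((K : ℝ) + 3) * M ^ (K + 5) := by ring
    _ ≤ Real.exp (2 * t) * Real.exp ((10 * A + 2) * t * (2 * t ^ 3 + 5)) := by gcongr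
    _ = Real.exp (2 * t + (10 * A + 2) * t * (2 * t ^ 3 + 5)) := by rw [Real.exp_add]
    _ ≤ _ := by
      apply Real.exp_le_exp.2
      have h1 : 10 * A + 2 ≤ t / 9 := by linarith
      have h2 : (10 * A + 2) * t * (2 * t ^ 3 + 5) ≤ t / 9 * t * (2 * t ^ 3 + 5) := by gcongr
      have ht1 : 1 ≤ t := by linarith
      have h3 : t ≤ t ^ 5 := le_self_pow₀ ht1 (by norm_num)
      have h4 : t ^ 2 ≤ t ^ 5 := pow_le_pow_right₀ ht1 (by norm_num)
      have h5 : t * 10 ≤ t ^ 5 := by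
        have h6 : t ^ 2 * 1 ≤ t ^ 5 := by linarith
        nlinarith
      nlinarith

/-- With `L = log X`, `t = log L`: `10 A t⁴ ≤ L` gives `1 / z₀ ≤ δ`; `t` large against `1 / ε` lets
the Rankin saving `exp (-(ε / 4) t³)` beat `L ^ (16 + 10 A)`; and `X ^ (1 / 11) ≥ 3` gives `z⁶ = X ^
(12 / 11) > 2 X`. -/
lemma eventually_regime {ε A : ℝ} (hε : 0 < ε) (hε' : ε ≤ 1 / 100) (hA : 5 ≤ A) :
    ∀ᶠ X : ℝ in atTop, Regime ε A X := by
  filter_upwards [Real.tendsto_log_atTop.eventually_ge_atTop 10,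
    tendsto_loglog.eventually_ge_atTop (100 * A),
    tendsto_loglog.eventually_ge_atTop (4 / ε * (16 + 10 * A)),
    eventually_loglog_pow_le (10 * A) (by positivity) 4,
    eventually_loglog_pow_le 3 (by norm_num) 3,
    eventually_rpow_ge (ε / 4) 4 (by positivity),
    eventually_rpow_ge (1 / 11) 3 (by norm_num), eventually_gt_atTop 0] with X
    hL ht ht2 h4 h3 h5 h6 hX
  set L := Real.log X with hLdef
  set t := Real.log L with htdef
  have hL0 : 0 < L := by linarith
  have ht0 : 0 < t := by linarith
  have hLt : Real.exp t = L := Real.exp_log hL0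
  have hXL : X = Real.exp L := (Real.exp_log hX).symm
  have hδ : delta A X = Real.exp (-(10 * A) * t) := by
    rw [delta, ← hLdef, ← hLt, ← Real.exp_mul, mul_comm]
  have hz₀ : z₀Level X = Real.exp (L / t ^ 3) := rfl
  have hlogz₀ : Real.log (z₀Level X) = L / t ^ 3 := by rw [hz₀, Real.log_exp]
  have hz : zLevel X = Real.exp (L * (2 / 11)) := by
    rw [zLevel]; nth_rewrite 1 [hXL]; rw [← Real.exp_mul]
  have h7 : 10 * A * t ≤ L / t ^ 3 := by
    rw [le_div_iff₀ (by positivity)]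
    calc _ = 10 * A * t ^ 4 := by ring
      _ ≤ L := h4
  have hmf : maxFactors X + 3 ≤ ⌊L⌋₊ := by
    rw [Nat.le_floor_iff hL0.le]
    push_cast
    have : (maxFactors X : ℝ) ≤ 2 * t ^ 3 := Nat.floor_le (by positivity)
    have : (500 : ℝ) ^ 3 ≤ t ^ 3 := by gcongr; linarith
    linarith
  refine ⟨hX, hε, hε', hA, hL, ?_, ?_, ?_, ?_, hmf, ?_, h5, ?_, ?_, ?_⟩
  · rw [hδ, ← hLdef, ← hLt, ← Real.exp_add]
    calc Real.exp (-(10 * A) * t + t) ≤ Real.exp (-(t + t)) := by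
          apply Real.exp_le_exp.2; nlinarith
      _ = (L * L)⁻¹ := by rw [Real.exp_neg, Real.exp_add, hLt]
      _ ≤ 1 / 100 := by
          rw [one_div]; apply inv_anti₀ (by norm_num); nlinarith
  · rw [hz₀]
    have := Real.add_one_le_exp (L / t ^ 3)
    nlinarith
  · rw [hz₀, one_div, ← Real.exp_neg, hδ]
    apply Real.exp_le_exp.2; linarith
  · rw [hz₀, hz]
    apply Real.exp_lt_exp.2
    rw [div_lt_iff₀ (by positivity)]
    have : (500 : ℝ) ^ 3 ≤ t ^ 3 := by gcongr; linarith
    nlinarith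
  · intro k hk
    refine Nat.le_floor ?_
    have h8 := Real.log_le_log (by rw [hz₀]; positivity) hk
    rw [Real.log_pow, hlogz₀, Real.log_mul (by norm_num) hX.ne', ← hLdef] at h8
    have h9 : Real.log 2 ≤ L := by linarith [Real.log_two_lt_d9]
    have h10 : (k : ℝ) * (L / t ^ 3) ≤ 2 * L := by linarith
    rw [mul_div_assoc', div_le_iff₀ (by positivity)] at h10
    have : (k : ℝ) * L ≤ 2 * t ^ 3 * L := by linarith
    exact le_of_mul_le_mul_right this hL0
  · rw [hlogz₀, hδ]
    have e1 : (X ^ (ε / 4)) ^ (-(1 / (L / t ^ 3))) = Real.exp (-(ε / 4 * t ^ 3)) := by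
      nth_rewrite 1 [hXL]
      rw [← Real.exp_mul, ← Real.exp_mul]
      congr 1
      field_simp
    have ht1 : 1 ≤ t ^ 3 := one_le_pow₀ (by linarith)
    have e2 : L / t ^ 3 ≤ L := div_le_self hL0.le ht1
    have e3 : (1 + L / t ^ 3) ^ 8 ≤ Real.exp (16 * t) := by
      calc (1 + L / t ^ 3) ^ 8 ≤ (L * L) ^ 8 := by
            have : 0 ≤ L / t ^ 3 := by positivity
            gcongr; nlinarith
        _ = L ^ 16 := by ring
        _ = _ := by rw [← hLt, ← Real.exp_nat_mul]; norm_num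
    rw [e1]
    calc Real.exp (-(ε / 4 * t ^ 3)) * (1 + L / t ^ 3) ^ 8
        ≤ Real.exp (-(ε / 4 * t ^ 3)) * Real.exp (16 * t) := by gcongr
      _ = Real.exp (-(ε / 4 * t ^ 3) + 16 * t) := by rw [Real.exp_add]
      _ ≤ _ := by
        apply Real.exp_le_exp.2
        have h8 : 16 + 10 * A ≤ ε / 4 * t := by
          have := mul_le_mul_of_nonneg_left ht2 (show 0 ≤ ε / 4 by positivity)
          have e : ε / 4 * (4 / ε * (16 + 10 * A)) = 16 + 10 * A := by field_simp
          linarith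
        have h9 : ε / 4 * t ^ 2 ≤ ε / 4 * t ^ 3 := by
          gcongr
          · linarith
          · norm_num
        nlinarith
  · rw [hz, ← Real.exp_nat_mul]
    have e : ((6 : ℕ) : ℝ) * (L * (2 / 11)) = L + L * (1 / 11) := by push_cast; ring
    rw [e, Real.exp_add, ← hXL]
    have : Real.exp (L * (1 / 11)) = X ^ (1 / 11 : ℝ) := by
      nth_rewrite 1 [hXL]; rw [← Real.exp_mul]
    rw [this]
    nlinarith
  · exact count_bound hA hL ht hLt hmf

end HarmanMinorant

/-! ### The geometric grid and products over sets of cells. -/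

namespace HarmanMinorant

open Finset

/-- The points of the geometric grid of ratio `1 + δ` through `z₀`. -/
noncomputable def gridPt (A X : ℝ) (i : ℤ) : ℝ := z₀Level X * (1 + delta A X) ^ i

/-- The index of the cell of the grid that contains `x`. -/
noncomputable def cell (A X x : ℝ) : ℤ :=
  ⌈Real.log (x / z₀Level X) / Real.log (1 + delta A X)⌉ - 1

/-- The primes in a cell. -/
noncomputable def cellPrimes (A X : ℝ) (i : ℤ) : Finset ℕ :=
  primesIoc (gridPt A X i) (gridPt A X i * (1 + delta A X))

noncomputable def cellSum (A X : ℝ) (i : ℤ) : AF := ∑ p ∈ cellPrimes A X i, pt p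

/-- The cells between `z₀` and `z`. -/
noncomputable def lowCells (A X : ℝ) : Finset ℤ := Finset.Ico 0 (cell A X (zLevel X))

/-- The indicator of the products of primes, one from each cell of `S`. -/
noncomputable def cellProd (A X : ℝ) (S : Finset ℤ) : AF := ∏ i ∈ S, cellSum A X i

noncomputable def cellVal (A X : ℝ) (S : Finset ℤ) : ℝ := ∏ i ∈ S, gridPt A X i

section Grid

variable {ε A X : ℝ}

namespace Regime

variable (H : Regime ε A X)
include H

lemma log_pos : 0 < Real.log X := by linarith [H.log_ge]

lemma one_lt_X : 1 < X := by
  by_contra h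
  have := Real.log_nonpos H.X_pos.le (not_lt.1 h)
  linarith [H.log_pos]

lemma delta_pos : 0 < delta A X := Real.rpow_pos_of_pos H.log_pos _

lemma delta_le : delta A X ≤ 1 / 1000 := by
  have h1 := H.delta_mul_log_le
  have h2 := H.log_ge
  have h3 := H.delta_pos
  nlinarith

lemma z₀_pos : 0 < z₀Level X := by linarith [H.two_le_z₀]

lemma z_pos : 0 < zLevel X := H.z₀_pos.trans H.z₀_lt

lemma log_ratio_pos : 0 < Real.log (1 + delta A X) := Real.log_pos (by linarith [H.delta_pos])

lemma gridPt_pos (i : ℤ) : 0 < gridPt A X i :=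
  mul_pos H.z₀_pos (zpow_pos (by linarith [H.delta_pos]) _)

lemma gridPt_succ (i : ℤ) : gridPt A X (i + 1) = gridPt A X i * (1 + delta A X) := by
  rw [gridPt, gridPt, zpow_add_one₀ (by linarith [H.delta_pos]), mul_assoc]

lemma gridPt_mono {i j : ℤ} (h : i ≤ j) : gridPt A X i ≤ gridPt A X j :=
  mul_le_mul_of_nonneg_left (zpow_le_zpow_right₀ (by linarith [H.delta_pos]) h) H.z₀_pos.le

omit H in
lemma gridPt_zero : gridPt A X 0 = z₀Level X := by simp [gridPt]

omit H in
lemma log_gridPt_div (hz : 0 < z₀Level X) (i : ℤ) :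
    Real.log (gridPt A X i / z₀Level X) = i * Real.log (1 + delta A X) := by
  rw [gridPt, mul_div_cancel_left₀ _ hz.ne', Real.log_zpow]

lemma gridPt_lt_iff {x : ℝ} (hx : 0 < x) (i : ℤ) :
    gridPt A X i < x ↔ (i : ℝ) < Real.log (x / z₀Level X) / Real.log (1 + delta A X) := by
  have hz := H.z₀_pos
  rw [lt_div_iff₀ H.log_ratio_pos, ← log_gridPt_div hz,
    Real.log_lt_log_iff (div_pos (H.gridPt_pos i) hz) (div_pos hx hz), div_lt_div_iff_of_pos_right hz]

/-- The ceiling minus one in `cell` makes the cells open on the left and closed on the right, like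
the ranges `M < m ≤ (1 + δ) M` of the three types. -/
lemma cell_eq_iff {x : ℝ} (hx : 0 < x) (i : ℤ) :
    cell A X x = i ↔ gridPt A X i < x ∧ x ≤ gridPt A X i * (1 + delta A X) := by
  have h2 := H.gridPt_lt_iff hx (i + 1)
  rw [H.gridPt_succ] at h2
  rw [← not_lt, h2, H.gridPt_lt_iff hx, cell, sub_eq_iff_eq_add, Int.ceil_eq_iff, not_lt]
  push_cast
  rw [add_sub_cancel_right]

lemma lt_of_cell {x : ℝ} (hx : 0 < x) : gridPt A X (cell A X x) < x :=
  ((H.cell_eq_iff hx _).1 rfl).1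

lemma le_of_cell {x : ℝ} (hx : 0 < x) : x ≤ gridPt A X (cell A X x) * (1 + delta A X) :=
  ((H.cell_eq_iff hx _).1 rfl).2

lemma cell_mono {x y : ℝ} (hx : 0 < x) (h : x ≤ y) : cell A X x ≤ cell A X y := by
  have hz := H.z₀_pos
  have hr := H.log_ratio_pos
  refine sub_le_sub_right (Int.ceil_mono (div_le_div_of_nonneg_right ?_ hr.le)) _
  exact Real.log_le_log (div_pos hx hz) (div_le_div_of_nonneg_right h hz.le)

lemma mem_cellPrimes {i : ℤ} {p : ℕ} : p ∈ cellPrimes A X i ↔ p.Prime ∧ cell A X p = i := by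
  rw [cellPrimes, mem_primesIoc]
  refine and_congr_right fun hp => ?_
  rw [H.cell_eq_iff (by exact_mod_cast hp.pos)]

omit H in
lemma prime_of_mem_cellPrimes {i : ℤ} {p : ℕ} (hp : p ∈ cellPrimes A X i) : p.Prime :=
  (mem_primesIoc.1 hp).1

lemma topCell_nonneg : 0 ≤ cell A X (zLevel X) := by
  by_contra h
  have h1 := H.le_of_cell H.z_pos
  rw [← H.gridPt_succ] at h1
  have h2 := H.gridPt_mono (show cell A X (zLevel X) + 1 ≤ 0 by omega)
  rw [gridPt_zero] at h2
  linarith [H.z₀_lt]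

lemma gridPt_lt_z {i : ℤ} (hi : i ∈ lowCells A X) : gridPt A X i < zLevel X :=
  (H.gridPt_mono (Finset.mem_Ico.1 hi).2.le).trans_lt (H.lt_of_cell H.z_pos)

lemma z₀_le_gridPt {i : ℤ} (hi : i ∈ lowCells A X) : z₀Level X ≤ gridPt A X i := by
  rw [← gridPt_zero (A := A)]
  exact H.gridPt_mono (Finset.mem_Ico.1 hi).1

lemma lt_z_of_mem_cellPrimes {i : ℤ} (hi : i ∈ lowCells A X) {p : ℕ} (hp : p ∈ cellPrimes A X i) :
    (p : ℝ) < zLevel X := by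
  have h1 := (mem_primesIoc.1 hp).2.2
  rw [← H.gridPt_succ] at h1
  exact (h1.trans (H.gridPt_mono (Finset.mem_Ico.1 hi).2)).trans_lt (H.lt_of_cell H.z_pos)

lemma z₀_lt_of_mem_cellPrimes {i : ℤ} (hi : i ∈ lowCells A X) {p : ℕ}
    (hp : p ∈ cellPrimes A X i) : z₀Level X < p :=
  (H.z₀_le_gridPt hi).trans_lt (mem_primesIoc.1 hp).2.1

lemma cellVal_pos (S : Finset ℤ) : 0 < cellVal A X S := Finset.prod_pos fun i _ => H.gridPt_pos i

/-- Each prime exceeds the left end of its cell by a factor in `(1, 1 + δ]`. Strictness at the left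
fails only for the empty product, where both sides are `1`. -/
lemma cellProd_support (S : Finset ℤ) {m : ℕ} (hm : cellProd A X S m ≠ 0) :
    cellVal A X S ≤ m ∧ (S.Nonempty → cellVal A X S < m) ∧
      (m : ℝ) ≤ cellVal A X S * (1 + delta A X) ^ S.card := by
  classical
  induction S using Finset.induction_on generalizing m with
  | empty =>
    rw [cellProd, Finset.prod_empty, ArithmeticFunction.one_apply] at hm
    have : m = 1 := by by_contra h; exact hm (if_neg h)
    subst this
    simp [cellVal]
  | insert i S hi ih =>
    rw [cellProd, Finset.prod_insert hi] at hm
    obtain ⟨a, b, hab, ha, hb⟩ := exists_of_mul_ne_zero hm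
    obtain ⟨h1, -, h3⟩ := ih hb
    obtain ⟨p, hp, hpa⟩ := exists_of_sum_ne_zero ha
    obtain rfl := eq_of_pt_ne_zero hpa
    obtain ⟨-, h4, h5⟩ := mem_primesIoc.1 hp
    have hS := H.cellVal_pos S
    have hg := H.gridPt_pos i
    have hlt : cellVal A X (insert i S) < m := by
      rw [cellVal, Finset.prod_insert hi, ← hab]
      push_cast
      exact mul_lt_mul h4 h1 hS (Nat.cast_nonneg a)
    refine ⟨hlt.le, fun _ => hlt, ?_⟩
    rw [cellVal, Finset.prod_insert hi, ← hab, Finset.card_insert_of_notMem hi, pow_succ]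
    push_cast
    calc (a : ℝ) * b ≤ gridPt A X i * (1 + delta A X) *
          (cellVal A X S * (1 + delta A X) ^ S.card) :=
          mul_le_mul h5 h3 (Nat.cast_nonneg b) ((Nat.cast_nonneg a).trans h5)
      _ = _ := by rw [cellVal]; ring

/-- With the field `card_le` of `Regime`, this limits the number of cells in a set of value at most
`2 X`. -/
lemma z₀_pow_card_le_cellVal {S : Finset ℤ} (hS : S ⊆ lowCells A X) :
    z₀Level X ^ S.card ≤ cellVal A X S := by
  rw [← Finset.prod_const, cellVal]
  exact Finset.prod_le_prod (fun _ _ => H.z₀_pos.le) fun i hi => H.z₀_le_gridPt (hS hi)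

end Regime

/-- The cells that meet `[1, 2 X]`. -/
noncomputable def cells (A X : ℝ) : Finset ℤ := Finset.Icc (cell A X 1) (cell A X (2 * X))

namespace Regime

variable (H : Regime ε A X)
include H

lemma cell_mem_cells {x : ℝ} (hx : 1 ≤ x) (hx' : x ≤ 2 * X) : cell A X x ∈ cells A X :=
  Finset.mem_Icc.2 ⟨H.cell_mono one_pos hx, H.cell_mono (by linarith) hx'⟩

/-- There are `log (2 X) / log (1 + δ)` cells up to an additive `2`, and `log (1 + δ) ≥ δ / 2`; the
generous constant `10` absorbs the rest. -/
lemma card_cells_le : ((cells A X).card : ℝ) ≤ cellBound A X := by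
  have hz := H.z₀_pos
  have hr := H.log_ratio_pos
  have hδ := H.delta_pos
  have hδ1 := H.delta_le
  have hL := H.log_ge
  have hX := H.X_pos
  have h0 : cell A X 1 ≤ cell A X (2 * X) := H.cell_mono one_pos (by linarith [H.one_lt_X])
  have h1 : (cell A X (2 * X) : ℝ) ≤ Real.log (2 * X / z₀Level X) / Real.log (1 + delta A X) := by
    have := Int.ceil_lt_add_one (Real.log (2 * X / z₀Level X) / Real.log (1 + delta A X))
    rw [cell]; push_cast; linarith
  have h2 : Real.log (1 / z₀Level X) / Real.log (1 + delta A X) - 1 ≤ (cell A X 1 : ℝ) := by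
    have := Int.le_ceil (Real.log (1 / z₀Level X) / Real.log (1 + delta A X))
    rw [cell]; push_cast; linarith
  have h3 : ((cells A X).card : ℝ) = (cell A X (2 * X) : ℝ) + 1 - cell A X 1 := by
    rw [cells, Int.card_Icc]
    have : (((cell A X (2 * X) + 1 - cell A X 1).toNat : ℤ) : ℝ) =
        ((cell A X (2 * X) + 1 - cell A X 1 : ℤ) : ℝ) := by
      rw [Int.toNat_of_nonneg (by omega)]
    push_cast at this
    exact_mod_cast this
  have h4 : Real.log (2 * X / z₀Level X) / Real.log (1 + delta A X) -
      Real.log (1 / z₀Level X) / Real.log (1 + delta A X) =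
        Real.log (2 * X) / Real.log (1 + delta A X) := by
    rw [Real.log_div (by positivity) hz.ne', Real.log_div one_ne_zero hz.ne', Real.log_one]
    ring
  have h5 : delta A X / 2 ≤ Real.log (1 + delta A X) := by
    refine le_trans ?_ (Real.one_sub_inv_le_log_of_pos (by linarith))
    have : 1 - (1 + delta A X)⁻¹ = delta A X / (1 + delta A X) := by field_simp; ring
    rw [this]
    exact div_le_div_of_nonneg_left hδ.le (by linarith) (by linarith)
  have h6 : Real.log (2 * X) ≤ 2 * Real.log X := by
    rw [Real.log_mul two_ne_zero hX.ne']
    linarith [Real.log_two_lt_d9]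
  have h7 : Real.log (2 * X) / Real.log (1 + delta A X) ≤ 4 * Real.log X / delta A X := by
    calc _ ≤ 2 * Real.log X / (delta A X / 2) := by gcongr
      _ = _ := by field_simp; ring
  have h8 : 2 ≤ 6 * Real.log X / delta A X := by
    rw [le_div_iff₀ hδ]; nlinarith
  have h9 : cellBound A X = 4 * Real.log X / delta A X + 6 * Real.log X / delta A X := by
    rw [cellBound]; ring
  rw [h3, h9]
  linarith

lemma lowCells_subset : lowCells A X ⊆ cells A X := by
  intro i hi
  obtain ⟨h1, h2⟩ := Finset.mem_Ico.1 hi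
  refine Finset.mem_Icc.2 ⟨?_, h2.le.trans (H.cell_mono H.z_pos ?_)⟩
  · have h3 := H.lt_of_cell one_pos
    by_contra h
    have h4 := H.gridPt_mono (show 0 ≤ cell A X 1 by omega)
    rw [gridPt_zero] at h4
    linarith [H.two_le_z₀]
  · have : zLevel X ≤ X := by
      rw [zLevel]
      nth_rewrite 2 [← Real.rpow_one X]
      exact Real.rpow_le_rpow_of_exponent_le H.one_lt_X.le (by norm_num)
    linarith [H.X_pos]

end Regime

end Grid

end HarmanMinorant

/-! ### The modified sieve identity at good integers. -/

namespace HarmanMinorant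

open Finset

/-- The part of `∏_{p ≤ z₀} (1 - pt p)` that is supported up to `X ^ (ε / 4)`. -/
noncomputable def muSmooth (ε X : ℝ) : AF :=
  ∑ T ∈ (primesIoc 0 (z₀Level X)).powerset.filter
    (fun T => ((∏ p ∈ T, p : ℕ) : ℝ) ≤ X ^ (ε / 4)), (-1 : AF) ^ T.card * pt (∏ p ∈ T, p)

noncomputable def smallSets (ε A X : ℝ) : Finset (Finset ℤ) :=
  (lowCells A X).powerset.filter fun S => cellVal A X S < X ^ (ε / 2)

/-- Sets of value above `2 X` are left out: every product from such a set exceeds the integers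
considered. -/
noncomputable def largeSets (ε A X : ℝ) : Finset (Finset ℤ) :=
  (lowCells A X).powerset.filter fun S => X ^ (ε / 2) ≤ cellVal A X S ∧ cellVal A X S ≤ 2 * X

noncomputable def muCells (A X : ℝ) (s : Finset (Finset ℤ)) : AF :=
  ∑ S ∈ s, (-1 : AF) ^ S.card * cellProd A X S

/-- The primes in the ranges of the second and third sum of the minorant. -/
noncomputable def midPrimes (ε X : ℝ) : Finset ℕ := primesIco (zLevel X) (X ^ (1 / 4 - 2 * ε))

noncomputable def midSum (ε A X : ℝ) (i : ℤ) : AF :=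
  ∑ q ∈ (midPrimes ε X).filter (fun q : ℕ => cell A X q = i), pt q

noncomputable def midPairSum (ε A X : ℝ) (i : ℤ) : AF :=
  ∑ q ∈ (midPrimes ε X ×ˢ midPrimes ε X).filter (fun q => q.2 < q.1 ∧ cell A X q.1 = i),
    pt q.1 * pt q.2

/-- Pairs of cells all of whose members satisfy the conditions on `(q₁, q₂)`. -/
noncomputable def cellPairs (ε A X : ℝ) : Finset (ℤ × ℤ) :=
  (cells A X ×ˢ cells A X).filter fun i =>
    i.2 < i.1 ∧ gridPt A X (i.1 + 1) * gridPt A X (i.2 + 1) ^ 4 < X ^ (1 - 2 * ε)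

/-- `q₁` and `(q₂, q₃)` are linked only through the cells of `q₁` and `q₂`, so they can enter
different coefficients. The condition `q₃ < q₂` stays inside `midPairSum`. -/
noncomputable def weight₃' (ε A X : ℝ) : AF :=
  ∑ i ∈ cellPairs ε A X, midSum ε A X i.1 * midPairSum ε A X i.2

/-- The conditions on `n` under which the decomposition is exact. -/
structure GoodAt (ε A X Y : ℝ) (n : ℕ) : Prop where
  ne_zero : n ≠ 0
  le : (n : ℝ) ≤ 2 * X
  lower : (1 + delta A X) ^ ⌊Real.log X⌋₊ * (Y / 2) < n
  upper : (1 + delta A X) ^ ⌊Real.log X⌋₊ * n ≤ 4 * Y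
  smooth : ¬ HasLargeDivisor (primesIoc 0 (z₀Level X)) (X ^ (ε / 4)) n
  window₁ : ¬ HasWindowDivisor (z₀Level X) ((1 + delta A X) ^ 5) (fun a => a) n
  window₂ : ¬ HasWindowDivisor (z₀Level X) ((1 + delta A X) ^ 5)
    (fun a => X ^ (1 - 2 * ε) / (a : ℝ) ^ 4 / (1 + delta A X) ^ 5) n
  window₃ : ¬ HasWindowDivisor (z₀Level X) ((1 + delta A X) ^ 5)
    (fun _ => zLevel X / (1 + delta A X)) n

variable {ε A X Y : ℝ} {n : ℕ}

local notation "[" f "]_" n => Ideal.Quotient.mk (vanishIdeal n) f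

lemma GoodAt.mk_muSmooth (G : GoodAt ε A X Y n) :
    ([∏ p ∈ primesIoc 0 (z₀Level X), (1 - pt p)]_n) = [muSmooth ε X]_n := by
  rw [prod_one_sub_pt_eq _ fun p hp => (mem_primesIoc.1 hp).1, muSmooth, Ideal.Quotient.eq,
    ← Finset.sum_filter_add_sum_filter_not _
      (fun T => ((∏ p ∈ T, p : ℕ) : ℝ) ≤ X ^ (ε / 4)), add_sub_cancel_left]
  refine Ideal.sum_mem _ fun T hT => Ideal.mul_mem_left _ _ (pt_mem_vanishIdeal fun hd => ?_)
  obtain ⟨h1, h2⟩ := mem_filter.1 hT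
  exact G.smooth ⟨T, h1, not_le.1 h2, hd⟩

lemma prod_one_sub_cellSum (C : Finset ℤ) :
    ∏ i ∈ C, (1 - cellSum A X i) = muCells A X C.powerset := by
  simp only [sub_eq_add_neg]
  rw [Finset.prod_one_add, muCells]
  refine Finset.sum_congr rfl fun T _ => ?_
  simp only [neg_eq_neg_one_mul (cellSum A X _)]
  rw [Finset.prod_mul_distrib, Finset.prod_const, cellProd]

/-- Two primes of one cell dividing `n` would violate `window₁`, so each full cell factor
linearizes. The cell containing `z`, which `z` may cut, has no prime below `z` dividing `n` by
`window₃`. -/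
lemma GoodAt.mk_cells (G : GoodAt ε A X Y n) (H : Regime ε A X) :
    ([∏ p ∈ (primesIco 0 (zLevel X)).filter (fun p : ℕ => ¬ (p : ℝ) ≤ z₀Level X), (1 - pt p)]_n) =
      [muCells A X (lowCells A X).powerset]_n := by
  have hδ := H.delta_pos
  have hδ1 : 1 ≤ 1 + delta A X := by linarith
  set R := (primesIco 0 (zLevel X)).filter (fun p : ℕ => ¬ (p : ℝ) ≤ z₀Level X) with hR
  have hmem : ∀ p, p ∈ R ↔ p.Prime ∧ z₀Level X < p ∧ (p : ℝ) < zLevel X := by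
    intro p
    rw [hR, mem_filter, mem_primesIco, not_le]
    have : (0 : ℝ) ≤ p := Nat.cast_nonneg p
    tauto
  have hmaps : ∀ p ∈ R, cell A X p ∈ Finset.Icc 0 (cell A X (zLevel X)) := by
    intro p hp
    obtain ⟨h1, h2, h3⟩ := (hmem p).1 hp
    have hp0 : (0 : ℝ) < p := by exact_mod_cast h1.pos
    refine Finset.mem_Icc.2 ⟨?_, H.cell_mono hp0 h3.le⟩
    by_contra h
    have h4 := H.le_of_cell hp0
    rw [← H.gridPt_succ] at h4
    have h5 := H.gridPt_mono (show cell A X p + 1 ≤ 0 by omega)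
    rw [Regime.gridPt_zero] at h5
    linarith
  rw [← Finset.prod_fiberwise_of_maps_to hmaps, ← Finset.Ico_insert_right H.topCell_nonneg,
    Finset.prod_insert Finset.right_notMem_Ico, map_mul, mk_prod_one_sub_pt_eq_one,
    ← map_one (Ideal.Quotient.mk (vanishIdeal n)), ← map_mul, one_mul, ← prod_one_sub_cellSum, map_prod, map_prod]
  · refine Finset.prod_congr rfl fun i hi => ?_
    have hfib : R.filter (fun p : ℕ => cell A X p = i) = cellPrimes A X i := by
      ext p
      rw [mem_filter, hmem, H.mem_cellPrimes]
      refine ⟨fun h => ⟨h.1.1, h.2⟩, fun h => ⟨⟨h.1, ?_, ?_⟩, h.2⟩⟩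
      · exact H.z₀_lt_of_mem_cellPrimes hi (H.mem_cellPrimes.2 h)
      · exact H.lt_z_of_mem_cellPrimes hi (H.mem_cellPrimes.2 h)
    rw [hfib, mk_prod_one_sub_pt n _ fun p hp => Regime.prime_of_mem_cellPrimes hp]
    · rfl
    · intro p hp q hq hpq hd
      have hpq' : (p : ℝ) < q := by exact_mod_cast hpq
      refine G.window₁ ⟨p, q, hd, (H.z₀_lt_of_mem_cellPrimes hi hq).le, hpq'.le, ?_⟩
      have h1 := (mem_primesIoc.1 hp).2.1
      have h2 := (mem_primesIoc.1 hq).2.2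
      calc (q : ℝ) ≤ gridPt A X i * (1 + delta A X) := h2
        -- One factor `1 + δ` would do here. The fifth power is needed in `window₂`, where it comes
        -- from `q₁ q₂⁴`.
        _ ≤ p * (1 + delta A X) ^ 5 := by
          gcongr
          exact le_self_pow₀ hδ1 (by norm_num)
        _ = _ := mul_comm _ _
  · intro p hp hd
    obtain ⟨h0, h1⟩ := mem_filter.1 hp
    obtain ⟨h2, h3, h4⟩ := (hmem p).1 h0
    have hp0 : (0 : ℝ) < p := by exact_mod_cast h2.pos
    refine G.window₃ ⟨1, p, by simpa using hd, h3.le, ?_, ?_⟩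
    · rw [div_le_iff₀ (by linarith)]
      have h5 := H.le_of_cell H.z_pos
      have h6 := H.lt_of_cell hp0
      rw [h1] at h6
      calc zLevel X ≤ _ := h5
        _ ≤ _ := by gcongr
    · rw [mul_div_assoc', le_div_iff₀ (by linarith), pow_succ]
      have h7 : 1 ≤ (1 + delta A X) ^ 4 := one_le_pow₀ hδ1
      have h8 := H.z_pos
      calc (p : ℝ) * (1 + delta A X) ≤ zLevel X * (1 + delta A X) := by gcongr
        _ ≤ (1 + delta A X) ^ 4 * zLevel X * (1 + delta A X) := by
          gcongr
          exact le_mul_of_one_le_left h8.le h7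
        _ = _ := by ring

lemma GoodAt.mk_muCells (G : GoodAt ε A X Y n) (H : Regime ε A X) :
    ([muCells A X (lowCells A X).powerset]_n) =
      [muCells A X (smallSets ε A X) + muCells A X (largeSets ε A X)]_n := by
  have hsplit : muCells A X (lowCells A X).powerset =
      muCells A X (smallSets ε A X) + muCells A X (largeSets ε A X) +
        muCells A X (((lowCells A X).powerset.filter fun S => ¬ cellVal A X S < X ^ (ε / 2)).filter
          fun S => ¬ cellVal A X S ≤ 2 * X) := by
    have h1 : largeSets ε A X = ((lowCells A X).powerset.filter
        fun S => ¬ cellVal A X S < X ^ (ε / 2)).filter fun S => cellVal A X S ≤ 2 * X := by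
      rw [largeSets, Finset.filter_filter]
      simp only [not_lt]
    rw [h1, muCells, muCells, muCells, muCells, add_assoc, Finset.sum_filter_add_sum_filter_not,
      smallSets, Finset.sum_filter_add_sum_filter_not]
  rw [hsplit, Ideal.Quotient.eq, add_sub_cancel_left]
  refine Ideal.sum_mem _ fun S hS => Ideal.mul_mem_left _ _ fun d hd hd0 => ?_
  by_contra h
  have h1 := (H.cellProd_support S h).1
  have h2 := (mem_filter.1 hS).2
  have h3 : (d : ℝ) ≤ n := by exact_mod_cast Nat.le_of_dvd (Nat.pos_of_ne_zero G.ne_zero) hd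
  linarith [G.le]

lemma GoodAt.mk_rhoAF (G : GoodAt ε A X Y n) (H : Regime ε A X) :
    ([rhoAF (zLevel X)]_n) =
      [(muCells A X (smallSets ε A X) + muCells A X (largeSets ε A X)) * muSmooth ε X *
        constOne]_n := by
  have h : (primesIco 0 (zLevel X)).filter (fun p : ℕ => (p : ℝ) ≤ z₀Level X) =
      primesIoc 0 (z₀Level X) := by
    ext p
    rw [mem_filter, mem_primesIco, mem_primesIoc]
    constructor
    · rintro ⟨⟨h1, -, -⟩, h2⟩
      exact ⟨h1, by exact_mod_cast h1.pos, h2⟩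
    · rintro ⟨h1, h2, h3⟩
      exact ⟨⟨h1, h2.le, h3.trans_lt H.z₀_lt⟩, h3⟩
  rw [rhoAF, ← Finset.prod_filter_mul_prod_filter_not _ (fun p : ℕ => (p : ℝ) ≤ z₀Level X), h,
    map_mul, map_mul, G.mk_muSmooth, G.mk_cells H, G.mk_muCells H, map_mul, map_mul]
  ring

/-- The triples of primes counted by `weight₃'`. -/
noncomputable def goodTriples (ε A X : ℝ) : Finset (ℕ × ℕ × ℕ) :=
  (midPrimes ε X ×ˢ midPrimes ε X ×ˢ midPrimes ε X).filter fun q =>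
    q.2.2 < q.2.1 ∧ (cell A X q.1, cell A X q.2.1) ∈ cellPairs ε A X

lemma weight₃'_eq : weight₃' ε A X = ∑ q ∈ goodTriples ε A X, pt q.1 * pt q.2.1 * pt q.2.2 := by
  rw [weight₃', ← Finset.sum_fiberwise_of_maps_to (t := cellPairs ε A X)
    (g := fun q : ℕ × ℕ × ℕ => (cell A X q.1, cell A X q.2.1))
    (fun q hq => (mem_filter.1 hq).2.2)]
  refine Finset.sum_congr rfl fun i hi => ?_
  rw [midSum, midPairSum, Finset.sum_mul_sum, ← Finset.sum_product']
  refine Finset.sum_congr ?_ fun q _ => by rw [mul_assoc]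
  obtain ⟨i, j⟩ := i
  ext ⟨a, b, c⟩
  simp only [goodTriples, mem_filter, mem_product]
  constructor
  · rintro ⟨⟨h1, h2⟩, ⟨h3, h4⟩, h5, h6⟩
    subst h2 h6
    exact ⟨⟨⟨h1, h3, h4⟩, h5, hi⟩, rfl⟩
  · rintro ⟨⟨⟨h1, h3, h4⟩, h5, -⟩, h6⟩
    obtain ⟨rfl, rfl⟩ := Prod.mk.inj h6
    exact ⟨⟨h1, rfl⟩, ⟨h3, h4⟩, h5, rfl⟩

/-- The inequality is imposed at the right ends of the two cells, hence holds for all their members.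
-/
lemma cellPairs_spec (H : Regime ε A X) {q r : ℕ} (hq : 0 < q) (hr : 0 < r)
    (h : (cell A X q, cell A X r) ∈ cellPairs ε A X) :
    r < q ∧ (q : ℝ) * (r : ℝ) ^ 4 < X ^ (1 - 2 * ε) := by
  obtain ⟨-, h1, h2⟩ := mem_filter.1 h
  have hq0 : (0 : ℝ) < q := by exact_mod_cast hq
  have hr0 : (0 : ℝ) < r := by exact_mod_cast hr
  constructor
  · by_contra h3
    have h4 : (q : ℝ) ≤ r := by exact_mod_cast not_lt.1 h3
    exact absurd (H.cell_mono hq0 h4) (not_le.2 h1)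
  · refine lt_of_le_of_lt ?_ h2
    have h5 := H.le_of_cell hq0
    have h6 := H.le_of_cell hr0
    rw [← H.gridPt_succ] at h5 h6
    have := H.gridPt_pos (cell A X q + 1)
    gcongr

lemma goodTriples_subset (H : Regime ε A X) : goodTriples ε A X ⊆ primeTriples ε X := by
  rintro ⟨a, b, c⟩ h
  obtain ⟨h1, h2, h3⟩ := mem_filter.1 h
  simp only [mem_product] at h1
  have ha := (mem_primesIco.1 h1.1).1.pos
  have hb := (mem_primesIco.1 h1.2.1).1.pos
  exact mem_filter.2 ⟨by simpa [midPrimes] using h1, h2, cellPairs_spec H ha hb h3⟩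

/-- A lost triple either has `q₁` and `q₂` in one cell, which `window₁` excludes, or has `q₁ q₂⁴`
within a factor `(1 + δ)⁵` of the threshold. The latter puts `q₁` in a short window determined by
`q₂`, excluded by `window₂`. -/
lemma GoodAt.mk_weight₃ (G : GoodAt ε A X Y n) (H : Regime ε A X) :
    ([weight₃ ε X]_n) = [weight₃' ε A X]_n := by
  have hδ := H.delta_pos
  have hδ1 : 1 ≤ 1 + delta A X := by linarith
  rw [weight₃'_eq, weight₃, Ideal.Quotient.eq, ← Finset.sum_sdiff (goodTriples_subset H),
    add_sub_cancel_right]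
  refine Ideal.sum_mem _ ?_
  rintro ⟨a, b, c⟩ hq
  refine Ideal.mul_mem_right _ _ ?_
  obtain ⟨h1, h2⟩ := mem_sdiff.1 hq
  obtain ⟨h3, h4, h5, h6⟩ := mem_filter.1 h1
  simp only [mem_product] at h3
  change c < b at h4
  change b < a at h5
  change (a : ℝ) * (b : ℝ) ^ 4 < X ^ (1 - 2 * ε) at h6
  obtain ⟨pa, za, -⟩ := mem_primesIco.1 h3.1
  obtain ⟨pb, zb, -⟩ := mem_primesIco.1 h3.2.1
  change a.Prime at pa
  change b.Prime at pb
  change zLevel X ≤ a at za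
  change zLevel X ≤ b at zb
  rw [pt_mul_pt _ _ pa.ne_zero pb.ne_zero]
  refine pt_mem_vanishIdeal fun hd => h2 (mem_filter.2 ⟨?_, h4, mem_filter.2 ⟨?_, ?_, ?_⟩⟩)
  · simpa [midPrimes] using h3
  · have hn := Nat.pos_of_ne_zero G.ne_zero
    have ha : (a : ℝ) ≤ 2 * X := le_trans
      (by exact_mod_cast Nat.le_of_dvd hn ((Dvd.intro _ rfl).trans hd)) G.le
    have hb : (b : ℝ) ≤ 2 * X := le_trans
      (by exact_mod_cast Nat.le_of_dvd hn ((Dvd.intro_left _ rfl).trans hd)) G.le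
    exact mem_product.2 ⟨H.cell_mem_cells (by exact_mod_cast pa.one_le) ha,
      H.cell_mem_cells (by exact_mod_cast pb.one_le) hb⟩
  all_goals
    have ha0 : (0 : ℝ) < a := by exact_mod_cast pa.pos
    have hb0 : (0 : ℝ) < b := by exact_mod_cast pb.pos
    have hba : (b : ℝ) < a := by exact_mod_cast h5
    have hza : z₀Level X ≤ a := H.z₀_lt.le.trans za
    rw [mul_comm] at hd
    have e1 := H.lt_of_cell ha0
    have e2 := H.lt_of_cell hb0
    by_contra hcon
  · have hc : cell A X a = cell A X b := le_antisymm (not_lt.1 hcon) (H.cell_mono hb0 hba.le)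
    refine G.window₁ ⟨b, a, hd, hza, hba.le, ?_⟩
    have h7 := H.le_of_cell ha0
    rw [hc] at h7
    calc (a : ℝ) ≤ _ := h7
      _ ≤ b * (1 + delta A X) ^ 5 := by
          gcongr
          exact le_self_pow₀ hδ1 (by norm_num)
      _ = _ := mul_comm _ _
  · refine G.window₂ ⟨b, a, hd, hza, ?_, ?_⟩
    · change X ^ (1 - 2 * ε) / (b : ℝ) ^ 4 / (1 + delta A X) ^ 5 ≤ a
      rw [div_div, div_le_iff₀ (by positivity)]
      refine (not_lt.1 hcon).trans ?_
      simp only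
      rw [H.gridPt_succ, H.gridPt_succ]
      have := H.gridPt_pos (cell A X b)
      calc _ ≤ (a : ℝ) * (1 + delta A X) * (b * (1 + delta A X)) ^ 4 := by gcongr
        _ = _ := by ring
    · change (a : ℝ) ≤ (1 + delta A X) ^ 5 * (X ^ (1 - 2 * ε) / (b : ℝ) ^ 4 / (1 + delta A X) ^ 5)
      rw [mul_div_cancel₀ _ (by positivity), le_div_iff₀ (by positivity)]
      exact h6.le

/-- The function `w` for which `ρ⁻` is `w` convolved with the sifted part and `constOne`. -/
noncomputable def weightTotal (ε A X : ℝ) : AF :=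
  1 - weight₁ X + weight₂ ε X - weight₃' ε A X

lemma GoodAt.rhoMinus_eq (G : GoodAt ε A X Y n) (H : Regime ε A X) :
    rhoMinus ε X n =
      ((1 - weight₁ X + weight₂ ε X) * muCells A X (smallSets ε A X) * muSmooth ε X * constOne -
        weight₃' ε A X * muCells A X (smallSets ε A X) * muSmooth ε X * constOne +
        muCells A X (largeSets ε A X) * (weightTotal ε A X * muSmooth ε X * constOne)) n := by
  rw [HarmanMinorant.rhoMinus_eq ε X G.ne_zero]
  refine eq_of_mk_eq G.ne_zero ?_
  rw [map_mul, G.mk_rhoAF H, map_sub, G.mk_weight₃ H, ← map_sub, ← map_mul, weightTotal]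
  congr 1
  ring

end HarmanMinorant

/-! ### The three kinds of pieces, and finite sums of them. -/

namespace HarmanMinorant

open Finset

/-- `f` is of one of the three types. -/
def IsPiece (K : ℝ) (B : ℕ) (ε A X Y : ℝ) (f : ℕ → ℂ) : Prop :=
  IsTypeI K B ε A X Y f ∨ IsTypeI_II K B ε A X Y f ∨ IsTypeII K B ε A X Y f

lemma DivisorBounded.mul_const {K : ℝ} {B : ℕ} {α : ℕ → ℂ} (h : DivisorBounded K B α) {s : ℝ}
    (hs : |s| ≤ 1) : DivisorBounded K B fun m => s * α m := fun m hm => by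
  rw [norm_mul, Complex.norm_real, Real.norm_eq_abs]
  exact (mul_le_of_le_one_left (norm_nonneg _) hs).trans (h m hm)

/-- In type II the scalar must go into `β`, because `α` is prescribed exactly. -/
lemma IsPiece.mul_const {K : ℝ} {B : ℕ} {ε A X Y : ℝ} {f : ℕ → ℂ} (h : IsPiece K B ε A X Y f)
    {s : ℝ} (hs : |s| ≤ 1) : IsPiece K B ε A X Y fun n => s * f n := by
  rcases h with ⟨α, M₁, M₂, h, h1, h2, h3, h4, h5, h6⟩ |
    ⟨α, β, M₁, M₂, M₃, hα, hβ, h1, h2, h3, h4, h5, h6, h7, h8⟩ |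
    ⟨α, β, R, M₁, M₂, Q, hα, hβ, h1, h2, h3, h4, h5, h6, h7, h8, h9, h10, h11⟩
  · refine Or.inl ⟨_, M₁, M₂, h.mul_const hs, h1, h2, h3, h4, h5, fun n => ?_⟩
    beta_reduce
    rw [h6, sumTypeI, sumTypeI, Finset.mul_sum]
  · refine Or.inr (Or.inl ⟨α, _, M₁, M₂, M₃, hα, hβ.mul_const hs, h1, h2, h3, h4, h5, h6, h7,
      fun n => ?_⟩)
    beta_reduce
    rw [h8, sumTypeI_II, sumTypeI_II, Finset.mul_sum]
    exact Finset.sum_congr rfl fun _ _ => by ring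
  · refine Or.inr (Or.inr ⟨α, _, R, M₁, M₂, Q, hα, hβ.mul_const hs, h1, h2, h3, h4, h5, h6, h7,
      h8, h9, h10, fun n => ?_⟩)
    beta_reduce
    rw [h11, sumTypeII, sumTypeII, Finset.mul_sum]
    exact Finset.sum_congr rfl fun _ _ => by ring

/-- `g` is a sum of at most `N` functions with property `P`, repetitions allowed. -/
def Decomp (P : (ℕ → ℂ) → Prop) (N : ℕ) (g : ℕ → ℂ) : Prop :=
  ∃ s : Multiset (ℕ → ℂ), (∀ f ∈ s, P f) ∧ Multiset.card s ≤ N ∧ s.sum = g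

namespace Decomp

variable {P : (ℕ → ℂ) → Prop} {N N' : ℕ} {g g' : ℕ → ℂ}

lemma single (h : P g) : Decomp P 1 g := ⟨{g}, by simpa using h, by simp, by simp⟩

lemma add (h : Decomp P N g) (h' : Decomp P N' g') : Decomp P (N + N') (g + g') := by
  obtain ⟨s, h1, h2, h3⟩ := h
  obtain ⟨s', h1', h2', h3'⟩ := h'
  refine ⟨s + s', fun f hf => ?_, ?_, ?_⟩
  · rcases Multiset.mem_add.1 hf with h | h
    · exact h1 f h
    · exact h1' f h
  · rw [Multiset.card_add]; exact add_le_add h2 h2'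
  · rw [Multiset.sum_add, h3, h3']

lemma sum {ι : Type*} (t : Finset ι) (F : ι → ℕ → ℂ) (h : ∀ i ∈ t, Decomp P N (F i)) :
    Decomp P (t.card * N) (∑ i ∈ t, F i) := by
  classical
  induction t using Finset.induction_on with
  | empty => exact ⟨0, by simp, by simp, by simp⟩
  | insert a t ha ih =>
    rw [Finset.sum_insert ha, Finset.card_insert_of_notMem ha, add_mul, one_mul, add_comm _ N]
    exact (h a (by simp)).add (ih fun i hi => h i (by simp [hi]))

/-- Repetitions are removed by splitting each function into two multiples of itself. -/
lemma exists_finset (hP : ∀ f, P f → ∀ s : ℝ, |s| ≤ 1 → P fun n => s * f n)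
    (h : Decomp P N g) : ∃ F : Finset (ℕ → ℂ), F.card ≤ 2 * N ∧ (∀ f ∈ F, P f) ∧
      ∑ f ∈ F, f = g := by
  classical
  obtain ⟨s, h1, h2, rfl⟩ := h
  suffices ∃ F : Finset (ℕ → ℂ), F.card ≤ 2 * Multiset.card s ∧ (∀ f ∈ F, P f) ∧
      ∑ f ∈ F, f = s.sum by
    obtain ⟨F, hF, h⟩ := this
    exact ⟨F, by omega, h⟩
  clear h2
  induction s using Multiset.induction_on with
  | empty => exact ⟨∅, by simp⟩
  | cons f s ih =>
    obtain ⟨F, hF1, hF2, hF3⟩ := ih fun g hg => h1 g (Multiset.mem_cons_of_mem hg)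
    by_cases hf : f = 0
    · refine ⟨F, ?_, hF2, ?_⟩
      · rw [Multiset.card_cons]; omega
      · rw [Multiset.sum_cons, hf, zero_add, hF3]
    set φ : ℝ → ℕ → ℂ := fun t n => (t : ℂ) * f n with hφ
    have hinj : Function.Injective φ := by
      intro t t' h
      obtain ⟨n, hn⟩ := Function.ne_iff.1 hf
      have := congrFun h n
      simp only [hφ] at this
      exact_mod_cast mul_right_cancel₀ hn this
    -- Write `f = t f + (1 - t) f`. Only finitely many `t` put a summand into `F`, and `t < 1 / 2`
    -- keeps the two summands distinct.
    have hbad : ((φ ⁻¹' (F : Set (ℕ → ℂ))) ∪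
        ((fun t : ℝ => 1 - t) ⁻¹' (φ ⁻¹' (F : Set (ℕ → ℂ))))).Finite := by
      have h0 : (φ ⁻¹' (F : Set (ℕ → ℂ))).Finite := F.finite_toSet.preimage hinj.injOn
      exact h0.union (h0.preimage fun a _ b _ h => sub_right_injective h)
    obtain ⟨t, ht, htb⟩ := (Set.Ioo_infinite (show (0 : ℝ) < 1 / 2 by norm_num)).exists_notMem_finite
      hbad
    simp only [Set.mem_union, Set.mem_preimage, not_or, Finset.mem_coe] at htb
    obtain ⟨ht0, ht1⟩ := ht
    have hne : φ t ≠ φ (1 - t) := fun h => by have := hinj h; linarith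
    have hPf := hP f (h1 f (Multiset.mem_cons_self f s))
    have hn1 : φ t ∉ insert (φ (1 - t)) F := by
      rw [Finset.mem_insert, not_or]; exact ⟨hne, htb.1⟩
    refine ⟨insert (φ t) (insert (φ (1 - t)) F), ?_, ?_, ?_⟩
    · rw [Finset.card_insert_of_notMem hn1, Finset.card_insert_of_notMem htb.2,
        Multiset.card_cons]
      omega
    · intro g hg
      rcases Finset.mem_insert.1 hg with rfl | hg
      · exact hPf t (by rw [abs_of_pos ht0]; linarith)
      rcases Finset.mem_insert.1 hg with rfl | hg
      · exact hPf (1 - t) (by rw [abs_of_pos (by linarith)]; linarith)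
      · exact hF2 g hg
    · rw [Finset.sum_insert hn1, Finset.sum_insert htb.2, hF3, Multiset.sum_cons, ← add_assoc]
      congr 1
      funext n
      simp only [hφ, Pi.add_apply]
      push_cast
      ring

end Decomp

/-- The complex-valued function underlying an arithmetic function. -/
def toFun (f : AF) : ℕ → ℂ := fun n => (f n : ℂ)

lemma toFun_sum {ι : Type*} (s : Finset ι) (F : ι → AF) :
    toFun (∑ i ∈ s, F i) = ∑ i ∈ s, toFun (F i) := by
  funext n
  rw [toFun, sum_apply, Finset.sum_apply]
  push_cast
  rfl

/-- Six convolution factors `constOne` are the most that any coefficient needs; this fixes `K = 4`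
and `B = 5`. -/
lemma divisorBounded_of_dom {f : AF} {k : ℕ} (h : Dom f (4 * constOne ^ k)) (hk : k ≤ 6) :
    DivisorBounded 4 5 (toFun f) := by
  intro m hm
  rw [toFun, Complex.norm_real, Real.norm_eq_abs]
  refine (h m).trans ?_
  have e : (4 * constOne ^ k : AF) = constOne ^ k + constOne ^ k + constOne ^ k + constOne ^ k := by
    ring
  have h1 := (le_abs_self _).trans (dom_constOne_pow_le hk m)
  have h2 := constOne_pow_apply_le 5 m
  rw [e]
  simp only [ArithmeticFunction.add_apply]
  linarith

variable {ε A X Y : ℝ}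

/-- The cells that are admissible for a cofactor of a variable close to `b`. -/
noncomputable def offCells (A X Y b : ℝ) : Finset ℤ :=
  (cells A X).filter fun j => Y / 2 < b * gridPt A X j ∧
    (1 + delta A X) ^ ⌊Real.log X⌋₊ * (b * gridPt A X j) ≤ 4 * Y

lemma offCells_spec (H : Regime ε A X) {b : ℝ} (hb : 0 < b) {j : ℤ} (hj : j ∈ offCells A X Y b) :
    Y / 2 < b * gridPt A X j ∧ b * gridPt A X j ≤ 4 * Y := by
  obtain ⟨-, h1, h2⟩ := mem_filter.1 hj
  refine ⟨h1, le_trans (le_mul_of_one_le_left ?_ ?_) h2⟩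
  · exact (mul_pos hb (H.gridPt_pos j)).le
  · exact one_le_pow₀ (by linarith [H.delta_pos])

lemma res_cell_eq (H : Regime ε A X) (j : ℤ) (f : AF) (m : ℕ) :
    res (fun x : ℕ => cell A X x = j) f m =
      if gridPt A X j < m ∧ (m : ℝ) ≤ (1 + delta A X) * gridPt A X j then f m else 0 := by
  rcases Nat.eq_zero_or_pos m with rfl | hm
  · simp
  have := H.cell_eq_iff (x := m) (by exact_mod_cast hm) j
  rw [mul_comm] at this
  rw [res_apply]
  by_cases h : cell A X m = j
  · rw [if_pos h, if_pos (this.1 h)]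
  · rw [if_neg h, if_neg fun h' => h (this.2 h')]

lemma res_cell_support (H : Regime ε A X) {j : ℤ} {f : AF} {m : ℕ}
    (h : res (fun x : ℕ => cell A X x = j) f m ≠ 0) :
    gridPt A X j < m ∧ (m : ℝ) ≤ gridPt A X j * (1 + delta A X) ∧ f m ≠ 0 := by
  rw [res_cell_eq H] at h
  by_cases hc : gridPt A X j < m ∧ (m : ℝ) ≤ (1 + delta A X) * gridPt A X j
  · rw [if_pos hc] at h
    exact ⟨hc.1, by rw [mul_comm]; exact hc.2, h⟩
  · exact absurd (if_neg hc) h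

lemma dyadic_of_res_cell (H : Regime ε A X) {j : ℤ} {f : AF} {m : ℕ}
    (h : res (fun x : ℕ => cell A X x = j) f m ≠ 0) : Dyadic (gridPt A X j) m := by
  obtain ⟨h1, h2, -⟩ := res_cell_support H h
  refine ⟨h1, h2.trans ?_⟩
  have := H.gridPt_pos j
  nlinarith [H.delta_le]

lemma res_cell_constOne (H : Regime ε A X) (j : ℤ) {m : ℕ} (hm : m ≠ 0) :
    res (fun x : ℕ => cell A X x = j) constOne m =
      if gridPt A X j < m ∧ (m : ℝ) ≤ (1 + delta A X) * gridPt A X j then 1 else 0 := by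
  rw [res_cell_eq H, constOne_apply, if_neg hm]

/-- A cell of ratio `1 + δ` lies in a dyadic interval, so the condition `m₁ ∼ M₁` is automatic on
the support of the coefficient. -/
lemma isTypeI_of (H : Regime ε A X) {V : AF} {k : ℕ} (hV : Dom V (4 * constOne ^ k)) (hk : k ≤ 6)
    {i j : ℤ} (hi : gridPt A X i ≤ X ^ (1 / 2 + ε)) (hj : j ∈ offCells A X Y (gridPt A X i)) :
    IsTypeI 4 5 ε A X Y (toFun (res (fun x : ℕ => cell A X x = i) V *
      res (fun x : ℕ => cell A X x = j) constOne)) := by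
  classical
  obtain ⟨h1, h2⟩ := offCells_spec H (H.gridPt_pos i) hj
  refine ⟨toFun (res (fun x : ℕ => cell A X x = i) V), gridPt A X i, gridPt A X j,
    divisorBounded_of_dom (hV.res _) hk, H.gridPt_pos i, H.gridPt_pos j, hi, h1, h2, fun n => ?_⟩
  rw [sumTypeI, toFun, ArithmeticFunction.mul_apply, Finset.sum_filter]
  push_cast
  refine Finset.sum_congr rfl fun x hx => ?_
  have hx' := Nat.mem_divisorsAntidiagonal.1 hx
  have hx2 : x.2 ≠ 0 := by rintro h; rw [h, mul_zero] at hx'; exact hx'.2 hx'.1.symm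
  rw [res_cell_constOne H j hx2]
  by_cases h : res (fun x : ℕ => cell A X x = i) V x.1 = 0
  · simp [toFun, h]
  · have := dyadic_of_res_cell H h
    simp only [this, true_and, toFun]
    split_ifs <;> simp

lemma isTypeI_II_of (H : Regime ε A X) {V U : AF} {k l : ℕ} (hV : Dom V (4 * constOne ^ k))
    (hk : k ≤ 6) (hU : Dom U (4 * constOne ^ l)) (hl : l ≤ 6) {i₁ i₂ j : ℤ}
    (hi : gridPt A X i₁ ^ 2 * gridPt A X i₂ ≤ X ^ (1 - ε))
    (hi₂ : gridPt A X i₂ ≤ X ^ (1 / 4 - ε))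
    (hj : j ∈ offCells A X Y (gridPt A X i₁ * gridPt A X i₂)) :
    IsTypeI_II 4 5 ε A X Y (toFun (res (fun x : ℕ => cell A X x = i₁) V *
      res (fun x : ℕ => cell A X x = i₂) U * res (fun x : ℕ => cell A X x = j) constOne)) := by
  classical
  obtain ⟨h1, h2⟩ := offCells_spec H (mul_pos (H.gridPt_pos i₁) (H.gridPt_pos i₂)) hj
  refine ⟨toFun (res (fun x : ℕ => cell A X x = i₁) V), toFun (res (fun x : ℕ => cell A X x = i₂) U),
    gridPt A X i₁, gridPt A X i₂, gridPt A X j,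
    divisorBounded_of_dom (hV.res _) hk, divisorBounded_of_dom (hU.res _) hl, H.gridPt_pos i₁,
    H.gridPt_pos i₂, H.gridPt_pos j, hi, hi₂, h1, h2, fun n => ?_⟩
  rw [sumTypeI_II, toFun, mul_three_apply, Finset.sum_filter]
  push_cast
  refine Finset.sum_congr rfl fun t ht => ?_
  rw [res_cell_constOne H j (Nat.ne_zero_of_mem_finMulAntidiag ht 2)]
  by_cases h : res (fun x : ℕ => cell A X x = i₁) V (t 0) = 0
  · simp [toFun, h]
  by_cases h' : res (fun x : ℕ => cell A X x = i₂) U (t 1) = 0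
  · simp [toFun, h']
  · have := dyadic_of_res_cell H h
    have := dyadic_of_res_cell H h'
    simp only [*, true_and, toFun]
    split_ifs <;> simp

/-- A product over a set of cells counts products of primes from these cells. -/
lemma cellProd_eq_primeProductCoeff {T : Finset ℤ} {R : ℕ} (e : Fin R ≃ T) (m : ℕ) :
    toFun (cellProd A X T) m = primeProductCoeff (delta A X) R (fun j => gridPt A X (e j)) m := by
  classical
  have h1 : cellProd A X T = ∏ j : Fin R, cellSum A X (e j) := by
    rw [cellProd, ← Finset.prod_coe_sort T (fun i => cellSum A X i)]
    exact (Equiv.prod_comp e fun i : T => cellSum A X i).symm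
  rw [toFun, h1, prod_fin_apply, primeProductCoeff, Finset.sum_filter]
  push_cast
  refine Finset.sum_congr rfl fun q hq => ?_
  have h0 : ∀ i, q i ≠ 0 := fun i => Nat.ne_zero_of_mem_finMulAntidiag hq i
  rw [← Complex.ofReal_prod]
  have h2 : ∀ j, cellSum A X (e j) (q j) = if (q j).Prime ∧ gridPt A X (e j) < (q j : ℝ) ∧
      (q j : ℝ) ≤ gridPt A X (e j) * (1 + delta A X) then 1 else 0 := by
    intro j
    rw [cellSum, sum_pt_apply]
    refine if_congr ?_ rfl rfl
    rw [cellPrimes, mem_primesIoc]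
    exact and_iff_left (h0 j)
  simp only [h2, Finset.prod_ite_zero, Finset.prod_const_one, Finset.mem_univ, forall_true_left]
  split_ifs <;> simp

/-- The bound for `R` follows from `z₀ ^ R ≤ M₁ ≤ z`, and the range of `m₁` is automatic from the
support of `cellProd`. -/
lemma isTypeII_of (H : Regime ε A X) {U : AF} {T : Finset ℤ} {k l : ℕ} (hT : T ⊆ lowCells A X)
    (hne : T.Nonempty) (hlow : X ^ (ε / 2) ≤ cellVal A X T) (hup : cellVal A X T ≤ zLevel X)
    (hα : Dom (cellProd A X T) (4 * constOne ^ k)) (hk : k ≤ 6)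
    (hU : Dom U (4 * constOne ^ l)) (hl : l ≤ 6) {j : ℤ}
    (hj : j ∈ offCells A X Y (cellVal A X T)) :
    IsTypeII 4 5 ε A X Y (toFun (cellProd A X T * res (fun x : ℕ => cell A X x = j) U)) := by
  classical
  obtain ⟨h1, h2⟩ := offCells_spec H (H.cellVal_pos T) hj
  have e : Fin T.card ≃ T := T.equivFin.symm
  refine ⟨toFun (cellProd A X T), toFun (res (fun x : ℕ => cell A X x = j) U), T.card,
    cellVal A X T, gridPt A X j, fun i => gridPt A X (e i), divisorBounded_of_dom hα hk,
    divisorBounded_of_dom (hU.res _) hl, H.gridPt_pos j, hne.card_pos, ?_, hlow, hup, h1, h2,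
    fun i => ⟨H.z₀_le_gridPt (hT (e i).2), H.gridPt_lt_z (hT (e i).2)⟩, ?_,
    fun m => cellProd_eq_primeProductCoeff e m, fun n => ?_⟩
  · refine Nat.le_floor ?_
    rw [le_div_iff₀ (Real.log_pos (by linarith [H.two_le_z₀])), ← Real.log_pow]
    exact Real.log_le_log (pow_pos H.z₀_pos _) ((H.z₀_pow_card_le_cellVal hT).trans hup)
  · rw [cellVal, ← Finset.prod_coe_sort T (fun i => gridPt A X i)]
    exact Equiv.prod_comp e fun i : T => gridPt A X i
  · rw [sumTypeII, toFun, ArithmeticFunction.mul_apply, Finset.sum_filter]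
    push_cast
    refine Finset.sum_congr rfl fun x hx => ?_
    by_cases h : cellProd A X T x.1 = 0
    · simp [toFun, h]
    by_cases h' : res (fun x : ℕ => cell A X x = j) U x.2 = 0
    · simp [toFun, h']
    have h3 := dyadic_of_res_cell H h'
    obtain ⟨-, h4, h5⟩ := H.cellProd_support T h
    rw [if_pos ⟨h4 hne, by rw [mul_comm]; exact h5, h3⟩, toFun, toFun]

end HarmanMinorant

/-! ### Localising the cofactor, and pointwise majorants. -/

namespace HarmanMinorant

open Finset

lemma Decomp.mono {P : (ℕ → ℂ) → Prop} {N N' : ℕ} {g : ℕ → ℂ} (h : Decomp P N g) (hN : N ≤ N') :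
    Decomp P N' g := by
  obtain ⟨s, h1, h2, h3⟩ := h
  exact ⟨s, h1, h2.trans hN, h3⟩

variable {ε A X Y : ℝ} {n : ℕ}

/-! ### Restricting the cofactor to admissible cells -/

/-- At most `⌊log X⌋` factors `1 + δ` ever accumulate; their total distortion `1 + O(δ log X)` is
also the relative width of the excluded strips near `Y / 2` and `4 Y`. -/
lemma Regime.ratio_pow_le (H : Regime ε A X) :
    (1 + delta A X) ^ ⌊Real.log X⌋₊ ≤ 1 + 2 * (delta A X * Real.log X) := by
  have hδ := H.delta_pos
  have hL := H.log_pos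
  have h1 := H.delta_mul_log_le
  have h0 : 0 < delta A X * Real.log X := mul_pos hδ hL
  have h2 : (1 + delta A X) ^ ⌊Real.log X⌋₊ ≤ Real.exp (delta A X * Real.log X) := by
    calc (1 + delta A X) ^ ⌊Real.log X⌋₊ ≤ Real.exp (delta A X) ^ ⌊Real.log X⌋₊ := by
          gcongr
          linarith [Real.add_one_le_exp (delta A X)]
      _ = Real.exp (⌊Real.log X⌋₊ * delta A X) := by rw [← Real.exp_nat_mul]
      _ ≤ _ := by
          apply Real.exp_le_exp.2
          rw [mul_comm]
          exact mul_le_mul_of_nonneg_left (Nat.floor_le hL.le) hδ.le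
  have h3 := Real.add_one_le_exp (-(delta A X * Real.log X))
  have h4 : Real.exp (delta A X * Real.log X) * Real.exp (-(delta A X * Real.log X)) = 1 := by
    rw [← Real.exp_add]; simp
  have h5 := Real.exp_pos (delta A X * Real.log X)
  refine h2.trans ?_
  nlinarith

lemma Regime.ratio_pow_le_two (H : Regime ε A X) {k : ℕ} (hk : k ≤ ⌊Real.log X⌋₊) :
    (1 + delta A X) ^ k ≤ 2 := by
  have h1 : (1 + delta A X) ^ k ≤ (1 + delta A X) ^ ⌊Real.log X⌋₊ :=
    pow_le_pow_right₀ (by linarith [H.delta_pos]) hk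
  linarith [H.ratio_pow_le, H.delta_mul_log_le]

/-- `offCells` leaves room for `⌊log X⌋` factors `1 + δ` below `4 Y`: `k` for the variable of `f`
and one for the cofactor. Since `GoodAt` is not needed, the pieces vanish off `(Y/2, 4Y]`
unconditionally. -/
lemma mul_res_offCells_eq_zero (H : Regime ε A X) {f g : AF} {b : ℝ} (hb : 0 < b) {k : ℕ}
    (hk : k + 1 ≤ ⌊Real.log X⌋₊)
    (hf : ∀ a, f a ≠ 0 → b < a ∧ (a : ℝ) ≤ b * (1 + delta A X) ^ k)
    (hn : ¬ (Y / 2 < n ∧ (n : ℝ) ≤ 4 * Y)) :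
    (f * res (fun x : ℕ => cell A X x ∈ offCells A X Y b) g) n = 0 := by
  by_contra h
  obtain ⟨a, c, rfl, ha, hc⟩ := exists_of_mul_ne_zero h
  have hc0 : (0 : ℝ) < c := by exact_mod_cast Nat.pos_of_ne_zero (ne_zero_of_apply_ne_zero hc)
  rw [res_apply] at hc
  by_cases hcell : cell A X c ∈ offCells A X Y b
  · obtain ⟨-, h1, h2⟩ := mem_filter.1 hcell
    obtain ⟨h3, h4⟩ := hf a ha
    have hg := H.gridPt_pos (cell A X c)
    have hδ := H.delta_pos
    apply hn
    push_cast
    constructor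
    · refine h1.trans (mul_lt_mul h3 (H.lt_of_cell hc0).le hg (Nat.cast_nonneg a))
    · calc (a : ℝ) * c ≤ b * (1 + delta A X) ^ k * (gridPt A X (cell A X c) * (1 + delta A X)) :=
            mul_le_mul h4 (H.le_of_cell hc0) hc0.le ((Nat.cast_nonneg a).trans h4)
        _ = (1 + delta A X) ^ (k + 1) * (b * gridPt A X (cell A X c)) := by ring
        _ ≤ (1 + delta A X) ^ ⌊Real.log X⌋₊ * (b * gridPt A X (cell A X c)) := by
            gcongr
            linarith
        _ ≤ _ := h2
  · rw [if_neg hcell] at hc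
    exact hc rfl

lemma GoodAt.le_of_dvd (G : GoodAt ε A X Y n) {d : ℕ} (hd : d ∣ n) : (d : ℝ) ≤ 2 * X :=
  le_trans (by exact_mod_cast Nat.le_of_dvd (Nat.pos_of_ne_zero G.ne_zero) hd) G.le

lemma GoodAt.cell_mem_cells (G : GoodAt ε A X Y n) (H : Regime ε A X) {d : ℕ} (hd : d ∣ n) :
    cell A X d ∈ cells A X :=
  H.cell_mem_cells (by exact_mod_cast Nat.pos_of_dvd_of_pos hd (Nat.pos_of_ne_zero G.ne_zero))
    (G.le_of_dvd hd)

/-- Conversely, the distance of a good `n` from both ends of the interval forces the cofactor into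
an admissible cell, so nothing is lost at `n`. -/
lemma GoodAt.mul_res_offCells (G : GoodAt ε A X Y n) (H : Regime ε A X) {f g : AF} {b : ℝ}
    (hb : 0 < b) {k : ℕ} (hk : k + 1 ≤ ⌊Real.log X⌋₊)
    (hf : ∀ a, f a ≠ 0 → b < a ∧ (a : ℝ) ≤ b * (1 + delta A X) ^ k) :
    (f * res (fun x : ℕ => cell A X x ∈ offCells A X Y b) g) n = (f * g) n := by
  refine mul_res_apply_eq ?_
  rintro a c hac hn0 ha hc
  have hc0 : (0 : ℝ) < c := by exact_mod_cast Nat.pos_of_ne_zero (ne_zero_of_apply_ne_zero hc)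
  have hg := H.gridPt_pos (cell A X c)
  have hδ := H.delta_pos
  have hr : 0 < (1 + delta A X) ^ ⌊Real.log X⌋₊ := by positivity
  obtain ⟨h3, h4⟩ := hf a ha
  have hnac : (n : ℝ) = a * c := by rw [← hac]; push_cast; ring
  refine mem_filter.2 ⟨G.cell_mem_cells H (Dvd.intro_left _ hac), ?_, ?_⟩
  · have h5 : (n : ℝ) ≤ (1 + delta A X) ^ ⌊Real.log X⌋₊ * (b * gridPt A X (cell A X c)) := by
      calc (n : ℝ) = a * c := hnac
        _ ≤ b * (1 + delta A X) ^ k * (gridPt A X (cell A X c) * (1 + delta A X)) :=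
            mul_le_mul h4 (H.le_of_cell hc0) hc0.le ((Nat.cast_nonneg a).trans h4)
        _ = (1 + delta A X) ^ (k + 1) * (b * gridPt A X (cell A X c)) := by ring
        _ ≤ _ := by
            gcongr
            linarith
    exact lt_of_mul_lt_mul_left (G.lower.trans_le h5) hr.le
  · refine le_trans ?_ G.upper
    refine mul_le_mul_of_nonneg_left ?_ hr.le
    rw [hnac]
    exact mul_le_mul h3.le (H.lt_of_cell hc0).le hg.le (Nat.cast_nonneg a)

lemma decomp_mul_res_offCells {P : (ℕ → ℂ) → Prop} {f g : AF} {b : ℝ}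
    (h : ∀ j ∈ offCells A X Y b, P (toFun (f * res (fun x : ℕ => cell A X x = j) g))) :
    Decomp P (cells A X).card
      (toFun (f * res (fun x : ℕ => cell A X x ∈ offCells A X Y b) g)) := by
  rw [← sum_res_eq (fun x : ℕ => cell A X x), Finset.mul_sum, toFun_sum]
  refine (Decomp.sum (N := 1) _ _ fun j hj => Decomp.single (h j hj)).mono ?_
  rw [mul_one]
  exact Finset.card_le_card (Finset.filter_subset _ _)

/-! ### Majorants -/

/-- A majorant of the weights. -/
noncomputable def weightBar (X : ℝ) : AF := 1 + weight₁ X + weight₁ X ^ 2 + weight₁ X ^ 3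

noncomputable def smoothBar (X : ℝ) : AF := ∏ p ∈ primesIoc 0 (z₀Level X), (1 + pt p)

noncomputable def cellsBar (A X : ℝ) (s : Finset (Finset ℤ)) : AF := ∑ S ∈ s, cellProd A X S

lemma dom_weight₁ : Dom (weight₁ X) (weight₁ X) := dom_sum_pt

lemma dom_weight₁_pow (k : ℕ) : Dom (weight₁ X ^ k) (weight₁ X ^ k) := by
  have := Dom.prod (s := range k) (F := fun _ => weight₁ X) (G := fun _ => weight₁ X)
    fun _ _ => dom_weight₁
  simpa using this

lemma midPrimes_subset (H : Regime ε A X) :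
    midPrimes ε X ⊆ primesIco (zLevel X) (2 * X ^ (1 / 2 : ℝ)) := by
  intro p hp
  obtain ⟨h1, h2, h3⟩ := mem_primesIco.1 hp
  refine mem_primesIco.2 ⟨h1, h2, h3.trans_le ?_⟩
  have h4 : X ^ (1 / 4 - 2 * ε) ≤ X ^ (1 / 2 : ℝ) :=
    Real.rpow_le_rpow_of_exponent_le H.one_lt_X.le (by linarith [H.eps_pos])
  have h5 : 0 < X ^ (1 / 2 : ℝ) := Real.rpow_pos_of_pos H.X_pos _
  linarith

lemma dom_weight₂ (H : Regime ε A X) : Dom (weight₂ ε X) (weight₁ X ^ 2) := by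
  rw [sq, weight₁, Finset.sum_mul_sum, ← Finset.sum_product']
  exact dom_sum_subset ((Finset.filter_subset _ _).trans
    (Finset.product_subset_product (midPrimes_subset H) (midPrimes_subset H)))
    fun q _ => (dom_pt _).mul (dom_pt _)

lemma dom_sum_triples (H : Regime ε A X) {s : Finset (ℕ × ℕ × ℕ)}
    (hs : s ⊆ midPrimes ε X ×ˢ midPrimes ε X ×ˢ midPrimes ε X) :
    Dom (∑ q ∈ s, pt q.1 * pt q.2.1 * pt q.2.2) (weight₁ X ^ 3) := by
  have e : weight₁ X ^ 3 = ∑ q ∈ primesIco (zLevel X) (2 * X ^ (1 / 2 : ℝ)) ×ˢ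
      primesIco (zLevel X) (2 * X ^ (1 / 2 : ℝ)) ×ˢ primesIco (zLevel X) (2 * X ^ (1 / 2 : ℝ)),
      pt q.1 * pt q.2.1 * pt q.2.2 := by
    rw [Finset.sum_product, pow_three, weight₁]
    simp only [Finset.sum_product, mul_assoc, ← Finset.mul_sum, ← Finset.sum_mul]
  rw [e]
  have := midPrimes_subset H
  exact dom_sum_subset (hs.trans (Finset.product_subset_product this
    (Finset.product_subset_product this this)))
    fun q _ => ((dom_pt _).mul (dom_pt _)).mul (dom_pt _)

lemma dom_weight₃ (H : Regime ε A X) : Dom (weight₃ ε X) (weight₁ X ^ 3) :=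
  dom_sum_triples H (Finset.filter_subset _ _)

lemma dom_weight₃' (H : Regime ε A X) : Dom (weight₃' ε A X) (weight₁ X ^ 3) := by
  rw [weight₃'_eq]; exact dom_sum_triples H (Finset.filter_subset _ _)

lemma dom_weight₁₂ (H : Regime ε A X) :
    Dom (1 - weight₁ X + weight₂ ε X) (weightBar X) :=
  ((Dom.one.sub dom_weight₁).add (dom_weight₂ H)).add_right (dom_weight₁_pow 3)

lemma dom_weightTotal (H : Regime ε A X) : Dom (weightTotal ε A X) (weightBar X) :=
  ((Dom.one.sub dom_weight₁).add (dom_weight₂ H)).sub (dom_weight₃' H)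

lemma dom_pow_weightBar : Dom (weight₁ X ^ 3) (weightBar X) := by
  have h := (dom_weight₁_pow (X := X) 3).add_right
    ((Dom.one.add (dom_weight₁ (X := X))).add (dom_weight₁_pow (X := X) 2))
  rw [add_comm] at h
  exact h

lemma dom_cellSum (i : ℤ) : Dom (cellSum A X i) (cellSum A X i) := dom_sum_pt

lemma dom_cellProd (S : Finset ℤ) : Dom (cellProd A X S) (cellProd A X S) :=
  Dom.prod fun i _ => dom_cellSum i

lemma dom_muCells (s : Finset (Finset ℤ)) : Dom (muCells A X s) (cellsBar A X s) :=
  Dom.sum fun S _ => (dom_cellProd S).neg_one_pow_mul _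

lemma dom_one_add_sum_pt (C : Finset ℕ) :
    Dom (1 + ∑ p ∈ C, pt p) (∏ p ∈ C, (1 + pt p)) := by
  classical
  induction C using Finset.induction_on with
  | empty => simpa using Dom.one
  | insert p C hp ih =>
    rw [Finset.sum_insert hp, Finset.prod_insert hp]
    have h1 : Dom (1 + (pt p + ∑ q ∈ C, pt q)) ((1 + pt p) * (1 + ∑ q ∈ C, pt q)) := by
      have e : (1 + pt p) * (1 + ∑ q ∈ C, pt q) =
          (1 + (pt p + ∑ q ∈ C, pt q)) + pt p * ∑ q ∈ C, pt q := by ring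
      rw [e]
      exact (Dom.one.add ((dom_pt p).add dom_sum_pt)).add_right ((dom_pt p).mul dom_sum_pt)
    exact h1.trans ((Dom.one.add (dom_pt p)).mul ih)

/-- Since `1 + ∑ pt p` is dominated by `∏ (1 + pt p)` in each cell, and the cells and the primes up
to `z₀` are disjoint, everything sits under one product over distinct primes. The bound does not
grow with the number of sets of cells. -/
lemma dom_cellsBar_mul_smoothBar (H : Regime ε A X) {s : Finset (Finset ℤ)}
    (hs : s ⊆ (lowCells A X).powerset) : Dom (cellsBar A X s * smoothBar X) constOne := by
  classical
  have h1 : Dom (cellsBar A X s) (∏ i ∈ lowCells A X, (1 + cellSum A X i)) := by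
    rw [Finset.prod_one_add]
    exact dom_sum_subset hs fun S _ => dom_cellProd S
  have h2 : Dom (∏ i ∈ lowCells A X, (1 + cellSum A X i))
      (∏ p ∈ (lowCells A X).biUnion (cellPrimes A X), (1 + pt p)) := by
    rw [Finset.prod_biUnion]
    · exact Dom.prod fun i _ => dom_one_add_sum_pt _
    · intro i _ j _ hij
      rw [Function.onFun, Finset.disjoint_left]
      intro p hp hq
      exact hij ((H.mem_cellPrimes.1 hp).2.symm.trans (H.mem_cellPrimes.1 hq).2)
  have h3 : Dom (smoothBar X) (smoothBar X) := Dom.prod fun p _ => Dom.one.add (dom_pt p)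
  refine ((h1.trans h2).mul h3).trans ?_
  rw [smoothBar, ← Finset.prod_union]
  · refine dom_prod_one_add_pt _ fun p hp => ?_
    rcases Finset.mem_union.1 hp with hp | hp
    · obtain ⟨i, -, hp⟩ := Finset.mem_biUnion.1 hp
      exact Regime.prime_of_mem_cellPrimes hp
    · exact (mem_primesIoc.1 hp).1
  · rw [Finset.disjoint_left]
    intro p hp hq
    obtain ⟨i, hi, hp⟩ := Finset.mem_biUnion.1 hp
    exact absurd (mem_primesIoc.1 hq).2.2 (not_le.2 (H.z₀_lt_of_mem_cellPrimes hi hp))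

lemma dom_muSmooth : Dom (muSmooth ε X) (smoothBar X) := by
  rw [smoothBar, prod_one_add_pt_eq _ fun p hp => (mem_primesIoc.1 hp).1, muSmooth]
  exact (Dom.sum fun T _ => (dom_pt _).neg_one_pow_mul _).trans
    (dom_sum_subset (Finset.filter_subset _ _) fun T _ => dom_pt _)

lemma dom_smoothBar_constOne : Dom (smoothBar X) constOne :=
  dom_prod_one_add_pt _ fun _ hp => (mem_primesIoc.1 hp).1

lemma dom_cellProd_constOne (H : Regime ε A X) {S : Finset ℤ} (hS : S ⊆ lowCells A X) :
    Dom (cellProd A X S) constOne := by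
  have h1 : Dom (cellProd A X S) (cellsBar A X {S} * smoothBar X) := by
    rw [cellsBar, Finset.sum_singleton]
    have h : Dom 1 (smoothBar X) := by
      have := Dom.prod (s := primesIoc 0 (z₀Level X)) (F := fun _ => (1 : AF))
        (G := fun p => 1 + pt p) fun p _ => Dom.one.add_right (dom_pt p)
      simpa [smoothBar] using this
    simpa using (dom_cellProd (A := A) (X := X) S).mul h
  exact h1.trans (dom_cellsBar_mul_smoothBar H (by simpa using hS))

lemma dom_weightBar : Dom (weightBar X) (4 * constOne ^ 3) := by
  have e : (4 * constOne ^ 3 : AF) = constOne ^ 3 + constOne ^ 3 + constOne ^ 3 + constOne ^ 3 := by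
    ring
  have h : ∀ k, k ≤ 3 → Dom (weight₁ X ^ k) (constOne ^ 3) := by
    intro k hk
    have := Dom.prod (s := range k) (F := fun _ => weight₁ X) (G := fun _ => constOne)
      fun _ _ => dom_sum_pt_constOne _
    rw [Finset.prod_const, Finset.prod_const, card_range] at this
    exact this.trans (dom_constOne_pow_le hk)
  have h0 := h 0 (by norm_num)
  have h1 := h 1 (by norm_num)
  rw [pow_zero] at h0
  rw [pow_one] at h1
  rw [e]
  exact ((h0.add h1).add (h 2 (by norm_num))).add (h 3 le_rfl)

/-- The common majorant of all parts of the decomposition. -/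
noncomputable def majorant (X : ℝ) : AF := weightBar X * (constOne * constOne)

lemma dom_constOne_mul_self : Dom constOne (constOne * constOne) := by
  have := dom_constOne_pow_le (k := 1) (l := 2) (by norm_num)
  rwa [pow_one, sq] at this

lemma abs_rhoMinus_le (H : Regime ε A X) (hn : n ≠ 0) : |rhoMinus ε X n| ≤ majorant X n := by
  rw [rhoMinus_eq ε X hn]
  exact ((((Dom.one.sub dom_weight₁).add (dom_weight₂ H)).sub (dom_weight₃ H)).mul
    ((dom_rhoAF _).trans dom_constOne_mul_self)) n

/-- An integer up to `2 X` has at most five prime factors above `z`. -/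
lemma card_bigPrimes_dvd_le (H : Regime ε A X) {m : ℕ} (hm : m ≠ 0) (hmX : (m : ℝ) ≤ 2 * X)
    (b : ℝ) : ((primesIco (zLevel X) b).filter fun p => p ∣ m).card ≤ 5 := by
  set s := (primesIco (zLevel X) b).filter fun p => p ∣ m with hs
  have h1 : ∏ p ∈ s, p ∣ m := by
    refine Finset.prod_primes_dvd m (fun p hp => ?_) fun p hp => (mem_filter.1 hp).2
    exact (mem_primesIco.1 (mem_filter.1 hp).1).1.prime
  have h2 : zLevel X ^ s.card ≤ ((∏ p ∈ s, p : ℕ) : ℝ) := by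
    rw [← Finset.prod_const]
    push_cast
    exact Finset.prod_le_prod (fun _ _ => H.z_pos.le)
      fun p hp => (mem_primesIco.1 (mem_filter.1 hp).1).2.1
  have h3 : ((∏ p ∈ s, p : ℕ) : ℝ) ≤ m := by
    exact_mod_cast Nat.le_of_dvd (Nat.pos_of_ne_zero hm) h1
  by_contra h
  have h4 : zLevel X ^ 6 ≤ zLevel X ^ s.card :=
    pow_le_pow_right₀ (by linarith [H.z₀_lt, H.two_le_z₀]) (by omega)
  linarith [H.z_pow_gt]

/-- Each convolution with `weight₁` sums over the primes at least `z` that divide `m`, of which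
there are at most five. Hence these weights cost constants, not divisor functions. -/
lemma weight₁_pow_mul_apply_le (H : Regime ε A X) (hn : n ≠ 0) (hnX : (n : ℝ) ≤ 2 * X) (k : ℕ) :
    ∀ m, m ∣ n → (weight₁ X ^ k * (constOne * constOne)) m ≤ 5 ^ k * (n.divisors.card : ℝ) := by
  induction k with
  | zero =>
    intro m hm
    have h1 := constOne_pow_apply_le 1 m
    have h2 := Finset.card_le_card (Nat.divisors_subset_of_dvd hn hm)
    rw [pow_one] at h1
    rw [pow_zero, pow_zero, one_mul, one_mul, ← sq]
    exact h1.trans (by exact_mod_cast h2)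
  | succ k ih =>
    intro m hm
    have hm0 : m ≠ 0 := fun h => hn (Nat.eq_zero_of_zero_dvd (h ▸ hm))
    rw [pow_succ', mul_assoc, weight₁, Finset.sum_mul, sum_apply]
    have hmX : (m : ℝ) ≤ 2 * X :=
      le_trans (by exact_mod_cast Nat.le_of_dvd (Nat.pos_of_ne_zero hn) hm) hnX
    set c : ℝ := 5 ^ k * (n.divisors.card : ℝ) with hc
    have hc0 : 0 ≤ c := by positivity
    calc ∑ q ∈ primesIco (zLevel X) (2 * X ^ (1 / 2 : ℝ)),
          (pt q * ((∑ q ∈ primesIco (zLevel X) (2 * X ^ (1 / 2 : ℝ)), pt q) ^ k *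
            (constOne * constOne))) m
        ≤ ∑ q ∈ primesIco (zLevel X) (2 * X ^ (1 / 2 : ℝ)), if q ∣ m then c else 0 := by
          refine Finset.sum_le_sum fun q hq => ?_
          rw [pt_mul_apply (mem_primesIco.1 hq).1.ne_zero _ hm0]
          split_ifs with hd
          · exact ih _ ((Nat.div_dvd_of_dvd hd).trans hm)
          · exact le_rfl
      _ = ((primesIco (zLevel X) (2 * X ^ (1 / 2 : ℝ))).filter fun p => p ∣ m).card * c := by
          rw [← Finset.sum_filter, Finset.sum_const, nsmul_eq_mul]
      _ ≤ 5 * c := by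
          have h : (((primesIco (zLevel X) (2 * X ^ (1 / 2 : ℝ))).filter
              fun p => p ∣ m).card : ℝ) ≤ 5 := by
            exact_mod_cast card_bigPrimes_dvd_le H hm0 hmX _
          gcongr
      _ = _ := by rw [hc, pow_succ]; ring

/-- The constant is `1 + 5 + 25 + 125`. -/
lemma majorant_apply_le (H : Regime ε A X) (hn : n ≠ 0) (hnX : (n : ℝ) ≤ 2 * X) :
    majorant X n ≤ 156 * (n.divisors.card : ℝ) := by
  have h := fun k => weight₁_pow_mul_apply_le H hn hnX k n dvd_rfl
  have h0 := h 0
  have h1 := h 1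
  have h2 := h 2
  have h3 := h 3
  rw [majorant, weightBar, add_mul, add_mul, add_mul]
  simp only [ArithmeticFunction.add_apply]
  rw [pow_zero] at h0
  rw [pow_one] at h1
  linarith

end HarmanMinorant

/-! ### Construction of the type I, type I/II and type II parts. -/

namespace HarmanMinorant

open Finset

variable {ε A X Y : ℝ} {n : ℕ}

/-- The Möbius factor occupies only `X ^ (3 ε / 4)`; the remaining `X ^ (ε / 4)` absorbs numerical
constants. -/
lemma Regime.mul_rpow_le (H : Regime ε A X) {c : ℝ} (hc : c ≤ 4) (a : ℝ) :
    c * (X ^ a * (X ^ (ε / 2) * X ^ (ε / 4))) ≤ X ^ (a + ε) := by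
  have hX := H.X_pos
  have e : X ^ (a + ε) = X ^ (ε / 4) * (X ^ a * (X ^ (ε / 2) * X ^ (ε / 4))) := by
    rw [← Real.rpow_add hX, ← Real.rpow_add hX, ← Real.rpow_add hX]
    congr 1; ring
  rw [e]
  exact mul_le_mul_of_nonneg_right (hc.trans H.four_le) (by positivity)

lemma Regime.two_le_log (H : Regime ε A X) : 2 + 1 ≤ ⌊Real.log X⌋₊ := by
  have := H.maxFactors_le
  omega

lemma Regime.card_succ_le (H : Regime ε A X) {S : Finset ℤ} (hS : S ⊆ lowCells A X)
    (hv : cellVal A X S ≤ 2 * X) : S.card + 1 ≤ ⌊Real.log X⌋₊ := by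
  have := H.card_le S.card ((H.z₀_pow_card_le_cellVal hS).trans hv)
  have := H.maxFactors_le
  omega

lemma Regime.rpow_le_self (H : Regime ε A X) {a : ℝ} (ha : a ≤ 1) : X ^ a ≤ X := by
  nth_rewrite 2 [← Real.rpow_one X]
  exact Real.rpow_le_rpow_of_exponent_le H.one_lt_X.le ha

/-- The Möbius factor that belongs to the terms of type I. -/
noncomputable def smallMu (ε A X : ℝ) : AF := muCells A X (smallSets ε A X) * muSmooth ε X

lemma exists_of_neg_one_pow_mul_ne_zero {f : AF} {k m : ℕ} (h : ((-1 : AF) ^ k * f) m ≠ 0) :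
    f m ≠ 0 := by
  rcases neg_one_pow_eq_or AF k with hk | hk <;> rw [hk] at h
  · simpa using h
  · simpa using h

/-- The two powers come from the cells and from the smooth part; the factor `2` bounds `(1 + δ) ^
|S|`. -/
lemma smallMu_support (H : Regime ε A X) {m : ℕ} (hm : smallMu ε A X m ≠ 0) :
    (m : ℝ) ≤ 2 * (X ^ (ε / 2) * X ^ (ε / 4)) := by
  obtain ⟨a, b, rfl, ha, hb⟩ := exists_of_mul_ne_zero hm
  obtain ⟨S, hS, ha⟩ := exists_of_sum_ne_zero ha
  obtain ⟨T, hT, hb⟩ := exists_of_sum_ne_zero hb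
  have ha' := exists_of_neg_one_pow_mul_ne_zero ha
  obtain rfl := eq_of_pt_ne_zero (exists_of_neg_one_pow_mul_ne_zero hb)
  obtain ⟨hS1, hS2⟩ := mem_filter.1 hS
  have hS1' := mem_powerset.1 hS1
  have h1 := (H.cellProd_support S ha').2.2
  have h2 := (mem_filter.1 hT).2
  have h3 : X ^ (ε / 2) ≤ X := H.rpow_le_self (by linarith [H.eps_le])
  have h4 := H.card_succ_le hS1' (by linarith [H.X_pos])
  have h5 := H.ratio_pow_le_two (k := S.card) (by omega)
  have h6 := H.cellVal_pos S
  have hδ := H.delta_pos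
  have hX := H.X_pos
  rw [Nat.cast_mul]
  calc (a : ℝ) * ((∏ p ∈ T, p : ℕ) : ℝ) ≤ (X ^ (ε / 2) * 2) * X ^ (ε / 4) := by
        refine mul_le_mul (h1.trans ?_) h2 (Nat.cast_nonneg _) (by positivity)
        gcongr
    _ = _ := by ring

lemma dom_smallMu (H : Regime ε A X) :
    Dom (smallMu ε A X) constOne :=
  ((dom_muCells _).mul dom_muSmooth).trans
    (dom_cellsBar_mul_smoothBar H (Finset.filter_subset _ _))

lemma weight₁₂_support (H : Regime ε A X) {m : ℕ} (hm : (1 - weight₁ X + weight₂ ε X) m ≠ 0) :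
    (m : ℝ) ≤ 2 * X ^ (1 / 2 : ℝ) := by
  have hX := H.X_pos
  have h1 : 1 ≤ X ^ (1 / 2 : ℝ) := Real.one_le_rpow H.one_lt_X.le (by norm_num)
  by_contra hcon
  apply hm
  rw [ArithmeticFunction.add_apply, sub_apply, ArithmeticFunction.one_apply_ne, zero_sub]
  · have h2 : weight₁ X m = 0 := by
      by_contra h
      obtain ⟨q, hq, h⟩ := exists_of_sum_ne_zero h
      obtain rfl := eq_of_pt_ne_zero h
      exact hcon (mem_primesIco.1 hq).2.2.le
    have h3 : weight₂ ε X m = 0 := by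
      by_contra h
      obtain ⟨q, hq, h⟩ := exists_of_sum_ne_zero h
      obtain ⟨a, b, rfl, ha, hb⟩ := exists_of_mul_ne_zero h
      obtain rfl := eq_of_pt_ne_zero ha
      obtain rfl := eq_of_pt_ne_zero hb
      obtain ⟨h4, h5⟩ := mem_product.1 (mem_filter.1 hq).1
      apply hcon
      have h6 := (mem_primesIco.1 h4).2.2.le
      have h7 := (mem_primesIco.1 h5).2.2.le
      push_cast
      calc (q.1 : ℝ) * q.2 ≤ X ^ (1 / 4 - 2 * ε) * X ^ (1 / 4 - 2 * ε) :=
            mul_le_mul h6 h7 (Nat.cast_nonneg _) (by positivity)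
        _ = X ^ (1 / 4 - 2 * ε + (1 / 4 - 2 * ε)) := by rw [Real.rpow_add hX]
        _ ≤ X ^ (1 / 2 : ℝ) :=
            Real.rpow_le_rpow_of_exponent_le H.one_lt_X.le (by linarith [H.eps_pos])
        _ ≤ _ := by linarith
    rw [h2, h3]; simp
  · rintro rfl
    apply hcon
    push_cast
    linarith

/-! ### Type I -/

noncomputable def coeffI (ε A X : ℝ) : AF := (1 - weight₁ X + weight₂ ε X) * smallMu ε A X

noncomputable def cellsI (ε A X : ℝ) : Finset ℤ :=
  (cells A X).filter fun i => gridPt A X i ≤ X ^ (1 / 2 + ε)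

noncomputable def partI (ε A X Y : ℝ) : AF :=
  ∑ i ∈ cellsI ε A X, res (fun x : ℕ => cell A X x = i) (coeffI ε A X) *
    res (fun x : ℕ => cell A X x ∈ offCells A X Y (gridPt A X i)) constOne

lemma coeffI_support (H : Regime ε A X) {m : ℕ} (hm : coeffI ε A X m ≠ 0) :
    (m : ℝ) ≤ X ^ (1 / 2 + ε) := by
  obtain ⟨a, b, rfl, ha, hb⟩ := exists_of_mul_ne_zero hm
  have h1 := weight₁₂_support H ha
  have h2 := smallMu_support H hb
  have hX := H.X_pos
  push_cast
  calc (a : ℝ) * b ≤ 2 * X ^ (1 / 2 : ℝ) * (2 * (X ^ (ε / 2) * X ^ (ε / 4))) :=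
        mul_le_mul h1 h2 (Nat.cast_nonneg _) (by positivity)
    _ = 4 * (X ^ (1 / 2 : ℝ) * (X ^ (ε / 2) * X ^ (ε / 4))) := by ring
    _ ≤ _ := H.mul_rpow_le le_rfl _

lemma dom_coeffI (H : Regime ε A X) : Dom (coeffI ε A X) (weightBar X * constOne) :=
  (dom_weight₁₂ H).mul (dom_smallMu H)

lemma res_cell_support_pow (H : Regime ε A X) {j : ℤ} {f : AF} {a : ℕ}
    (h : res (fun x : ℕ => cell A X x = j) f a ≠ 0) :
    gridPt A X j < a ∧ (a : ℝ) ≤ gridPt A X j * (1 + delta A X) ^ 1 := by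
  obtain ⟨h1, h2, -⟩ := res_cell_support H h
  exact ⟨h1, by rwa [pow_one]⟩

lemma partI_eq_zero (H : Regime ε A X) (hn : ¬ (Y / 2 < n ∧ (n : ℝ) ≤ 4 * Y)) :
    partI ε A X Y n = 0 := by
  rw [partI, sum_apply]
  refine Finset.sum_eq_zero fun i _ => ?_
  exact mul_res_offCells_eq_zero H (H.gridPt_pos i) (k := 1) (by have := H.two_le_log; omega)
    (fun a ha => res_cell_support_pow H ha) hn

/-- On divisors of `n`, the cells in `cellsI` cover the support of `coeffI`: a member's left grid
point is below it, hence below `X ^ (1 / 2 + ε)`. -/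
lemma partI_eq (H : Regime ε A X) (G : GoodAt ε A X Y n) :
    partI ε A X Y n = (coeffI ε A X * constOne) n := by
  have h1 : partI ε A X Y n =
      (∑ i ∈ cellsI ε A X, res (fun x : ℕ => cell A X x = i) (coeffI ε A X) * constOne) n := by
    rw [partI, sum_apply, sum_apply]
    refine Finset.sum_congr rfl fun i _ => ?_
    exact G.mul_res_offCells H (H.gridPt_pos i) (k := 1) (by have := H.two_le_log; omega)
      (fun a ha => res_cell_support_pow H ha)
  rw [h1, ← Finset.sum_mul, sum_res_eq (fun x : ℕ => cell A X x), mul_comm, mul_comm (coeffI ε A X)]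
  refine mul_res_apply_eq fun a b hab _ _ hb => ?_
  have hb0 : (0 : ℝ) < b := by exact_mod_cast Nat.pos_of_ne_zero (ne_zero_of_apply_ne_zero hb)
  exact mem_filter.2 ⟨G.cell_mem_cells H (Dvd.intro_left _ hab),
    (H.lt_of_cell hb0).le.trans (coeffI_support H hb)⟩

/-- The restrictions of the coefficient are to disjoint cells, so their majorants add up to the
unrestricted one. -/
lemma dom_partI (H : Regime ε A X) : Dom (partI ε A X Y) (majorant X) := by
  have h := dom_coeffI H
  have h1 : Dom (partI ε A X Y) (∑ i ∈ cellsI ε A X,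
      res (fun x : ℕ => cell A X x = i) (weightBar X * constOne) * constOne) := by
    refine Dom.sum fun i _ => Dom.mul (fun m => ?_) (dom_constOne.res _)
    rw [res_apply, res_apply]
    split_ifs
    · exact h m
    · simp
  refine h1.trans ?_
  rw [← Finset.sum_mul, majorant, ← mul_assoc]
  exact (dom_sum_res (fun x : ℕ => cell A X x) _ h.self_right).mul dom_constOne

lemma decomp_partI (H : Regime ε A X) : Decomp (IsPiece 4 5 ε A X Y)
    ((cells A X).card * (cells A X).card) (toFun (partI ε A X Y)) := by
  have hD : Dom (coeffI ε A X) (4 * constOne ^ 4) := by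
    refine (dom_coeffI H).trans ?_
    have := dom_weightBar (X := X).mul dom_constOne
    rwa [mul_assoc, ← pow_succ] at this
  rw [partI, toFun_sum]
  refine (Decomp.sum (N := (cells A X).card) _ _ fun i hi => ?_).mono
    (Nat.mul_le_mul_right _ (Finset.card_le_card (Finset.filter_subset _ _)))
  exact decomp_mul_res_offCells fun j hj =>
    Or.inl (isTypeI_of H hD (by norm_num) (mem_filter.1 hi).2 hj)

/-! ### Type I/II -/

noncomputable def mixedCells (ε A X : ℝ) : Finset (ℤ × ℤ) :=
  (cells A X ×ˢ cells A X).filter fun j =>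
    gridPt A X j.1 ^ 2 * gridPt A X j.2 ≤ X ^ (1 - ε) ∧ gridPt A X j.2 ≤ X ^ (1 / 4 - ε)

noncomputable def mixedCoeff (ε A X : ℝ) (i : ℤ) : AF := -(midSum ε A X i * smallMu ε A X)

/-- The first variable is `q₂ q₃`; the second is `q₁` times the Möbius divisor and carries the sign.
-/
noncomputable def partI_II (ε A X Y : ℝ) : AF :=
  ∑ i ∈ cellPairs ε A X, ∑ j ∈ mixedCells ε A X,
    res (fun x : ℕ => cell A X x = j.1) (midPairSum ε A X i.2) *
      res (fun x : ℕ => cell A X x = j.2) (mixedCoeff ε A X i.1) *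
      res (fun x : ℕ => cell A X x ∈ offCells A X Y (gridPt A X j.1 * gridPt A X j.2)) constOne

lemma sum_res_mul_res_apply {κ : Type*} [DecidableEq κ] (idx : ℕ → κ) (F : Finset (κ × κ)) (f g : AF) (d : ℕ) :
    (∑ j ∈ F, res (fun x => idx x = j.1) f * res (fun x => idx x = j.2) g) d =
      ∑ x ∈ d.divisorsAntidiagonal, if (idx x.1, idx x.2) ∈ F then f x.1 * g x.2 else 0 := by
  rw [sum_apply]
  simp only [ArithmeticFunction.mul_apply]
  rw [Finset.sum_comm]
  refine Finset.sum_congr rfl fun x _ => ?_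
  have h : ∀ j : κ × κ, res (fun x => idx x = j.1) f x.1 * res (fun x => idx x = j.2) g x.2 =
      if (idx x.1, idx x.2) = j then f x.1 * g x.2 else 0 := by
    rintro ⟨a, b⟩
    simp only [res_apply, Prod.mk.injEq, ite_and]
    split_ifs <;> simp
  simp only [h]
  rw [Finset.sum_ite_eq]

lemma dom_sum_res_mul_res {κ : Type*} [DecidableEq κ] (idx : ℕ → κ) (F : Finset (κ × κ)) {f g f' g' : AF}
    (hf : Dom f f') (hg : Dom g g') :
    Dom (∑ j ∈ F, res (fun x => idx x = j.1) f' * res (fun x => idx x = j.2) g') (f' * g') := by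
  intro d
  rw [sum_res_mul_res_apply, ArithmeticFunction.mul_apply]
  refine (Finset.abs_sum_le_sum_abs _ _).trans (Finset.sum_le_sum fun x _ => ?_)
  have h0 : 0 ≤ f' x.1 * g' x.2 := mul_nonneg (hf.nonneg _) (hg.nonneg _)
  split_ifs
  · rw [abs_of_nonneg h0]
  · simpa using h0

lemma res_mul_res_support (H : Regime ε A X) {i j : ℤ} {f g : AF} {a : ℕ}
    (h : (res (fun x : ℕ => cell A X x = i) f * res (fun x : ℕ => cell A X x = j) g) a ≠ 0) :
    gridPt A X i * gridPt A X j < a ∧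
      (a : ℝ) ≤ gridPt A X i * gridPt A X j * (1 + delta A X) ^ 2 := by
  obtain ⟨b, c, rfl, hb, hc⟩ := exists_of_mul_ne_zero h
  obtain ⟨h1, h2, -⟩ := res_cell_support H hb
  obtain ⟨h3, h4, -⟩ := res_cell_support H hc
  have hi := H.gridPt_pos i
  have hj := H.gridPt_pos j
  push_cast
  refine ⟨mul_lt_mul'' h1 h3 hi.le hj.le, ?_⟩
  calc (b : ℝ) * c ≤ gridPt A X i * (1 + delta A X) * (gridPt A X j * (1 + delta A X)) :=
        mul_le_mul h2 h4 (Nat.cast_nonneg _) ((Nat.cast_nonneg _).trans h2)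
    _ = _ := by ring

lemma partI_II_eq_zero (H : Regime ε A X) (hn : ¬ (Y / 2 < n ∧ (n : ℝ) ≤ 4 * Y)) :
    partI_II ε A X Y n = 0 := by
  rw [partI_II, sum_apply]
  refine Finset.sum_eq_zero fun i _ => ?_
  rw [sum_apply]
  refine Finset.sum_eq_zero fun j _ => ?_
  exact mul_res_offCells_eq_zero H (mul_pos (H.gridPt_pos _) (H.gridPt_pos _)) (k := 2)
    H.two_le_log (fun a ha => res_mul_res_support H ha) hn

/-- From `q₃ < q₂` one gets `(q₂ q₃)² q₁ ≤ q₁ q₂⁴ < X ^ (1 - 2 ε)`, and the Möbius divisor costs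
less than `X ^ ε`. The bound for the second variable comes likewise from `q₁ < X ^ (1 / 4 - 2 ε)`.
-/
lemma mem_mixedCells (H : Regime ε A X) {i : ℤ × ℤ} (hi : i ∈ cellPairs ε A X) {a b : ℕ}
    (ha : midPairSum ε A X i.2 a ≠ 0) (hb : mixedCoeff ε A X i.1 b ≠ 0)
    (hca : cell A X a ∈ cells A X) (hcb : cell A X b ∈ cells A X) :
    (cell A X a, cell A X b) ∈ mixedCells ε A X := by
  have hX := H.X_pos
  have ha0 : (0 : ℝ) < a := by exact_mod_cast Nat.pos_of_ne_zero (ne_zero_of_apply_ne_zero ha)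
  have hb0 : (0 : ℝ) < b := by exact_mod_cast Nat.pos_of_ne_zero (ne_zero_of_apply_ne_zero hb)
  obtain ⟨⟨q, r⟩, hq, ha⟩ := exists_of_sum_ne_zero ha
  obtain ⟨q', r', rfl, hq', hr'⟩ := exists_of_mul_ne_zero ha
  obtain rfl := eq_of_pt_ne_zero hq'
  obtain rfl := eq_of_pt_ne_zero hr'
  obtain ⟨hqr, hlt, hcq⟩ := mem_filter.1 hq
  change r' < q' at hlt
  change cell A X q' = i.2 at hcq
  rw [mixedCoeff, ArithmeticFunction.neg_apply] at hb
  obtain ⟨p, c, rfl, hp, hc⟩ := exists_of_mul_ne_zero (neg_ne_zero.1 hb)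
  obtain ⟨p', hp', hp⟩ := exists_of_sum_ne_zero hp
  obtain rfl := eq_of_pt_ne_zero hp
  obtain ⟨hp', hcp⟩ := mem_filter.1 hp'
  have hc' := smallMu_support H hc
  have hpp := mem_primesIco.1 hp'
  have hqq := mem_primesIco.1 (mem_product.1 hqr).1
  have hi' : (cell A X p, cell A X q') ∈ cellPairs ε A X := by rw [hcp, hcq]; exact hi
  have hpq := (cellPairs_spec H hpp.1.pos hqq.1.pos hi').2
  have hlt' : (r' : ℝ) < q' := by exact_mod_cast hlt
  have g1 := (H.lt_of_cell ha0).le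
  have g2 := (H.lt_of_cell hb0).le
  have g3 := H.gridPt_pos (cell A X ((q' * r' : ℕ) : ℝ))
  have g4 := H.gridPt_pos (cell A X ((p * c : ℕ) : ℝ))
  refine mem_filter.2 ⟨mem_product.2 ⟨hca, hcb⟩, ?_, ?_⟩
  · change gridPt A X (cell A X ((q' * r' : ℕ) : ℝ)) ^ 2 *
      gridPt A X (cell A X ((p * c : ℕ) : ℝ)) ≤ X ^ (1 - ε)
    calc _ ≤ ((q' * r' : ℕ) : ℝ) ^ 2 * ((p * c : ℕ) : ℝ) := by gcongr
      _ = ((q' : ℝ) * r') ^ 2 * (p * c) := by push_cast; ring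
      _ ≤ ((q' : ℝ) * q') ^ 2 * (p * (2 * (X ^ (ε / 2) * X ^ (ε / 4)))) := by gcongr
      _ = 2 * ((p * (q' : ℝ) ^ 4) * (X ^ (ε / 2) * X ^ (ε / 4))) := by ring
      _ ≤ 2 * (X ^ (1 - 2 * ε) * (X ^ (ε / 2) * X ^ (ε / 4))) := by gcongr
      _ ≤ X ^ (1 - 2 * ε + ε) := H.mul_rpow_le (by norm_num) _
      _ = _ := by congr 1; ring
  · change gridPt A X (cell A X ((p * c : ℕ) : ℝ)) ≤ X ^ (1 / 4 - ε)
    calc _ ≤ ((p * c : ℕ) : ℝ) := g2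
      _ = (p : ℝ) * c := by push_cast; ring
      _ ≤ X ^ (1 / 4 - 2 * ε) * (2 * (X ^ (ε / 2) * X ^ (ε / 4))) :=
          mul_le_mul hpp.2.2.le hc' (Nat.cast_nonneg _) (by positivity)
      _ = 2 * (X ^ (1 / 4 - 2 * ε) * (X ^ (ε / 2) * X ^ (ε / 4))) := by ring
      _ ≤ X ^ (1 / 4 - 2 * ε + ε) := H.mul_rpow_le (by norm_num) _
      _ = _ := by congr 1; ring

lemma partI_II_eq (H : Regime ε A X) (G : GoodAt ε A X Y n) :
    partI_II ε A X Y n = (-(weight₃' ε A X * smallMu ε A X) * constOne) n := by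
  have h1 : partI_II ε A X Y n = ∑ i ∈ cellPairs ε A X,
      ((midPairSum ε A X i.2 * mixedCoeff ε A X i.1) * constOne) n := by
    rw [partI_II, sum_apply]
    refine Finset.sum_congr rfl fun i hi => ?_
    have h2 : (∑ j ∈ mixedCells ε A X,
        res (fun x : ℕ => cell A X x = j.1) (midPairSum ε A X i.2) *
          res (fun x : ℕ => cell A X x = j.2) (mixedCoeff ε A X i.1) *
          res (fun x : ℕ => cell A X x ∈ offCells A X Y (gridPt A X j.1 * gridPt A X j.2))
            constOne) n =
        (∑ j ∈ mixedCells ε A X,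
          res (fun x : ℕ => cell A X x = j.1) (midPairSum ε A X i.2) *
            res (fun x : ℕ => cell A X x = j.2) (mixedCoeff ε A X i.1) * constOne) n := by
      rw [sum_apply, sum_apply]
      refine Finset.sum_congr rfl fun j _ => ?_
      exact G.mul_res_offCells H (mul_pos (H.gridPt_pos _) (H.gridPt_pos _)) (k := 2)
        H.two_le_log (fun a ha => res_mul_res_support H ha)
    rw [h2, ← Finset.sum_mul, mul_constOne_apply, mul_constOne_apply]
    refine Finset.sum_congr rfl fun d hd => ?_
    have hdn := (Nat.mem_divisors.1 hd).1
    rw [sum_res_mul_res_apply (fun x : ℕ => cell A X x), ArithmeticFunction.mul_apply]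
    refine Finset.sum_congr rfl fun x hx => ?_
    have hx' := (Nat.mem_divisorsAntidiagonal.1 hx).1
    by_cases ha : midPairSum ε A X i.2 x.1 = 0
    · simp [ha]
    by_cases hb : mixedCoeff ε A X i.1 x.2 = 0
    · simp [hb]
    exact if_pos (mem_mixedCells H hi ha hb
      (G.cell_mem_cells H ((Dvd.intro _ hx').trans hdn))
      (G.cell_mem_cells H ((Dvd.intro_left _ hx').trans hdn)))
  rw [h1, ← sum_apply, ← Finset.sum_mul]
  congr 2
  rw [weight₃', Finset.sum_mul, ← Finset.sum_neg_distrib]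
  refine Finset.sum_congr rfl fun i _ => ?_
  rw [mixedCoeff]
  ring

lemma dom_midSum (i : ℤ) : Dom (midSum ε A X i) (midSum ε A X i) := dom_sum_pt

lemma dom_midPairSum (i : ℤ) : Dom (midPairSum ε A X i) (midPairSum ε A X i) :=
  Dom.sum fun _ _ => (dom_pt _).mul (dom_pt _)

lemma dom_mixedCoeff (H : Regime ε A X) (i : ℤ) :
    Dom (mixedCoeff ε A X i) (midSum ε A X i * constOne) :=
  ((dom_midSum i).mul (dom_smallMu H)).neg

lemma dom_partI_II (H : Regime ε A X) : Dom (partI_II ε A X Y) (majorant X) := by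
  have h1 : Dom (partI_II ε A X Y) (∑ i ∈ cellPairs ε A X, ∑ j ∈ mixedCells ε A X,
      res (fun x : ℕ => cell A X x = j.1) (midPairSum ε A X i.2) *
        res (fun x : ℕ => cell A X x = j.2) (midSum ε A X i.1 * constOne) * constOne) := by
    refine Dom.sum fun i _ => Dom.sum fun j _ => Dom.mul (Dom.mul (fun m => ?_) (fun m => ?_))
      (dom_constOne.res _)
    · rw [res_apply]
      split_ifs
      · exact dom_midPairSum _ m
      · simp
    · rw [res_apply, res_apply]
      split_ifs
      · exact dom_mixedCoeff H _ m
      · simp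
  have h2 : Dom (∑ i ∈ cellPairs ε A X, ∑ j ∈ mixedCells ε A X,
      res (fun x : ℕ => cell A X x = j.1) (midPairSum ε A X i.2) *
        res (fun x : ℕ => cell A X x = j.2) (midSum ε A X i.1 * constOne) * constOne)
      (∑ i ∈ cellPairs ε A X, midPairSum ε A X i.2 * (midSum ε A X i.1 * constOne) * constOne) := by
    refine Dom.sum fun i _ => ?_
    rw [← Finset.sum_mul]
    exact (dom_sum_res_mul_res (fun x : ℕ => cell A X x) _ (dom_midPairSum _)
      (dom_mixedCoeff H _)).mul dom_constOne
  have h3 : ∑ i ∈ cellPairs ε A X, midPairSum ε A X i.2 * (midSum ε A X i.1 * constOne) * constOne =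
      weight₃' ε A X * (constOne * constOne) := by
    rw [weight₃', Finset.sum_mul]
    exact Finset.sum_congr rfl fun i _ => by ring
  refine (h1.trans h2).trans ?_
  rw [h3]
  exact ((dom_weight₃' H).trans dom_pow_weightBar).mul (dom_constOne.mul dom_constOne)

lemma dom_four_mul {f : AF} {k : ℕ} (h : Dom f (constOne ^ k)) : Dom f (4 * constOne ^ k) := by
  have e : (4 * constOne ^ k : AF) = constOne ^ k + constOne ^ k + constOne ^ k + constOne ^ k := by
    ring
  have h0 := dom_constOne_pow k
  rw [e]
  exact ((h.add_right h0).add_right h0).add_right h0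

lemma decomp_partI_II (H : Regime ε A X) : Decomp (IsPiece 4 5 ε A X Y)
    ((cells A X).card ^ 5) (toFun (partI_II ε A X Y)) := by
  have hV : ∀ i, Dom (midPairSum ε A X i) (4 * constOne ^ 2) := by
    refine fun i => dom_four_mul ?_
    refine Dom.trans (h := constOne ^ 2) (g := (∑ q ∈ midPrimes ε X, pt q) ^ 2) ?_ ?_
    · rw [sq, Finset.sum_mul_sum, ← Finset.sum_product']
      exact dom_sum_subset (Finset.filter_subset _ _) fun q _ => (dom_pt _).mul (dom_pt _)
    · rw [sq, sq]
      exact (dom_sum_pt_constOne _).mul (dom_sum_pt_constOne _)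
  have hU : ∀ i, Dom (mixedCoeff ε A X i) (4 * constOne ^ 2) := by
    refine fun i => dom_four_mul ((dom_mixedCoeff H i).trans ?_)
    rw [sq]
    exact (dom_sum_pt_constOne _).mul dom_constOne
  have hc : (cellPairs ε A X).card ≤ (cells A X).card ^ 2 := by
    refine (Finset.card_le_card (Finset.filter_subset _ _)).trans ?_
    rw [Finset.card_product, sq]
  have hm : (mixedCells ε A X).card ≤ (cells A X).card ^ 2 := by
    refine (Finset.card_le_card (Finset.filter_subset _ _)).trans ?_
    rw [Finset.card_product, sq]
  rw [partI_II, toFun_sum]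
  refine (Decomp.sum (N := (mixedCells ε A X).card * (cells A X).card) _ _ fun i hi => ?_).mono ?_
  · rw [toFun_sum]
    refine Decomp.sum _ _ fun j hj => decomp_mul_res_offCells fun k hk => ?_
    obtain ⟨-, h1, h2⟩ := mem_filter.1 hj
    exact Or.inr (Or.inl (isTypeI_II_of H (hV _) (by norm_num) (hU _) (by norm_num) h1 h2 hk))
  · calc _ ≤ (cells A X).card ^ 2 * ((cells A X).card ^ 2 * (cells A X).card) := by gcongr
      _ = _ := by ring

/-! ### Type II -/

/-- Some subset of a large set has a value in the range of the type II variable. -/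
lemma exists_subset_cellVal (H : Regime ε A X) {S : Finset ℤ} (hS : S ∈ largeSets ε A X) :
    ∃ T ⊆ S, T.Nonempty ∧ X ^ (ε / 2) ≤ cellVal A X T ∧ cellVal A X T ≤ zLevel X := by
  classical
  obtain ⟨hS1, hS2, -⟩ := mem_filter.1 hS
  have hS1' := mem_powerset.1 hS1
  have hX := H.X_pos
  have hone : 1 < X ^ (ε / 2) := Real.one_lt_rpow H.one_lt_X (by linarith [H.eps_pos])
  -- Minimal cardinality suffices: no proper subset of `T` then reaches the threshold.
  obtain ⟨T, hT, hmin⟩ := Finset.exists_min_image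
    (S.powerset.filter fun T => X ^ (ε / 2) ≤ cellVal A X T) Finset.card
    ⟨S, mem_filter.2 ⟨mem_powerset_self S, hS2⟩⟩
  obtain ⟨hTS, hT2⟩ := mem_filter.1 hT
  have hTS' := mem_powerset.1 hTS
  have hne : T.Nonempty := by
    rw [Finset.nonempty_iff_ne_empty]
    rintro rfl
    rw [cellVal, Finset.prod_empty] at hT2
    linarith
  refine ⟨T, hTS', hne, hT2, ?_⟩
  obtain ⟨i, hi⟩ := hne
  -- If one cell alone reaches the threshold, `T` is a single cell, which lies below `z`. Otherwise
  -- `T` is a cell and a remainder, both below `X ^ (ε / 2)`, and `X ^ ε ≤ z`.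
  by_cases hg : X ^ (ε / 2) ≤ gridPt A X i
  · have h1 := hmin {i} (mem_filter.2 ⟨mem_powerset.2 (by simpa using hTS' hi),
      by simpa [cellVal] using hg⟩)
    rw [Finset.card_singleton] at h1
    have h2 : T = {i} := by
      symm
      exact Finset.eq_of_subset_of_card_le (by simpa using hi) (by simpa using h1)
    rw [h2, cellVal, Finset.prod_singleton]
    exact (H.gridPt_lt_z (hS1' (hTS' hi))).le
  · have h1 : cellVal A X (T.erase i) < X ^ (ε / 2) := by
      by_contra h
      have := hmin (T.erase i) (mem_filter.2 ⟨mem_powerset.2 ((Finset.erase_subset _ _).trans hTS'),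
        not_lt.1 h⟩)
      rw [Finset.card_erase_of_mem hi] at this
      have := Finset.card_pos.2 ⟨i, hi⟩
      omega
    have h2 : cellVal A X T = gridPt A X i * cellVal A X (T.erase i) :=
      (Finset.mul_prod_erase T _ hi).symm
    have h3 := H.cellVal_pos (T.erase i)
    rw [h2]
    calc _ ≤ X ^ (ε / 2) * X ^ (ε / 2) := by
          have := (not_le.1 hg).le
          gcongr
      _ = X ^ ε := by rw [← Real.rpow_add hX]; congr 1; ring
      _ ≤ _ := Real.rpow_le_rpow_of_exponent_le H.one_lt_X.le (by linarith [H.eps_le])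

open Classical in
/-- The cells of the type II variable. -/
noncomputable def selected (ε A X : ℝ) (S : Finset ℤ) : Finset ℤ :=
  if h : ∃ T ⊆ S, T.Nonempty ∧ X ^ (ε / 2) ≤ cellVal A X T ∧ cellVal A X T ≤ zLevel X
    then h.choose else ∅

lemma selected_spec (H : Regime ε A X) {S : Finset ℤ} (hS : S ∈ largeSets ε A X) :
    selected ε A X S ⊆ S ∧ (selected ε A X S).Nonempty ∧
      X ^ (ε / 2) ≤ cellVal A X (selected ε A X S) ∧
      cellVal A X (selected ε A X S) ≤ zLevel X := by
  have h := exists_subset_cellVal H hS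
  rw [selected, dif_pos h]
  exact h.choose_spec

lemma largeSets_subset {S : Finset ℤ} (hS : S ∈ largeSets ε A X) : S ⊆ lowCells A X :=
  mem_powerset.1 (mem_filter.1 hS).1

/-- Everything outside the selected cells goes here, including the sign and all three weights, since
`β` is arbitrary. -/
noncomputable def cofactorII (ε A X : ℝ) (S : Finset ℤ) : AF :=
  (-1) ^ S.card * (cellProd A X (S \ selected ε A X S) *
    (weightTotal ε A X * muSmooth ε X * constOne))

noncomputable def partII (ε A X Y : ℝ) : AF :=
  ∑ S ∈ largeSets ε A X, cellProd A X (selected ε A X S) *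
    res (fun x : ℕ => cell A X x ∈ offCells A X Y (cellVal A X (selected ε A X S)))
      (cofactorII ε A X S)

lemma cellProd_selected_support (H : Regime ε A X) {S : Finset ℤ} (hS : S ∈ largeSets ε A X)
    {a : ℕ} (ha : cellProd A X (selected ε A X S) a ≠ 0) :
    cellVal A X (selected ε A X S) < a ∧ (a : ℝ) ≤
      cellVal A X (selected ε A X S) * (1 + delta A X) ^ (selected ε A X S).card := by
  obtain ⟨-, h1, h2⟩ := H.cellProd_support _ ha
  exact ⟨h1 (selected_spec H hS).2.1, h2⟩

lemma card_selected (H : Regime ε A X) {S : Finset ℤ} (hS : S ∈ largeSets ε A X) :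
    (selected ε A X S).card + 1 ≤ ⌊Real.log X⌋₊ := by
  obtain ⟨h1, -, -, h4⟩ := selected_spec H hS
  refine H.card_succ_le (h1.trans (largeSets_subset hS)) (h4.trans ?_)
  have : zLevel X ≤ X := H.rpow_le_self (by norm_num)
  linarith [H.X_pos]

lemma partII_eq_zero (H : Regime ε A X) (hn : ¬ (Y / 2 < n ∧ (n : ℝ) ≤ 4 * Y)) :
    partII ε A X Y n = 0 := by
  rw [partII, sum_apply]
  refine Finset.sum_eq_zero fun S hS => ?_
  exact mul_res_offCells_eq_zero H (H.cellVal_pos _) (card_selected H hS)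
    (fun a ha => cellProd_selected_support H hS ha) hn

lemma cellProd_mul_sdiff {T S : Finset ℤ} (h : T ⊆ S) :
    cellProd A X T * cellProd A X (S \ T) = cellProd A X S := by
  rw [mul_comm]
  exact Finset.prod_sdiff h

lemma partII_eq (H : Regime ε A X) (G : GoodAt ε A X Y n) : partII ε A X Y n =
    (muCells A X (largeSets ε A X) * (weightTotal ε A X * muSmooth ε X * constOne)) n := by
  rw [partII, muCells, Finset.sum_mul, sum_apply, sum_apply]
  refine Finset.sum_congr rfl fun S hS => ?_
  rw [G.mul_res_offCells H (H.cellVal_pos _) (card_selected H hS)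
    (fun a ha => cellProd_selected_support H hS ha), cofactorII,
    ← cellProd_mul_sdiff (selected_spec H hS).1]
  congr 1
  ring

/-- Selected and remaining cells recombine to `cellProd S`, so the choice of subset leaves no trace
in the majorant. -/
lemma dom_partII (H : Regime ε A X) : Dom (partII ε A X Y) (majorant X) := by
  have h1 : Dom (partII ε A X Y) (∑ S ∈ largeSets ε A X, cellProd A X (selected ε A X S) *
      (cellProd A X (S \ selected ε A X S) * (weightBar X * smoothBar X * constOne))) := by
    refine Dom.sum fun S _ => (dom_cellProd _).mul (Dom.res _ (Dom.neg_one_pow_mul _ ?_))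
    exact (dom_cellProd _).mul (((dom_weightTotal H).mul dom_muSmooth).mul dom_constOne)
  have h2 : ∑ S ∈ largeSets ε A X, cellProd A X (selected ε A X S) *
      (cellProd A X (S \ selected ε A X S) * (weightBar X * smoothBar X * constOne)) =
      weightBar X * (cellsBar A X (largeSets ε A X) * smoothBar X * constOne) := by
    have : ∀ S ∈ largeSets ε A X, cellProd A X (selected ε A X S) *
        (cellProd A X (S \ selected ε A X S) * (weightBar X * smoothBar X * constOne)) =
        cellProd A X S * (weightBar X * smoothBar X * constOne) := fun S hS => by
      rw [← mul_assoc, cellProd_mul_sdiff (selected_spec H hS).1]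
    rw [Finset.sum_congr rfl this, ← Finset.sum_mul, cellsBar]
    ring
  refine h1.trans ?_
  rw [h2]
  exact (dom_weightTotal H).self_right.mul
    ((dom_cellsBar_mul_smoothBar H (Finset.filter_subset _ _)).mul dom_constOne)

/-- A large set has at most `maxFactors` cells because `z₀ ^ |S| ≤ 2 X`. The maximum with `1` makes
the powers monotone in the exponent. -/
lemma card_largeSets_le (H : Regime ε A X) :
    (largeSets ε A X).card ≤ (maxFactors X + 1) * max 1 (cells A X).card ^ maxFactors X := by
  classical
  have hsub : largeSets ε A X ⊆
      (range (maxFactors X + 1)).biUnion fun k => (lowCells A X).powersetCard k := by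
    intro S hS
    refine mem_biUnion.2 ⟨S.card, mem_range.2 (Nat.lt_succ_of_le ?_),
      mem_powersetCard.2 ⟨largeSets_subset hS, rfl⟩⟩
    exact H.card_le _ ((H.z₀_pow_card_le_cellVal (largeSets_subset hS)).trans
      (mem_filter.1 hS).2.2)
  refine (Finset.card_le_card hsub).trans (Finset.card_biUnion_le.trans ?_)
  calc ∑ k ∈ range (maxFactors X + 1), ((lowCells A X).powersetCard k).card
      ≤ ∑ k ∈ range (maxFactors X + 1), max 1 (cells A X).card ^ maxFactors X := by
        refine Finset.sum_le_sum fun k hk => ?_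
        rw [Finset.card_powersetCard]
        have h1 := Nat.choose_le_pow (lowCells A X).card k
        have h2 : (lowCells A X).card ≤ max 1 (cells A X).card :=
          (Finset.card_le_card H.lowCells_subset).trans (le_max_right _ _)
        calc _ ≤ (lowCells A X).card ^ k := h1
          _ ≤ max 1 (cells A X).card ^ k := Nat.pow_le_pow_left h2 k
          _ ≤ _ := Nat.pow_le_pow_right (by simp) (Nat.le_of_lt_succ (mem_range.1 hk))
    _ = _ := by rw [Finset.sum_const, card_range, smul_eq_mul]

lemma decomp_partII (H : Regime ε A X) : Decomp (IsPiece 4 5 ε A X Y)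
    ((largeSets ε A X).card * (cells A X).card) (toFun (partII ε A X Y)) := by
  rw [partII, toFun_sum]
  refine Decomp.sum _ _ fun S hS => decomp_mul_res_offCells fun j hj => ?_
  obtain ⟨h1, h2, h3, h4⟩ := selected_spec H hS
  have h5 := h1.trans (largeSets_subset hS)
  have hα : Dom (cellProd A X (selected ε A X S)) (4 * constOne ^ 1) :=
    dom_four_mul (by rw [pow_one]; exact dom_cellProd_constOne H h5)
  -- Six factors: one for the remaining cells, three for the weights, one for the smooth part and
  -- one for `constOne`.
  have hU : Dom (cofactorII ε A X S) (4 * constOne ^ 6) := by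
    have e : (4 * constOne ^ 6 : AF) = constOne * (4 * constOne ^ 3 * constOne * constOne) := by
      ring
    rw [e]
    refine Dom.neg_one_pow_mul _ ((dom_cellProd_constOne H
      (Finset.sdiff_subset.trans (largeSets_subset hS))).mul ?_)
    exact (((dom_weightTotal H).trans dom_weightBar).mul
      (dom_muSmooth.trans dom_smoothBar_constOne)).mul dom_constOne
  exact Or.inr (Or.inr (isTypeII_of H h5 h2 h3 h4 hα (by norm_num) hU le_rfl hj))

end HarmanMinorant

/-! ### The remainder and the conclusion for large `X`. -/

namespace HarmanMinorant

open Finset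

variable {ε A X Y : ℝ} {n : ℕ}

lemma GoodAt.rhoMinus_eq_parts (G : GoodAt ε A X Y n) (H : Regime ε A X) :
    rhoMinus ε X n = partI ε A X Y n + partI_II ε A X Y n + partII ε A X Y n := by
  rw [G.rhoMinus_eq H, partI_eq H G, partI_II_eq H G, partII_eq H G,
    ← ArithmeticFunction.add_apply, ← ArithmeticFunction.add_apply, coeffI, smallMu]
  congr 1
  ring

/-- The difference between the minorant and the sum of the pieces. -/
noncomputable def remainder (ε A X Y : ℝ) (n : ℕ) : ℝ :=
  (if Y / 2 < n ∧ (n : ℝ) ≤ 4 * Y then rhoMinus ε X n else 0) -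
    (partI ε A X Y n + partI_II ε A X Y n + partII ε A X Y n)

lemma remainder_eq_zero (H : Regime ε A X)
    (h : ¬ ((Y / 2 < n ∧ (n : ℝ) ≤ 4 * Y) ∧ ¬ GoodAt ε A X Y n)) :
    remainder ε A X Y n = 0 := by
  rw [remainder]
  by_cases hn : Y / 2 < n ∧ (n : ℝ) ≤ 4 * Y
  · have G : GoodAt ε A X Y n := by
      by_contra hG
      exact h ⟨hn, hG⟩
    rw [if_pos hn, G.rhoMinus_eq_parts H, sub_self]
  · rw [if_neg hn, partI_eq_zero H hn, partI_II_eq_zero H hn, partII_eq_zero H hn]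
    simp

/-- Four terms share the majorant, and `624 = 4 * 156`. -/
lemma abs_remainder_le (H : Regime ε A X) (hn : n ≠ 0) (hnX : (n : ℝ) ≤ 2 * X) :
    |remainder ε A X Y n| ≤ 624 * (n.divisors.card : ℝ) := by
  have h0 := majorant_apply_le H hn hnX
  have h1 := dom_partI (Y := Y) H n
  have h2 := dom_partI_II (Y := Y) H n
  have h3 := dom_partII (Y := Y) H n
  have h4 : |if Y / 2 < n ∧ (n : ℝ) ≤ 4 * Y then rhoMinus ε X n else 0| ≤ majorant X n := by
    split_ifs
    · exact abs_rhoMinus_le H hn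
    · rw [abs_zero]; exact (abs_nonneg _).trans h1
  rw [remainder]
  have h5 := abs_sub (if Y / 2 < n ∧ (n : ℝ) ≤ 4 * Y then rhoMinus ε X n else 0)
    (partI ε A X Y n + partI_II ε A X Y n + partII ε A X Y n)
  have h6 := abs_add_le (partI ε A X Y n + partI_II ε A X Y n) (partII ε A X Y n)
  have h7 := abs_add_le (partI ε A X Y n) (partI_II ε A X Y n)
  linarith

open Classical in
/-- The integers at which the decomposition need not be exact. -/
noncomputable def badSet (ε A X Y : ℝ) : Finset ℕ :=
  (Icc 1 ⌊8 * Y⌋₊).filter fun n : ℕ => (Y / 2 < n ∧ (n : ℝ) ≤ 4 * Y) ∧ ¬ GoodAt ε A X Y n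

/-- Since `Y` exceeds `z₀ ≥ 1 / δ`, the additive `1` in counting integers of a short interval is
absorbed. -/
lemma Regime.one_le_delta_mul (H : Regime ε A X) (hY : X ^ (1 - ε / 100) < Y) :
    1 ≤ delta A X * Y := by
  have h1 : zLevel X ≤ X ^ (1 - ε / 100) :=
    Real.rpow_le_rpow_of_exponent_le H.one_lt_X.le (by linarith [H.eps_le])
  have h2 := H.inv_z₀_le
  have h3 := H.z₀_pos
  have hδ := H.delta_pos
  rw [div_le_iff₀ h3] at h2
  exact h2.trans (mul_le_mul_of_nonneg_left (by linarith [H.z₀_lt]) hδ.le)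

lemma one_add_log_floor_le (H : Regime ε A X) (hYpos : 0 < Y) (hY' : Y ≤ X / 2) :
    1 + Real.log ⌊8 * Y⌋₊ ≤ 2 * Real.log X := by
  have hL := H.log_ge
  rcases Nat.eq_zero_or_pos ⌊8 * Y⌋₊ with h | h
  · rw [h]; simp; linarith
  have h1 : (⌊8 * Y⌋₊ : ℝ) ≤ 2 * (2 * X) := (Nat.floor_le (by positivity)).trans (by linarith)
  have h2 := Real.log_le_log (by exact_mod_cast h) h1
  rw [Real.log_mul two_ne_zero (by linarith [H.X_pos]), Real.log_mul two_ne_zero H.X_pos.ne'] at h2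
  linarith [Real.log_two_lt_d9]

/-- Three window conditions cost `112` each, the smooth divisors `8`, and the strips at the two ends
`2` and `9`; the total `355` is rounded up. -/
lemma card_badSet_le (H : Regime ε A X) (hY : X ^ (1 - ε / 100) < Y) (hY' : Y ≤ X / 2) :
    ((badSet ε A X Y).card : ℝ) ≤ 400 * (delta A X * Real.log X * Y) := by
  classical
  have hX := H.X_pos
  have hYpos : 0 < Y := (Real.rpow_pos_of_pos hX _).trans hY
  have hL := H.log_ge
  have hδ := H.delta_pos
  have hδ1 := H.delta_le
  have hz := H.z₀_pos
  set δ := delta A X with hδdef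
  set L := Real.log X with hLdef
  set N := ⌊8 * Y⌋₊ with hN
  have hNY : (N : ℝ) ≤ 8 * Y := Nat.floor_le (by positivity)
  have hlogN : 1 + Real.log N ≤ 2 * L := one_add_log_floor_le H hYpos hY'
  set r := (1 + δ) ^ ⌊L⌋₊ with hr
  have hr1 : 1 ≤ r := one_le_pow₀ (by linarith)
  have hr2 : r ≤ 1 + 2 * (δ * L) := H.ratio_pow_le
  have h1 : 1 ≤ δ * Y := H.one_le_delta_mul hY
  have h1' : 1 ≤ δ * L * Y := by nlinarith
  have hpow : (1 + δ) ^ 5 - 1 ≤ 6 * δ := by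
    have e : (1 + δ) ^ 5 - 1 = δ * (5 + δ * (10 + 10 * δ + 5 * δ ^ 2 + δ ^ 3)) := by ring
    rw [e, mul_comm 6]
    refine mul_le_mul_of_nonneg_left ?_ hδ.le
    have a1 : δ ^ 2 ≤ 1 := by nlinarith
    have a2 : δ ^ 3 ≤ 1 := by
      calc δ ^ 3 = δ * δ ^ 2 := by ring
        _ ≤ 1 * 1 := by gcongr; linarith
        _ = 1 := by norm_num
    nlinarith
  have hwin : ∀ u : ℕ → ℝ, (((Icc 1 N).filter
      (HasWindowDivisor (z₀Level X) ((1 + δ) ^ 5) u)).card : ℝ) ≤ 112 * (δ * L * Y) := by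
    intro u
    refine (card_hasWindowDivisor_le N u hz (one_le_pow₀ (by linarith))).trans ?_
    have h2 := H.inv_z₀_le
    have h3 : 0 ≤ (1 + δ) ^ 5 - 1 := by
      have : 1 ≤ (1 + δ) ^ 5 := one_le_pow₀ (by linarith)
      linarith
    have h4 : 0 < 1 / z₀Level X := by positivity
    calc (N : ℝ) * ((1 + Real.log N) * ((1 + δ) ^ 5 - 1 + 1 / z₀Level X))
        ≤ 8 * Y * (2 * L * (6 * δ + δ)) := by gcongr
      _ = _ := by ring
  have hsm : (((Icc 1 N).filter
      (HasLargeDivisor (primesIoc 0 (z₀Level X)) (X ^ (ε / 4)))).card : ℝ) ≤ 8 * (δ * L * Y) := by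
    refine (card_hasLargeDivisor_le N (y := z₀Level X) (by linarith [H.two_le_z₀])
      (Real.rpow_pos_of_pos hX _) _ fun p hp => ?_).trans ?_
    · exact ⟨(mem_primesIoc.1 hp).1, (mem_primesIoc.1 hp).2.2⟩
    · calc _ ≤ (N : ℝ) * δ := mul_le_mul_of_nonneg_left H.smooth_le (Nat.cast_nonneg _)
        _ ≤ 8 * Y * (δ * L) := by
            gcongr
            nlinarith
        _ = _ := by ring
  have hlow : (((Icc 1 N).filter fun n : ℕ => Y / 2 < n ∧ (n : ℝ) ≤ r * (Y / 2)).card : ℝ) ≤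
      2 * (δ * L * Y) := by
    refine (card_filter_Ioc_le N (by nlinarith) (by positivity)).trans ?_
    nlinarith
  have hup : (((Icc 1 N).filter fun n : ℕ => 4 * Y / r < n ∧ (n : ℝ) ≤ 4 * Y).card : ℝ) ≤
      9 * (δ * L * Y) := by
    have hr0 : 0 < r := by linarith
    refine (card_filter_Ioc_le N (div_le_self (by positivity) hr1) (by positivity)).trans ?_
    have h5 : 4 * Y - 4 * Y / r ≤ 4 * Y * (r - 1) := by
      have e : 4 * Y - 4 * Y / r = 4 * Y * (r - 1) / r := by field_simp
      rw [e]
      exact div_le_self (mul_nonneg (by positivity) (by linarith)) hr1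
    nlinarith
  have hsub : badSet ε A X Y ⊆
      ((Icc 1 N).filter (HasLargeDivisor (primesIoc 0 (z₀Level X)) (X ^ (ε / 4))) ∪
        (Icc 1 N).filter (HasWindowDivisor (z₀Level X) ((1 + δ) ^ 5) (fun a => a)) ∪
        (Icc 1 N).filter (HasWindowDivisor (z₀Level X) ((1 + δ) ^ 5)
          (fun a => X ^ (1 - 2 * ε) / (a : ℝ) ^ 4 / (1 + δ) ^ 5))) ∪
      ((Icc 1 N).filter (HasWindowDivisor (z₀Level X) ((1 + δ) ^ 5)
          (fun _ => zLevel X / (1 + δ))) ∪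
        (Icc 1 N).filter (fun n : ℕ => Y / 2 < n ∧ (n : ℝ) ≤ r * (Y / 2)) ∪
        (Icc 1 N).filter (fun n : ℕ => 4 * Y / r < n ∧ (n : ℝ) ≤ 4 * Y)) := by
    intro n hn
    obtain ⟨hnN, ⟨h2, h3⟩, hG⟩ := mem_filter.1 hn
    by_contra hcon
    replace hnN : n ∈ Icc 1 N := hnN
    simp only [mem_union, mem_filter, hnN, true_and, not_or] at hcon
    obtain ⟨⟨⟨c1, c2⟩, c3⟩, ⟨c4, c5⟩, c6⟩ := hcon
    refine hG ⟨by have := (mem_Icc.1 hnN).1; omega, by linarith, ?_, ?_, c1, c2, c3, c4⟩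
    · by_contra h
      exact c5 ⟨h2, not_lt.1 h⟩
    · by_contra h
      refine c6 ⟨?_, h3⟩
      rw [div_lt_iff₀ (by linarith), mul_comm (n : ℝ) r]
      exact not_le.1 h
  have hcard := Finset.card_le_card hsub
  have u1 := Finset.card_union_le
    ((Icc 1 N).filter (HasLargeDivisor (primesIoc 0 (z₀Level X)) (X ^ (ε / 4))) ∪
        (Icc 1 N).filter (HasWindowDivisor (z₀Level X) ((1 + δ) ^ 5) (fun a => a)) ∪
        (Icc 1 N).filter (HasWindowDivisor (z₀Level X) ((1 + δ) ^ 5)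
          (fun a => X ^ (1 - 2 * ε) / (a : ℝ) ^ 4 / (1 + δ) ^ 5)))
    ((Icc 1 N).filter (HasWindowDivisor (z₀Level X) ((1 + δ) ^ 5)
          (fun _ => zLevel X / (1 + δ))) ∪
        (Icc 1 N).filter (fun n : ℕ => Y / 2 < n ∧ (n : ℝ) ≤ r * (Y / 2)) ∪
        (Icc 1 N).filter (fun n : ℕ => 4 * Y / r < n ∧ (n : ℝ) ≤ 4 * Y))
  have u2 := Finset.card_union_le
    ((Icc 1 N).filter (HasLargeDivisor (primesIoc 0 (z₀Level X)) (X ^ (ε / 4))) ∪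
        (Icc 1 N).filter (HasWindowDivisor (z₀Level X) ((1 + δ) ^ 5) (fun a => a)))
    ((Icc 1 N).filter (HasWindowDivisor (z₀Level X) ((1 + δ) ^ 5)
          (fun a => X ^ (1 - 2 * ε) / (a : ℝ) ^ 4 / (1 + δ) ^ 5)))
  have u3 := Finset.card_union_le
    ((Icc 1 N).filter (HasLargeDivisor (primesIoc 0 (z₀Level X)) (X ^ (ε / 4))))
    ((Icc 1 N).filter (HasWindowDivisor (z₀Level X) ((1 + δ) ^ 5) (fun a => a)))
  have u4 := Finset.card_union_le
    ((Icc 1 N).filter (HasWindowDivisor (z₀Level X) ((1 + δ) ^ 5)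
          (fun _ => zLevel X / (1 + δ))) ∪
        (Icc 1 N).filter (fun n : ℕ => Y / 2 < n ∧ (n : ℝ) ≤ r * (Y / 2)))
    ((Icc 1 N).filter (fun n : ℕ => 4 * Y / r < n ∧ (n : ℝ) ≤ 4 * Y))
  have u5 := Finset.card_union_le
    ((Icc 1 N).filter (HasWindowDivisor (z₀Level X) ((1 + δ) ^ 5)
          (fun _ => zLevel X / (1 + δ))))
    ((Icc 1 N).filter (fun n : ℕ => Y / 2 < n ∧ (n : ℝ) ≤ r * (Y / 2)))
  have w1 := hwin (fun a => a)
  have w2 := hwin (fun a => X ^ (1 - 2 * ε) / (a : ℝ) ^ 4 / (1 + δ) ^ 5)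
  have w3 := hwin (fun _ => zLevel X / (1 + δ))
  have htot : ((badSet ε A X Y).card : ℝ) ≤ _ :=
    Nat.cast_le.2 (hcard.trans (u1.trans (add_le_add (u2.trans (add_le_add u3 le_rfl))
      (u4.trans (add_le_add u5 le_rfl)))))
  push_cast at htot
  linarith

lemma sum_remainder_sq_le (H : Regime ε A X) (hY : X ^ (1 - ε / 100) < Y) (hY' : Y ≤ X / 2) :
    ∑ n ∈ range (⌊8 * Y⌋₊ + 1), ‖(remainder ε A X Y n : ℂ)‖ ^ 2 ≤
      624 ^ 2 * 2 ^ 14 * (Y / Real.log X ^ A) := by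
  classical
  have hX := H.X_pos
  have hYpos : 0 < Y := (Real.rpow_pos_of_pos hX _).trans hY
  have hL := H.log_ge
  have hL0 : 0 < Real.log X := H.log_pos
  set L := Real.log X with hLdef
  have hbad : badSet ε A X Y ⊆ Icc 1 ⌊8 * Y⌋₊ := Finset.filter_subset _ _
  have h1 : ∑ n ∈ range (⌊8 * Y⌋₊ + 1), ‖(remainder ε A X Y n : ℂ)‖ ^ 2 =
      ∑ n ∈ badSet ε A X Y, (remainder ε A X Y n) ^ 2 := by
    symm
    have h2 : badSet ε A X Y ⊆ range (⌊8 * Y⌋₊ + 1) := fun n hn =>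
      mem_range.2 (Nat.lt_succ_of_le (mem_Icc.1 (hbad hn)).2)
    rw [← Finset.sum_subset h2]
    · refine Finset.sum_congr rfl fun n _ => ?_
      rw [Complex.norm_real, Real.norm_eq_abs, sq_abs]
    · intro n hn hnb
      have : remainder ε A X Y n = 0 := by
        refine remainder_eq_zero H fun h => hnb (mem_filter.2 ⟨mem_Icc.2 ⟨?_, ?_⟩, h⟩)
        · have : (0 : ℝ) < n := by linarith [h.1.1]
          exact_mod_cast this
        · exact Nat.le_of_lt_succ (mem_range.1 hn)
      rw [this]; simp
  have h2 : ∑ n ∈ badSet ε A X Y, (remainder ε A X Y n) ^ 2 ≤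
      624 ^ 2 * ∑ n ∈ badSet ε A X Y, (n.divisors.card : ℝ) ^ 2 := by
    rw [Finset.mul_sum]
    refine Finset.sum_le_sum fun n hn => ?_
    obtain ⟨h3, h4, -⟩ := mem_filter.1 hn
    have h5 := abs_remainder_le (Y := Y) H (n := n) (by have := (mem_Icc.1 h3).1; omega)
      (by linarith)
    rw [← mul_pow, ← sq_abs]
    gcongr
  have h3 : ∑ n ∈ badSet ε A X Y, (n.divisors.card : ℝ) ^ 2 ≤ 2 ^ 14 * (Y / L ^ A) := by
    refine abs_le_of_sq_le_sq' ?_ (by positivity) |>.2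
    refine (sum_divisors_card_sq_le _ _ hbad).trans ?_
    have h4 := card_badSet_le H hY hY'
    have h5 : (⌊8 * Y⌋₊ : ℝ) ≤ 8 * Y := Nat.floor_le (by positivity)
    have h6 := one_add_log_floor_le H hYpos hY'
    have h7 : 0 ≤ 1 + Real.log ⌊8 * Y⌋₊ := by
      rcases Nat.eq_zero_or_pos ⌊8 * Y⌋₊ with h | h
      · rw [h]; simp
      · have := Real.log_nonneg (show (1 : ℝ) ≤ ⌊8 * Y⌋₊ by exact_mod_cast h)
        linarith
    have hδ := H.delta_pos
    -- The exponent is `17 - 10 A + 2 A`, negative for `A ≥ 5`. The `17` consists of `16` from the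
    -- fourth moment of `d` and `1` from `badSet`.
    have h8 : delta A X * L ^ 17 ≤ 1 / (L ^ A) ^ 2 := by
      rw [le_div_iff₀ (by positivity), delta, ← hLdef, ← Real.rpow_natCast L 17,
        ← Real.rpow_natCast (L ^ A) 2, ← Real.rpow_mul hL0.le, ← Real.rpow_add hL0,
        ← Real.rpow_add hL0]
      refine Real.rpow_le_one_of_one_le_of_nonpos (by linarith) ?_
      push_cast
      linarith [H.A_ge]
    calc ((badSet ε A X Y).card : ℝ) * (⌊8 * Y⌋₊ * (1 + Real.log ⌊8 * Y⌋₊) ^ 16)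
        ≤ 400 * (delta A X * L * Y) * (8 * Y * (2 * L) ^ 16) := by gcongr
      _ = 209715200 * Y ^ 2 * (delta A X * L ^ 17) := by ring
      _ ≤ 209715200 * Y ^ 2 * (1 / (L ^ A) ^ 2) := by gcongr
      _ = 209715200 * (Y / L ^ A) ^ 2 := by rw [div_pow]; ring
      _ ≤ (2 ^ 14) ^ 2 * (Y / L ^ A) ^ 2 := by gcongr; norm_num
      _ = _ := by rw [mul_pow]
  rw [h1]
  calc _ ≤ _ := h2
    _ ≤ 624 ^ 2 * (2 ^ 14 * (Y / L ^ A)) := by gcongr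
    _ = _ := by ring

/-- The conclusion of the theorem for given values of the parameters. -/
def HasDecomposition (C K : ℝ) (B : ℕ) (C_A ε A X Y : ℝ) : Prop :=
  ∃ (F : Finset (ℕ → ℂ)) (c : ℕ → ℂ),
    (F.card : ℝ) ≤ C * Real.exp (Real.log (Real.log X) ^ 5) ∧
    (∀ n : ℕ, (if Y / 2 < (n : ℝ) ∧ (n : ℝ) ≤ 4 * Y then (rhoMinus ε X n : ℂ) else 0) =
      (∑ f ∈ F, f n) + c n) ∧
    (∀ n : ℕ, c n ≠ 0 → Y / 4 < (n : ℝ) ∧ (n : ℝ) ≤ 8 * Y) ∧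
    ∑ n ∈ Finset.range (⌊8 * Y⌋₊ + 1), ‖c n‖ ^ 2 ≤ C_A * (Y / Real.log X ^ A) ∧
    ∀ f ∈ F, IsPiece K B ε A X Y f

lemma hasDecomposition_of_regime (H : Regime ε A X) (hY : X ^ (1 - ε / 100) < Y)
    (hY' : Y ≤ X / 2) {C_A : ℝ} (hC : 624 ^ 2 * 2 ^ 14 ≤ C_A) :
    HasDecomposition 1 4 5 C_A ε A X Y := by
  have hX := H.X_pos
  have hYpos : 0 < Y := (Real.rpow_pos_of_pos hX _).trans hY
  have hL0 : 0 < Real.log X := H.log_pos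
  obtain ⟨F, hF1, hF2, hF3⟩ := (((decomp_partI (Y := Y) H).add (decomp_partI_II (Y := Y) H)).add
    (decomp_partII (Y := Y) H)).exists_finset fun f hf s hs => hf.mul_const hs
  refine ⟨F, fun n => remainder ε A X Y n, ?_, fun n => ?_, fun n hn => ?_, ?_, hF2⟩
  · rw [one_mul]
    refine le_trans ?_ H.count_le
    have hc0 : 1 ≤ (cells A X).card := Finset.card_pos.2 ⟨cell A X 1,
      H.cell_mem_cells le_rfl (by linarith [H.one_lt_X])⟩
    have hl := card_largeSets_le H
    rw [max_eq_right hc0] at hl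
    have hM := H.card_cells_le
    set c := (cells A X).card with hc
    have h1 : F.card ≤ 2 * (c ^ 2 + c ^ 5 + (maxFactors X + 1) * c ^ maxFactors X * c) := by
      refine hF1.trans (Nat.mul_le_mul_left _ (add_le_add (add_le_add ?_ le_rfl) ?_))
      · rw [sq]
      · exact Nat.mul_le_mul_right _ hl
    have h2 : (F.card : ℝ) ≤
        2 * ((c : ℝ) ^ 2 + (c : ℝ) ^ 5 + (maxFactors X + 1) * (c : ℝ) ^ maxFactors X * c) := by
      exact_mod_cast h1
    refine h2.trans ?_
    have hM0 : 0 ≤ cellBound A X := (Nat.cast_nonneg c).trans hM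
    gcongr
  · have h := congrFun hF3 n
    rw [Finset.sum_apply] at h
    rw [h]
    simp only [remainder, toFun, Pi.add_apply]
    split_ifs <;> push_cast <;> ring
  · have h : ¬ remainder ε A X Y n = 0 := fun h0 => hn (by simp [h0])
    have h' := mt (remainder_eq_zero (n := n) (Y := Y) H) h
    rw [not_not] at h'
    constructor <;> linarith [h'.1.1, h'.1.2]
  · refine (sum_remainder_sq_le H hY hY').trans ?_
    have : 0 < Y / Real.log X ^ A := by positivity
    gcongr

/-! ### Bounded `X` and the theorem. -/

/-- A bound for the minorant that does not depend on the parameters. -/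
noncomputable def crudeBound (n : ℕ) : ℝ :=
  1 + n.divisorsAntidiagonal.card + (Nat.finMulAntidiag 3 n).card +
    (Nat.finMulAntidiag 4 n).card

lemma abs_sum_rho_le {ι : Type*} (s : Finset ι) (p : ι → Prop) [DecidablePred p] (g : ι → ℕ)
    (z : ℝ) : |∑ t ∈ s.filter p, rho (g t) z| ≤ s.card := by
  calc |∑ t ∈ s.filter p, rho (g t) z| ≤ ∑ t ∈ s.filter p, (1 : ℝ) :=
        (Finset.abs_sum_le_sum_abs _ _).trans (Finset.sum_le_sum fun t _ => by
          rw [abs_of_nonneg (rho_nonneg _ _)]; exact rho_le_one _ _)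
    _ = ((s.filter p).card : ℝ) := by simp
    _ ≤ _ := by exact_mod_cast Finset.card_filter_le _ _

lemma abs_rhoMinus_le_crudeBound (ε X : ℝ) (n : ℕ) : |rhoMinus ε X n| ≤ crudeBound n := by
  have h0 : |rho n (zLevel X)| ≤ 1 := by
    rw [abs_of_nonneg (rho_nonneg _ _)]; exact rho_le_one _ _
  have h1 : |rhoSum₁ X n| ≤ n.divisorsAntidiagonal.card := abs_sum_rho_le _ _ _ _
  have h2 : |rhoSum₂ ε X n| ≤ (Nat.finMulAntidiag 3 n).card := abs_sum_rho_le _ _ _ _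
  have h3 : |rhoSum₃ ε X n| ≤ (Nat.finMulAntidiag 4 n).card := abs_sum_rho_le _ _ _ _
  rw [rhoMinus, crudeBound, abs_le]
  rw [abs_le] at h0 h1 h2 h3
  constructor <;> linarith

/-- For bounded `X` the minorant itself may serve as the remainder. -/
lemma hasDecomposition_of_le {X₀ C_A : ℝ} (hε : 0 < ε) (hε' : ε ≤ 1 / 100) (hA : 5 ≤ A)
    (hX : 3 ≤ X) (hX₀ : X ≤ X₀) (hY : X ^ (1 - ε / 100) < Y) (hY' : Y ≤ X / 2)
    (hC : (∑ n ∈ range (⌊4 * X₀⌋₊ + 1), crudeBound n ^ 2) * Real.log X₀ ^ A ≤ C_A) :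
    HasDecomposition 1 4 5 C_A ε A X Y := by
  have hX1 : 1 < X := by linarith
  -- This lets the final bound drop to a constant independent of `Y`.
  have hY1 : 1 ≤ Y := (Real.one_le_rpow hX1.le (by linarith)).trans hY.le
  have hL : 0 < Real.log X := Real.log_pos hX1
  refine ⟨∅, fun n => if Y / 2 < (n : ℝ) ∧ (n : ℝ) ≤ 4 * Y then (rhoMinus ε X n : ℂ) else 0,
    ?_, fun n => by simp, fun n hn => ?_, ?_, by simp⟩
  · simp only [Finset.card_empty, CharP.cast_eq_zero, one_mul]
    exact (Real.exp_pos _).le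
  · by_cases h : Y / 2 < (n : ℝ) ∧ (n : ℝ) ≤ 4 * Y
    · constructor <;> linarith [h.1, h.2]
    · exact absurd (if_neg h) hn
  · set S := ∑ n ∈ range (⌊4 * X₀⌋₊ + 1), crudeBound n ^ 2 with hS
    have hS0 : 0 ≤ S := Finset.sum_nonneg fun n _ => sq_nonneg _
    have h1 : ∑ n ∈ range (⌊8 * Y⌋₊ + 1),
        ‖(if Y / 2 < (n : ℝ) ∧ (n : ℝ) ≤ 4 * Y then (rhoMinus ε X n : ℂ) else 0)‖ ^ 2 ≤ S := by
      refine le_trans (Finset.sum_le_sum (g := fun n => crudeBound n ^ 2) fun n _ => ?_) ?_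
      · have h2 := abs_rhoMinus_le_crudeBound ε X n
        split_ifs
        · rw [Complex.norm_real, Real.norm_eq_abs]
          gcongr
        · simpa using sq_nonneg (crudeBound n)
      · refine Finset.sum_le_sum_of_subset_of_nonneg ?_ fun n _ _ => sq_nonneg _
        refine Finset.range_subset_range.2 (Nat.succ_le_succ (Nat.floor_mono ?_))
        linarith
    refine h1.trans ?_
    have h3 : Real.log X ^ A ≤ Real.log X₀ ^ A := by
      have := Real.log_le_log (by linarith) hX₀
      exact Real.rpow_le_rpow hL.le this (by linarith)
    have h4 : 0 < Real.log X ^ A := Real.rpow_pos_of_pos hL _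
    rw [mul_div_assoc', le_div_iff₀ h4]
    have hC0 : 0 ≤ C_A := le_trans (mul_nonneg hS0 (h4.le.trans h3)) hC
    calc S * Real.log X ^ A ≤ S * Real.log X₀ ^ A := by gcongr
      _ ≤ C_A := hC
      _ ≤ C_A * Y := le_mul_of_one_le_right hC0 hY1

end HarmanMinorant

theorem mainTheorem6 :
    ∃ ε₀ : ℝ, 0 < ε₀ ∧ ∀ ε : ℝ, 0 < ε → ε ≤ ε₀ →
      ∃ (C K : ℝ) (B : ℕ), ∀ A : ℝ, 5 ≤ A → ∃ C_A : ℝ,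
        ∀ X Y : ℝ, 3 ≤ X → X ^ (1 - ε / 100) < Y → Y ≤ X / 2 →
          ∃ (F : Finset (ℕ → ℂ)) (c : ℕ → ℂ),
            (F.card : ℝ) ≤ C * Real.exp (Real.log (Real.log X) ^ 5) ∧
            (∀ n : ℕ,
              (if Y / 2 < (n : ℝ) ∧ (n : ℝ) ≤ 4 * Y
                then (HarmanMinorant.rhoMinus ε X n : ℂ) else 0) = (∑ f ∈ F, f n) + c n) ∧
            (∀ n : ℕ, c n ≠ 0 → Y / 4 < (n : ℝ) ∧ (n : ℝ) ≤ 8 * Y) ∧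
            ∑ n ∈ Finset.range (⌊8 * Y⌋₊ + 1), ‖c n‖ ^ 2 ≤ C_A * (Y / Real.log X ^ A) ∧
            ∀ f ∈ F, HarmanMinorant.IsTypeI K B ε A X Y f ∨
              HarmanMinorant.IsTypeI_II K B ε A X Y f ∨
              HarmanMinorant.IsTypeII K B ε A X Y f := by
  refine ⟨1 / 100, by norm_num, fun ε hε hε' => ⟨1, 4, 5, fun A hA => ?_⟩⟩
  -- The threshold depends only on `ε` and `A`, so both constants in the maximum below are
  -- admissible values of `C_A`.
  obtain ⟨X₀, hX₀⟩ := Filter.eventually_atTop.1 (HarmanMinorant.eventually_regime hε hε' hA)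
  refine ⟨max (624 ^ 2 * 2 ^ 14)
    ((∑ n ∈ Finset.range (⌊4 * X₀⌋₊ + 1), HarmanMinorant.crudeBound n ^ 2) * Real.log X₀ ^ A),
    fun X Y hX hY hY' => ?_⟩
  rcases le_total X₀ X with h | h
  · exact HarmanMinorant.hasDecomposition_of_regime (hX₀ X h) hY hY' (le_max_left _ _)
  · exact HarmanMinorant.hasDecomposition_of_le hε hε' hA hX h hY hY' (le_max_right _ _)
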